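/- For an integer $N\ge 2$ put $\omega=2\pi/N$ and $I_N=\{k\in\mathbb Z:\ -\lceil N/2\rceil+1\le k\le\lfloor N/2\rfloor\}$, and label the coordinates of vectors in $\mathbb R^N$ and $\mathbb C^N$ by $I_N$. Let $\|\cdot\|$ be the Euclidean norm, let $\mathscr F$ be the discrete Fourier transform $(\mathscr F\mathbf a)(l)=N^{-1/2}\sum_{k\in I_N}e^{-i\omega kl}\mathbf a(k)$, $l\in I_N$, and let the width of a non-zero vector $\mathbf a$ be the largest $|k|$, $k\in I_N$, with $\mathbf a(k)\ne0$. An orthonormal basis $\mathbf T_0,\dots,\mathbf T_{N-1}$ of $\mathbb R^N$ is called a minimal Hermite-type basis if every $\mathbf T_n$ is an eigenvector of $\mathscr F$, with eigenvalue $(-i)^n$ when $0\le n<N-1$, and the width of $\mathbf T_n$ is at most $\lfloor (N+n+2)/4\rfloor$ for $0\le n<N$. Let $\psi_n(x)=(-1)^n(\sqrt\pi\,2^n n!)^{-1/2}e^{x^2/2}\frac{d^n}{dx^n}e^{-x^2}$, $n\ge0$, be the Hermite functions and let $\mathbf\Psi_n\in\mathbb R^N$ be the vector $\mathbf\Psi_n(k)=\omega^{1/4}\psi_n(\sqrt\omega\,k)$,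 $k\in I_N$. Then a minimal Hermite-type basis of $\mathbb R^N$ exists for every $N\ge2$. Moreover, given minimal Hermite-type bases $\{\mathbf T_n\}_{0\le n<N}$ of $\mathbb R^N$ for all $N\ge 2$, one can change the signs of some of the vectors $\mathbf T_n$ (the choice depending only on $N$ and $n$) in such a way that for every fixed $n\ge0$ and every $\epsilon>0$ $$\|\mathbf T_n-\mathbf\Psi_n\|=O(N^{-1+\epsilon})\qquad\text{as } N\to\infty .$$ -/

import Mathlib

namespace MinimalHermite

/-- The index set `I_N = {k ∈ ℤ : -⌈N/2⌉ + 1 ≤ k ≤ ⌊N/2⌋}`; the integer divisions round down, so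
`(N + 1) / 2` is `⌈N/2⌉` and `N / 2` is `⌊N/2⌋`. -/
noncomputable abbrev indexSet (N : ℕ) : Finset ℤ :=
  Finset.Icc (-(((N : ℤ) + 1) / 2) + 1) ((N : ℤ) / 2)

/-- The real vectors of length `N`, labelled by `I_N`, with the Euclidean norm. -/
abbrev Vec (N : ℕ) : Type :=
  EuclideanSpace ℝ (indexSet N)

/-- The step `ω = 2π / N`. -/
noncomputable def omega (N : ℕ) : ℝ :=
  2 * Real.pi / (N : ℝ)

/-- The centered unitary discrete Fourier transform of a complex vector labelled by `I_N`:
`b(l) = N^{-1/2} ∑_{k ∈ I_N} e^{-iωkl} a(k)`. -/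
noncomputable def dft (N : ℕ) (a : indexSet N → ℂ) (l : indexSet N) : ℂ :=
  (1 / (Real.sqrt (N : ℝ) : ℂ)) *
    ∑ k : indexSet N,
      Complex.exp (-Complex.I * (omega N : ℂ) * ((k : ℤ) : ℂ) * ((l : ℤ) : ℂ)) * a k

open Classical in
/-- The width of a vector: the largest `|k|`, `k ∈ I_N`, with `a(k) ≠ 0` (for the zero vector,
which has no width, the value is `0`). -/
noncomputable def width {N : ℕ} (a : Vec N) : ℕ :=
  (Finset.univ.filter fun k : indexSet N => a k ≠ 0).sup fun k => (k : ℤ).natAbs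

/-- An orthonormal basis `T_0, …, T_{N-1}` of `ℝ^N` is a minimal Hermite-type basis if every `T_n`
is an eigenvector of the discrete Fourier transform, the eigenvalue being `(-i)^n` when
`n < N - 1`, and the width of every `T_n` is at most `⌊(N + n + 2) / 4⌋`. -/
structure IsMinimalHermiteBasis {N : ℕ} (T : OrthonormalBasis (Fin N) ℝ (Vec N)) : Prop where
  eigen : ∀ n : Fin N, ∃ μ : ℂ, ((n : ℕ) + 1 < N → μ = (-Complex.I) ^ (n : ℕ)) ∧
    ∀ l : indexSet N, dft N (fun k => ((T n k : ℝ) : ℂ)) l = μ * ((T n l : ℝ) : ℂ)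
  width_le : ∀ n : Fin N, width (T n) ≤ (N + (n : ℕ) + 2) / 4

/-- The Hermite functions
`ψ_n(x) = (-1)^n (√π 2^n n!)^{-1/2} e^{x²/2} (d/dx)^n e^{-x²}`. -/
noncomputable def hermiteFun (n : ℕ) (x : ℝ) : ℝ :=
  (-1) ^ n * (Real.sqrt Real.pi * 2 ^ n * (n.factorial : ℝ)) ^ (-(1 / 2) : ℝ) *
    Real.exp (x ^ 2 / 2) * iteratedDeriv n (fun y : ℝ => Real.exp (-y ^ 2)) x

/-- The sampled Hermite functions `Ψ_n(k) = ω^{1/4} ψ_n(√ω k)`, `k ∈ I_N`. -/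
noncomputable def hermiteVec (N n : ℕ) : Vec N :=
  WithLp.toLp 2 fun k : indexSet N =>
    omega N ^ (1 / 4 : ℝ) * hermiteFun n (Real.sqrt (omega N) * ((k : ℤ) : ℝ))

end MinimalHermite

/-!
A doubly concentrated vector is one that vanishes, together with its discrete Fourier transform, at
the points `|k| > m`. These vectors form a space `W` (`biWidthSub`) which governs both claims.

*Dimension.* A polynomial argument (`eq_zero_of_consecutive`) bounds the dimension of `W` by
`4m + 2 - N`. If `T` is a minimal Hermite-type basis, then its first `4m + 2 - N` vectors lie in
`W`, hence they span it, and every other vector of the basis is orthogonal to `W`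
(`inner_eq_zero_of_mem_biWidthSub`).

*Explicit elements.* For `m = ⌊(N + n + 2) / 4⌋` and `p ≤ n` of the parity of `n`, the function
`windowFun N m p` lies in `W`. It is the product of `sin(ω j) ^ (p % 2)`, a power of
`sin²(ω j / 2)`, and the trigonometric polynomial `∏ (1 - sin²(ω j / 2) / sin²(ω i / 2))` over
`m < i ≤ topIndex N p`, which makes the whole vanish at the points `|j| > m`. The degree of the
whole as a trigonometric polynomial is at most `m`, so its transform vanishes at the frequencies
beyond `m`.

*Existence.* Combinations of such functions with their transforms are nonzero eigenvectors of the
required width for `n < 4` (`exists_eigenvector`). The operator `hermiteOp` commutes with the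
transform, so it preserves the eigenvalue, and it raises the width by one exactly; this takes `n`
to `n + 4`. The Gram–Schmidt process then produces the basis (`exists_isMinimalHermiteBasis`): it
affects neither the eigenvalues, as eigenvectors for different eigenvalues are orthogonal already,
nor the widths, as these increase strictly along each residue class modulo `4`. The last vector is
an eigenvector because the transform is symmetric, and needs no bound on its width.

*Approximation.* The product in `windowFun` is close to the Gaussian `exp (-ω j² / 2)`, since
`∑ 1 / sin²(ω i / 2)` over `m < i ≤ topIndex N p` is `2 / ω + O(1)`. Hence the scaled
`windowFun N m p` is `x ^ p exp (-x² / 2) + O(1 / N)` at `x = √ω j`, with Gaussian decay in the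
error (`exists_abs_windowFun_sub_le`), and linear combinations of these functions give an element of
`W` at the distance `O(1 / N)` from `Ψ_n` (`exists_mem_biWidthSub_norm_sub_le`).

*Convergence.* Poisson summation shows that the `Ψ_n` are orthonormal up to `O(1 / N)`
(`exists_abs_inner_hermiteVec_sub_le`) and are eigenvectors up to a smaller error
(`exists_norm_unitaryDft_hermiteVec_sub_le`). So `Ψ_n` is almost orthogonal to the `T_j`, `j ≠ n`:
for `j ≥ 4m + 2 - N`, a number at most `n + 4`, because an element of `W` is close to `Ψ_n`; for
`j ≢ n` modulo `4` because the eigenvalues differ; for `j < n` with `j ≡ n` modulo `4` by induction,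
as `T_j` is close to `± Ψ_j`. Therefore `Ψ_n` is within `O(1 / N)` of a multiple of `T_n`, and as
both are nearly unit vectors, of `± T_n`. The error bound obtained is `O(N ^ (-1))`, without the
loss of `ε`.
-/

namespace MinimalHermite

lemma mem_indexSet_iff {N : ℕ} (k : ℤ) : k ∈ indexSet N ↔ k * 2 ∈ Set.Ioc (-N : ℤ) N := by
  simp only [Finset.mem_Icc, Set.mem_Ioc]
  omega

/-! ### The discrete Fourier transform on `ZMod N` -/

section ZModTransform

variable {N : ℕ} [NeZero N]

/-- The unitary discrete Fourier transform of functions on `ZMod N`. -/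
noncomputable def unitaryDft (N : ℕ) [NeZero N] : (ZMod N → ℂ) →ₗ[ℂ] (ZMod N → ℂ) :=
  (1 / (Real.sqrt (N : ℝ) : ℂ)) • (ZMod.dft (N := N) (E := ℂ)).toLinearMap

lemma unitaryDft_apply (f : ZMod N → ℂ) (l : ZMod N) :
    unitaryDft N f l =
      (1 / (Real.sqrt (N : ℝ) : ℂ)) * ∑ j : ZMod N, ZMod.stdAddChar (-(j * l)) * f j := by
  simp [unitaryDft, ZMod.dft_apply]

lemma inv_sqrt_mul_self (N : ℕ) [NeZero N] :
    (1 / (Real.sqrt (N : ℝ) : ℂ)) * (1 / (Real.sqrt (N : ℝ) : ℂ)) = (N : ℂ)⁻¹ := by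
  rw [div_mul_div_comm, ← Complex.ofReal_mul, Real.mul_self_sqrt (Nat.cast_nonneg N)]
  simp

lemma unitaryDft_unitaryDft (f : ZMod N → ℂ) (j : ZMod N) :
    unitaryDft N (unitaryDft N f) j = f (-j) := by
  have hN : (N : ℂ) ≠ 0 := NeZero.ne _
  simp only [unitaryDft, LinearMap.smul_apply, LinearEquiv.coe_coe, map_smul, ZMod.dft_dft,
    Pi.smul_apply, smul_eq_mul]
  rw [← mul_assoc, inv_sqrt_mul_self, inv_mul_cancel_left₀ hN]

lemma sum_unitaryDft_mul (f g : ZMod N → ℂ) :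
    ∑ l, unitaryDft N f l * g l = ∑ l, f l * unitaryDft N g l := by
  simp only [unitaryDft_apply, Finset.mul_sum, Finset.sum_mul]
  rw [Finset.sum_comm]
  refine Finset.sum_congr rfl fun j _ => Finset.sum_congr rfl fun l _ => ?_
  rw [mul_comm j l]
  ring

/-- The transform of a modulated function is a translate of the transform. -/
lemma unitaryDft_char_mul (f : ZMod N → ℂ) (a l : ZMod N) :
    unitaryDft N (fun j => ZMod.stdAddChar (a * j) * f j) l = unitaryDft N f (l - a) := by
  simp only [unitaryDft_apply]
  congr 1
  refine Finset.sum_congr rfl fun j _ => ?_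
  rw [← mul_assoc, ← AddChar.map_add_eq_mul]
  congr 2
  ring

/-- The transform of a translate is a modulation of the transform. -/
lemma unitaryDft_translate (f : ZMod N → ℂ) (a l : ZMod N) :
    unitaryDft N (fun j => f (j + a)) l = ZMod.stdAddChar (a * l) * unitaryDft N f l := by
  simp only [unitaryDft_apply]
  rw [mul_left_comm]
  congr 1
  rw [Finset.mul_sum, ← Equiv.sum_comp (Equiv.addRight a)
    (fun j => ZMod.stdAddChar (a * l) * (ZMod.stdAddChar (-(j * l)) * f j))]
  refine Finset.sum_congr rfl fun j _ => ?_
  rw [← mul_assoc, ← AddChar.map_add_eq_mul]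
  simp only [Equiv.coe_addRight]
  congr 2
  ring

lemma stdAddChar_intCast (k : ℤ) :
    (ZMod.stdAddChar (k : ZMod N) : ℂ) = Complex.exp (Complex.I * (omega N * k : ℝ)) := by
  rw [ZMod.stdAddChar_coe, omega]
  congr 1
  push_cast
  ring

/-- The function `j ↦ cos (ω j)` on `ZMod N`. -/
noncomputable def cosFun (N : ℕ) (j : ZMod N) : ℝ := Real.cos (omega N * j.valMinAbs)

/-- The function `j ↦ sin (ω j)` on `ZMod N`. -/
noncomputable def sinFun (N : ℕ) (j : ZMod N) : ℝ := Real.sin (omega N * j.valMinAbs)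

lemma stdAddChar_eq (j : ZMod N) :
    (ZMod.stdAddChar j : ℂ) = cosFun N j + sinFun N j * Complex.I := by
  conv_lhs => rw [← ZMod.coe_valMinAbs j]
  rw [stdAddChar_intCast, mul_comm, Complex.exp_mul_I, cosFun, sinFun]
  push_cast
  ring

lemma stdAddChar_neg_eq (j : ZMod N) :
    (ZMod.stdAddChar (-j) : ℂ) = cosFun N j - sinFun N j * Complex.I := by
  have : -j = ((-j.valMinAbs : ℤ) : ZMod N) := by simp
  rw [this, stdAddChar_intCast, mul_comm, Complex.exp_mul_I, cosFun, sinFun]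
  push_cast
  rw [mul_neg, Complex.cos_neg, Complex.sin_neg]
  ring

lemma cosFun_neg (j : ZMod N) : cosFun N (-j) = cosFun N j := by
  have h1 := stdAddChar_eq (-j)
  rw [stdAddChar_neg_eq] at h1
  have := congrArg Complex.re h1
  simpa using this.symm

lemma sinFun_neg (j : ZMod N) : sinFun N (-j) = - sinFun N j := by
  have h1 := stdAddChar_eq (-j)
  rw [stdAddChar_neg_eq] at h1
  have := congrArg Complex.im h1
  simpa using this.symm

lemma cosFun_eq (j : ZMod N) :
    (cosFun N j : ℂ) = (ZMod.stdAddChar j + ZMod.stdAddChar (-j)) / 2 := by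
  rw [stdAddChar_eq, stdAddChar_neg_eq]; ring

lemma sinFun_eq (j : ZMod N) :
    (sinFun N j : ℂ) =
      -Complex.I / 2 * ZMod.stdAddChar j + Complex.I / 2 * ZMod.stdAddChar (-j) := by
  rw [stdAddChar_eq, stdAddChar_neg_eq]
  ring_nf
  rw [Complex.I_sq]
  ring

lemma unitaryDft_cos_mul (f : ZMod N → ℂ) (l : ZMod N) :
    unitaryDft N (fun j => cosFun N j * f j) l =
      (unitaryDft N f (l - 1) + unitaryDft N f (l + 1)) / 2 := by
  have h1 := unitaryDft_char_mul f 1 l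
  have h2 := unitaryDft_char_mul f (-1) l
  have : (fun j => (cosFun N j : ℂ) * f j) = (1 / 2 : ℂ) • (fun j => ZMod.stdAddChar (1 * j) * f j)
      + (1 / 2 : ℂ) • (fun j => ZMod.stdAddChar ((-1) * j) * f j) := by
    funext j
    simp only [Pi.add_apply, Pi.smul_apply, smul_eq_mul, cosFun_eq, one_mul, neg_mul]
    ring
  rw [this, map_add, map_smul, map_smul, Pi.add_apply, Pi.smul_apply, Pi.smul_apply, h1, h2,
    sub_neg_eq_add, smul_eq_mul, smul_eq_mul]
  ring

lemma unitaryDft_sin_mul (f : ZMod N → ℂ) (l : ZMod N) :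
    unitaryDft N (fun j => sinFun N j * f j) l =
      -Complex.I / 2 * unitaryDft N f (l - 1) + Complex.I / 2 * unitaryDft N f (l + 1) := by
  have h1 := unitaryDft_char_mul f 1 l
  have h2 := unitaryDft_char_mul f (-1) l
  have : (fun j => (sinFun N j : ℂ) * f j) =
      (-Complex.I / 2 : ℂ) • (fun j => ZMod.stdAddChar (1 * j) * f j)
      + (Complex.I / 2 : ℂ) • (fun j => ZMod.stdAddChar ((-1) * j) * f j) := by
    funext j
    simp only [Pi.add_apply, Pi.smul_apply, smul_eq_mul, sinFun_eq, one_mul, neg_mul]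
    ring
  rw [this, map_add, map_smul, map_smul, Pi.add_apply, Pi.smul_apply, Pi.smul_apply, h1, h2,
    sub_neg_eq_add, smul_eq_mul, smul_eq_mul]

lemma unitaryDft_average (f : ZMod N → ℂ) (l : ZMod N) :
    unitaryDft N (fun j => (f (j - 1) + f (j + 1)) / 2) l = cosFun N l * unitaryDft N f l := by
  have h1 := unitaryDft_translate f 1 l
  have h2 := unitaryDft_translate f (-1) l
  have : (fun j => (f (j - 1) + f (j + 1)) / 2) = (1 / 2 : ℂ) • (fun j => f (j + 1))
      + (1 / 2 : ℂ) • (fun j => f (j + -1)) := by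
    funext j
    simp only [Pi.add_apply, Pi.smul_apply, smul_eq_mul, sub_eq_add_neg]
    ring
  rw [this, map_add, map_smul, map_smul, Pi.add_apply, Pi.smul_apply, Pi.smul_apply, h1, h2,
    smul_eq_mul, smul_eq_mul, cosFun_eq, one_mul, neg_mul, one_mul]
  ring

/-- The operator `(L f)(j) = cos (ω j) f(j) + (f(j - 1) + f(j + 1)) / 2`, a discrete analogue of
the Hermite differential operator. -/
noncomputable def hermiteOp (N : ℕ) (f : ZMod N → ℝ) (j : ZMod N) : ℝ :=
  cosFun N j * f j + (f (j - 1) + f (j + 1)) / 2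

lemma unitaryDft_hermiteOp (f : ZMod N → ℝ) (μ : ℂ)
    (hf : ∀ l, unitaryDft N (fun j => (f j : ℂ)) l = μ * f l) (l : ZMod N) :
    unitaryDft N (fun j => (hermiteOp N f j : ℂ)) l = μ * hermiteOp N f l := by
  have : (fun j => (hermiteOp N f j : ℂ)) = (fun j => (cosFun N j : ℂ) * (f j : ℂ)) +
      fun j => ((f (j - 1) : ℂ) + (f (j + 1) : ℂ)) / 2 := by
    funext j
    simp [hermiteOp]
  rw [this, map_add, Pi.add_apply, unitaryDft_cos_mul,
    unitaryDft_average (fun j => (f j : ℂ)), hf, hf, hf, hermiteOp]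
  push_cast
  ring

/-! ### Vectors labelled by `I_N` as functions on `ZMod N` -/

/-- Every residue class modulo `N` has exactly one representative in `I_N`. -/
noncomputable def indexEquiv (N : ℕ) [NeZero N] : indexSet N ≃ ZMod N where
  toFun k := ((k : ℤ) : ZMod N)
  invFun j := ⟨j.valMinAbs, (mem_indexSet_iff _).2 j.valMinAbs_mem_Ioc⟩
  left_inv k := Subtype.ext ((ZMod.valMinAbs_spec _ _).2 ⟨rfl, (mem_indexSet_iff _).1 k.2⟩)
  right_inv j := ZMod.coe_valMinAbs j

lemma valMinAbs_indexEquiv (k : indexSet N) : (indexEquiv N k).valMinAbs = (k : ℤ) :=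
  congrArg Subtype.val ((indexEquiv N).symm_apply_apply k)

/-- The function on `ZMod N` given by a vector labelled by `I_N`. -/
noncomputable def zfun (a : Vec N) (j : ZMod N) : ℝ := a ((indexEquiv N).symm j)

/-- The vector labelled by `I_N` given by a function on `ZMod N`. -/
noncomputable def ofZfun (f : ZMod N → ℝ) : Vec N := WithLp.toLp 2 fun k => f (indexEquiv N k)

lemma zfun_apply_index (a : Vec N) (k : indexSet N) : zfun a (indexEquiv N k) = a k := by
  simp [zfun]

@[simp] lemma zfun_ofZfun (f : ZMod N → ℝ) : zfun (ofZfun f) = f := by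
  funext j; simp [zfun, ofZfun]

@[simp] lemma ofZfun_zfun (a : Vec N) : ofZfun (zfun a) = a := by
  ext k; simp [zfun, ofZfun]

lemma zfun_injective : Function.Injective (zfun (N := N)) :=
  Function.LeftInverse.injective ofZfun_zfun

@[simp] lemma zfun_add (a b : Vec N) : zfun (a + b) = zfun a + zfun b := by
  funext j; simp [zfun]

@[simp] lemma zfun_sub (a b : Vec N) : zfun (a - b) = zfun a - zfun b := by
  funext j; simp [zfun]

@[simp] lemma zfun_smul (c : ℝ) (a : Vec N) : zfun (c • a) = c • zfun a := by
  funext j; simp [zfun]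

lemma inner_eq_sum_zfun (a b : Vec N) : inner ℝ a b = ∑ j, zfun a j * zfun b j := by
  rw [PiLp.inner_apply, ← Equiv.sum_comp (indexEquiv N)]
  refine Finset.sum_congr rfl fun k _ => ?_
  rw [zfun_apply_index, zfun_apply_index]
  simp [mul_comm]

/-- The complex-valued function on `ZMod N` given by a real vector labelled by `I_N`. -/
noncomputable def czfun (a : Vec N) (j : ZMod N) : ℂ := (zfun a j : ℂ)

lemma czfun_add (a b : Vec N) : czfun (a + b) = czfun a + czfun b := by
  funext j; simp [czfun]

lemma czfun_smul (c : ℝ) (a : Vec N) : czfun (c • a) = (c : ℂ) • czfun a := by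
  funext j; simp [czfun]

lemma dft_eq_unitaryDft (a : Vec N) (l : indexSet N) :
    dft N (fun k => ((a k : ℝ) : ℂ)) l = unitaryDft N (czfun a) (indexEquiv N l) := by
  rw [dft, unitaryDft_apply, ← Equiv.sum_comp (indexEquiv N)]
  congr 1
  refine Finset.sum_congr rfl fun k _ => ?_
  rw [czfun, zfun_apply_index]
  congr 1
  have : -(indexEquiv N k * indexEquiv N l) = ((-((k : ℤ) * (l : ℤ)) : ℤ) : ZMod N) := by
    simp [indexEquiv]
  rw [this, stdAddChar_intCast]
  congr 1
  push_cast
  ring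

lemma omega_pos : 0 < omega N := by
  have : (0 : ℝ) < N := Nat.cast_pos.2 (NeZero.pos N)
  rw [omega]; positivity

/-! ### Eigenvectors and vectors of bounded width -/

/-- The real vectors that the discrete Fourier transform multiplies by `μ`. -/
noncomputable def eigenSub (N : ℕ) [NeZero N] (μ : ℂ) : Submodule ℝ (Vec N) where
  carrier := {a | unitaryDft N (czfun a) = μ • czfun a}
  add_mem' {a b} ha hb := by
    simp only [Set.mem_ofPred_eq] at *
    rw [czfun_add, map_add, ha, hb, smul_add]
  zero_mem' := by
    have : czfun (0 : Vec N) = 0 := by funext j; simp [czfun, zfun]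
    simp [this]
  smul_mem' c a ha := by
    simp only [Set.mem_ofPred_eq] at *
    rw [czfun_smul, map_smul, ha, smul_comm]

lemma mem_eigenSub {μ : ℂ} {a : Vec N} :
    a ∈ eigenSub N μ ↔ unitaryDft N (czfun a) = μ • czfun a := Iff.rfl

lemma mem_eigenSub_iff_dft {μ : ℂ} {a : Vec N} :
    a ∈ eigenSub N μ ↔
      ∀ l : indexSet N, dft N (fun k => ((a k : ℝ) : ℂ)) l = μ * ((a l : ℝ) : ℂ) := by
  rw [mem_eigenSub, funext_iff, ← (indexEquiv N).forall_congr_right]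
  refine forall_congr' fun l => ?_
  rw [dft_eq_unitaryDft, Pi.smul_apply, smul_eq_mul, czfun, zfun_apply_index]

/-- The real vectors of width at most `m`. -/
noncomputable def widthSub (N : ℕ) [NeZero N] (m : ℕ) : Submodule ℝ (Vec N) where
  carrier := {a | ∀ j : ZMod N, m < j.valMinAbs.natAbs → zfun a j = 0}
  add_mem' {a b} ha hb j hj := by simp [ha j hj, hb j hj]
  zero_mem' j _ := by simp [zfun]
  smul_mem' c a ha j hj := by simp [ha j hj]

lemma mem_widthSub {m : ℕ} {a : Vec N} :
    a ∈ widthSub N m ↔ ∀ j : ZMod N, m < j.valMinAbs.natAbs → zfun a j = 0 := Iff.rfl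

lemma mem_widthSub_iff_width {m : ℕ} {a : Vec N} : a ∈ widthSub N m ↔ width a ≤ m := by
  rw [mem_widthSub, width, Finset.sup_le_iff, ← (indexEquiv N).forall_congr_right]
  refine forall_congr' fun k => ?_
  rw [valMinAbs_indexEquiv, zfun_apply_index]
  simp only [Finset.mem_filter, Finset.mem_univ, true_and]
  rw [← not_imp_not, not_lt]

lemma widthSub_mono {m m' : ℕ} (h : m ≤ m') : widthSub N m ≤ widthSub N m' :=
  fun _ ha j hj => ha j (h.trans_lt hj)

lemma widthSub_eq_top {m : ℕ} (h : N / 2 ≤ m) (a : Vec N) : a ∈ widthSub N m :=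
  fun j hj => absurd (j.natAbs_valMinAbs_le) (by omega)

/-- The real vectors which, together with their Fourier transform, have width at most `m`. -/
noncomputable def biWidthSub (N : ℕ) [NeZero N] (m : ℕ) : Submodule ℝ (Vec N) where
  carrier := {a | a ∈ widthSub N m ∧
    ∀ j : ZMod N, m < j.valMinAbs.natAbs → unitaryDft N (czfun a) j = 0}
  add_mem' {a b} ha hb := ⟨add_mem ha.1 hb.1, fun j hj => by
    rw [czfun_add, map_add, Pi.add_apply, ha.2 j hj, hb.2 j hj, add_zero]⟩
  zero_mem' := ⟨zero_mem _, fun j _ => by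
    have : czfun (0 : Vec N) = 0 := by funext j; simp [czfun, zfun]
    simp [this]⟩
  smul_mem' c a ha := ⟨Submodule.smul_mem _ _ ha.1, fun j hj => by
    rw [czfun_smul, map_smul, Pi.smul_apply, ha.2 j hj, smul_zero]⟩

lemma mem_biWidthSub_of_mem_eigenSub {m : ℕ} {μ : ℂ} {a : Vec N} (ha : a ∈ eigenSub N μ)
    (hw : a ∈ widthSub N m) : a ∈ biWidthSub N m := by
  refine ⟨hw, fun j hj => ?_⟩
  rw [mem_eigenSub.1 ha, Pi.smul_apply, czfun, hw j hj]
  simp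

/-- The matrix of the transform is symmetric, so eigenvectors with different eigenvalues are
orthogonal; this is the quantitative form. -/
lemma sub_mul_inner_eq_sum {μ ν : ℂ} {a b : Vec N} (hb : b ∈ eigenSub N ν) :
    (ν - μ) * (inner ℝ a b : ℝ) =
      ∑ j, (unitaryDft N (czfun a) j - μ * czfun a j) * czfun b j := by
  have h := sum_unitaryDft_mul (czfun a) (czfun b)
  rw [mem_eigenSub.1 hb] at h
  simp only [sub_mul, Finset.sum_sub_distrib, h, inner_eq_sum_zfun]
  push_cast
  simp only [Finset.mul_sum, Pi.smul_apply, smul_eq_mul, czfun]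
  congr 1 <;> refine Finset.sum_congr rfl fun j _ => by ring

lemma inner_eq_zero_of_mem_eigenSub {μ ν : ℂ} (hμν : μ ≠ ν) {a b : Vec N} (ha : a ∈ eigenSub N μ)
    (hb : b ∈ eigenSub N ν) : inner ℝ a b = 0 := by
  have h := sub_mul_inner_eq_sum (μ := μ) (a := a) hb
  rw [mem_eigenSub.1 ha] at h
  simp only [Pi.smul_apply, smul_eq_mul, sub_self, zero_mul, Finset.sum_const_zero,
    mul_eq_zero, sub_eq_zero, Complex.ofReal_eq_zero] at h
  exact h.resolve_left fun h => hμν h.symm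

end ZModTransform

section TrigPoly

variable {N : ℕ} [NeZero N]

/-! ### Trigonometric polynomials of low degree vanishing far from the origin -/

/-- The function `f` on `ZMod N` is a trigonometric polynomial of degree at most `d`: its Fourier
transform vanishes at the frequencies larger than `d`. -/
def IsTrigPoly (d : ℕ) (f : ZMod N → ℝ) : Prop :=
  ∀ l : ZMod N, d < l.valMinAbs.natAbs → unitaryDft N (fun j => (f j : ℂ)) l = 0

lemma natAbs_valMinAbs_one_le : (1 : ZMod N).valMinAbs.natAbs ≤ 1 := by
  rcases Nat.lt_or_ge 1 N with h | h
  · have := ZMod.valMinAbs_natCast_of_le_half (n := N) (a := 1) (by omega)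
    rw [Nat.cast_one] at this
    rw [this]; simp
  · have := (1 : ZMod N).natAbs_valMinAbs_le
    omega

lemma natAbs_valMinAbs_le_add_one (l : ZMod N) :
    l.valMinAbs.natAbs ≤ (l + 1).valMinAbs.natAbs + 1 := by
  have h := ZMod.natAbs_valMinAbs_add_le (l + 1) (-1)
  rw [add_neg_cancel_right] at h
  have h1 := natAbs_valMinAbs_one_le (N := N)
  rw [← ZMod.natAbs_valMinAbs_neg] at h1
  omega

lemma natAbs_valMinAbs_le_sub_one (l : ZMod N) :
    l.valMinAbs.natAbs ≤ (l - 1).valMinAbs.natAbs + 1 := by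
  have h := ZMod.natAbs_valMinAbs_add_le (l - 1) 1
  rw [sub_add_cancel] at h
  have h1 := natAbs_valMinAbs_one_le (N := N)
  omega

lemma IsTrigPoly.mono {d d' : ℕ} {f : ZMod N → ℝ} (hf : IsTrigPoly d f) (h : d ≤ d') :
    IsTrigPoly d' f := fun l hl => hf l (h.trans_lt hl)

lemma isTrigPoly_one : IsTrigPoly 0 (fun _ : ZMod N => 1) := by
  intro l hl
  rw [unitaryDft_apply]
  have h0 : l ≠ 0 := by
    rintro rfl
    simp at hl
  have := AddChar.sum_eq_zero_of_ne_one (ZMod.isPrimitive_stdAddChar N h0)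
  simp only [AddChar.mulShift_apply] at this
  have h2 : ∑ j : ZMod N, (ZMod.stdAddChar (-(j * l)) : ℂ) = 0 := by
    rw [← this, ← Equiv.sum_comp (Equiv.neg (ZMod N))]
    refine Finset.sum_congr rfl fun j _ => ?_
    simp [mul_comm]
  simp [h2]

lemma IsTrigPoly.cos_mul {d : ℕ} {f : ZMod N → ℝ} (hf : IsTrigPoly d f) (α β : ℝ) :
    IsTrigPoly (d + 1) fun j => (α + β * cosFun N j) * f j := by
  intro l hl
  have h1 := natAbs_valMinAbs_le_add_one l
  have h2 := natAbs_valMinAbs_le_sub_one l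
  have : (fun j => (((α + β * cosFun N j) * f j : ℝ) : ℂ)) = (α : ℂ) • (fun j => (f j : ℂ)) +
      (β : ℂ) • (fun j => (cosFun N j : ℂ) * (f j : ℂ)) := by
    funext j
    simp only [Pi.add_apply, Pi.smul_apply, smul_eq_mul]
    push_cast
    ring
  rw [this, map_add, map_smul, map_smul, Pi.add_apply, Pi.smul_apply, Pi.smul_apply,
    unitaryDft_cos_mul, hf l (by omega), hf (l - 1) (by omega), hf (l + 1) (by omega)]
  simp

lemma IsTrigPoly.sin_mul {d : ℕ} {f : ZMod N → ℝ} (hf : IsTrigPoly d f) :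
    IsTrigPoly (d + 1) fun j => sinFun N j * f j := by
  intro l hl
  have h1 := natAbs_valMinAbs_le_add_one l
  have h2 := natAbs_valMinAbs_le_sub_one l
  have := unitaryDft_sin_mul (fun j => (f j : ℂ)) l
  rw [hf (l - 1) (by omega), hf (l + 1) (by omega)] at this
  simpa using this

/-- The function `j ↦ sin² (ω j / 2)` on `ZMod N`. -/
noncomputable def halfSinSq (N : ℕ) (j : ZMod N) : ℝ := (1 - cosFun N j) / 2

lemma halfSinSq_eq {N : ℕ} (j : ZMod N) :
    halfSinSq N j = Real.sin (omega N * j.valMinAbs.natAbs / 2) ^ 2 := by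
  have h : Real.cos (omega N * j.valMinAbs) = Real.cos (omega N * j.valMinAbs.natAbs) := by
    rw [Nat.cast_natAbs, Int.cast_abs]
    rcases abs_choice (j.valMinAbs : ℝ) with h | h <;> rw [h]
    rw [mul_neg, Real.cos_neg]
  rw [halfSinSq, cosFun, h, Real.sin_sq_eq_half_sub]
  rw [mul_div_cancel₀ _ (two_ne_zero)]
  ring

lemma halfSinSq_nonneg {N : ℕ} (j : ZMod N) : 0 ≤ halfSinSq N j := by
  rw [halfSinSq_eq]; positivity

lemma omega_half_mul_le {k : ℕ} (h : k ≤ N / 2) : omega N * k / 2 ≤ Real.pi / 2 := by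
  have hN : (0 : ℝ) < N := Nat.cast_pos.2 (NeZero.pos N)
  have h' : 2 * (k : ℝ) ≤ N := by exact_mod_cast (by omega : 2 * k ≤ N)
  rw [omega, div_mul_eq_mul_div, div_div, div_le_div_iff₀ (by positivity) (by positivity)]
  nlinarith [Real.pi_pos]

lemma sin_omega_half_pos {k : ℕ} (h0 : 0 < k) (h : k ≤ N / 2) :
    0 < Real.sin (omega N * k / 2) := by
  have h1 := omega_half_mul_le (N := N) h
  have h2 := omega_pos (N := N)
  have h3 : (0 : ℝ) < k := Nat.cast_pos.2 h0
  exact Real.sin_pos_of_pos_of_lt_pi (by positivity) (by linarith [Real.pi_pos])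

lemma sin_omega_half_lt {k l : ℕ} (hkl : k < l) (h : l ≤ N / 2) :
    Real.sin (omega N * k / 2) < Real.sin (omega N * l / 2) := by
  have h1 := omega_half_mul_le (N := N) h
  have h2 := omega_pos (N := N)
  have h3 : (k : ℝ) < l := Nat.cast_lt.2 hkl
  have h4 : (0 : ℝ) ≤ k := Nat.cast_nonneg k
  have h5 : 0 ≤ omega N * k / 2 := by positivity
  exact Real.sin_lt_sin_of_lt_of_le_pi_div_two (by linarith [Real.pi_pos]) h1 (by nlinarith)

lemma sin_omega_half_nonneg {k : ℕ} (h : k ≤ N / 2) :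
    0 ≤ Real.sin (omega N * k / 2) := by
  rcases Nat.eq_zero_or_pos k with rfl | hk
  · simp
  · exact (sin_omega_half_pos hk h).le

/-- The last index of the product in `windowFun`. For even `N` and odd `p` the point `N / 2` is
left out, since `sin (ω N / 2) = 0` already. -/
def topIndex (N p : ℕ) : ℕ := (N - p % 2) / 2

lemma topIndex_le (N p : ℕ) : topIndex N p ≤ N / 2 := by
  rw [topIndex]; omega

/-- The even trigonometric polynomial `∏ (1 - sin² (ω j / 2) / sin² (ω i / 2))`, the product being
over `m < i ≤ topIndex N p`; it vanishes at these `i`. -/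
noncomputable def windowProd (N m p : ℕ) (j : ZMod N) : ℝ :=
  ∏ i ∈ Finset.Ioc m (topIndex N p), (1 - halfSinSq N j / Real.sin (omega N * i / 2) ^ 2)

/-- A trigonometric polynomial vanishing at `m < |j|`, of the parity of `p`, which is a discrete
analogue of `x ^ p * exp (-x ^ 2 / 2)` when `m` is close to `N / 4`. -/
noncomputable def windowFun (N m p : ℕ) (j : ZMod N) : ℝ :=
  sinFun N j ^ (p % 2) * (halfSinSq N j ^ (p / 2) * windowProd N m p j)

lemma windowProd_nonneg_factor {m p i : ℕ} {j : ZMod N} (hj : j.valMinAbs.natAbs ≤ m)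
    (hi : i ∈ Finset.Ioc m (topIndex N p)) :
    halfSinSq N j < Real.sin (omega N * i / 2) ^ 2 := by
  rw [Finset.mem_Ioc] at hi
  have h := topIndex_le N p
  rw [halfSinSq_eq]
  have := sin_omega_half_lt (N := N) (k := j.valMinAbs.natAbs) (l := i) (by omega) (by omega)
  have h0 := sin_omega_half_nonneg (N := N) j.natAbs_valMinAbs_le
  exact pow_lt_pow_left₀ this h0 two_ne_zero

lemma windowProd_pos {m p : ℕ} {j : ZMod N} (hj : j.valMinAbs.natAbs ≤ m) :
    0 < windowProd N m p j := by
  refine Finset.prod_pos fun i hi => ?_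
  have h := windowProd_nonneg_factor hj hi
  have h0 := halfSinSq_nonneg j
  rw [sub_pos, div_lt_one (h0.trans_lt h)]
  exact h

lemma sinFun_eq_zero {j : ZMod N} (h : 2 * j.valMinAbs.natAbs = N) : sinFun N j = 0 := by
  have hN : (N : ℝ) ≠ 0 := NeZero.ne _
  have h1 : 2 * |(j.valMinAbs : ℝ)| = N := by
    rw [← Int.cast_abs, ← Nat.cast_natAbs]; exact_mod_cast h
  have key : Real.sin (omega N * |(j.valMinAbs : ℝ)|) = 0 := by
    have : omega N * |(j.valMinAbs : ℝ)| = Real.pi := by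
      rw [omega, ← h1]
      have : |(j.valMinAbs : ℝ)| ≠ 0 := by
        intro h0
        rw [h0, mul_zero] at h1
        exact hN h1.symm
      field_simp
    rw [this, Real.sin_pi]
  rw [sinFun]
  rcases abs_choice (j.valMinAbs : ℝ) with h | h <;> rw [h] at key
  · exact key
  · rwa [mul_neg, Real.sin_neg, neg_eq_zero] at key

lemma windowFun_eq_zero {m p : ℕ} {j : ZMod N} (hj : m < j.valMinAbs.natAbs) :
    windowFun N m p j = 0 := by
  have hle := j.natAbs_valMinAbs_le
  by_cases h : j.valMinAbs.natAbs ≤ topIndex N p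
  · have : windowProd N m p j = 0 := by
      refine Finset.prod_eq_zero (Finset.mem_Ioc.2 ⟨hj, h⟩) ?_
      have := sin_omega_half_pos (N := N) (k := j.valMinAbs.natAbs) (by omega) hle
      rw [halfSinSq_eq, div_self (by positivity), sub_self]
    rw [windowFun, this, mul_zero, mul_zero]
  · rw [topIndex] at h
    have hp : p % 2 = 1 := by omega
    rw [windowFun, sinFun_eq_zero (by omega), hp, pow_one, zero_mul]

lemma windowFun_neg (m p : ℕ) (j : ZMod N) :
    windowFun N m p (-j) = (-1) ^ p * windowFun N m p j := by
  simp only [windowFun, windowProd, halfSinSq, cosFun_neg, sinFun_neg]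
  rw [neg_pow, mul_assoc, neg_one_pow_eq_pow_mod_two (n := p)]

lemma isTrigPoly_windowProd (m p : ℕ) :
    IsTrigPoly (topIndex N p - m) (windowProd N m p) := by
  have key : ∀ s : Finset ℕ, IsTrigPoly s.card (fun j : ZMod N =>
      ∏ i ∈ s, (1 - halfSinSq N j / Real.sin (omega N * i / 2) ^ 2)) := by
    intro s
    induction s using Finset.induction_on with
    | empty => simpa using isTrigPoly_one
    | insert i s hi ih =>
      rw [Finset.card_insert_of_notMem hi]
      simp only [Finset.prod_insert hi]
      convert ih.cos_mul (1 - 1 / (2 * Real.sin (omega N * i / 2) ^ 2))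
        (1 / (2 * Real.sin (omega N * i / 2) ^ 2)) using 3 with j
      rw [halfSinSq]
      ring
  have := key (Finset.Ioc m (topIndex N p))
  rwa [Nat.card_Ioc] at this

lemma isTrigPoly_windowFun (m p : ℕ) :
    IsTrigPoly (topIndex N p - m + p / 2 + p % 2) (windowFun N m p) := by
  have key : ∀ q : ℕ, IsTrigPoly (topIndex N p - m + q)
      (fun j : ZMod N => halfSinSq N j ^ q * windowProd N m p j) := by
    intro q
    induction q with
    | zero => simpa using isTrigPoly_windowProd m p
    | succ q ih =>
      have h := ih.cos_mul (1 / 2) (-1 / 2)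
      have h2 : (fun j : ZMod N => halfSinSq N j ^ (q + 1) * windowProd N m p j) = fun j =>
          (1 / 2 + -1 / 2 * cosFun N j) * (halfSinSq N j ^ q * windowProd N m p j) := by
        funext j
        rw [pow_succ']
        nth_rw 1 [halfSinSq]
        ring
      rw [h2]
      exact h
  unfold windowFun
  rcases Nat.mod_two_eq_zero_or_one p with h | h
  · simpa [h] using key (p / 2)
  · simpa [h] using (key (p / 2)).sin_mul

lemma mem_biWidthSub_windowFun {n p : ℕ} (hn : n < N) (hp : p ≤ n) (hpn : p % 2 = n % 2) :
    ofZfun (windowFun N ((N + n + 2) / 4) p) ∈ biWidthSub N ((N + n + 2) / 4) := by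
  refine ⟨fun j hj => ?_, fun j hj => ?_⟩
  · rw [zfun_ofZfun]
    exact windowFun_eq_zero hj
  · have h := (isTrigPoly_windowFun (N := N) ((N + n + 2) / 4) p).mono
      (d' := (N + n + 2) / 4) (by rw [topIndex]; omega) j hj
    unfold czfun
    rwa [zfun_ofZfun]

/-! ### Nonzero eigenvectors of small width for each eigenvalue -/

/-- The real part of the transform of a real function. -/
noncomputable def cosTransform (f : ZMod N → ℝ) (l : ZMod N) : ℝ :=
  1 / Real.sqrt N * ∑ j, cosFun N (j * l) * f j

/-- Minus the imaginary part of the transform of a real function. -/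
noncomputable def sinTransform (f : ZMod N → ℝ) (l : ZMod N) : ℝ :=
  1 / Real.sqrt N * ∑ j, sinFun N (j * l) * f j

lemma unitaryDft_ofReal (f : ZMod N → ℝ) (l : ZMod N) :
    unitaryDft N (fun j => (f j : ℂ)) l = cosTransform f l - Complex.I * sinTransform f l := by
  rw [unitaryDft_apply, cosTransform, sinTransform]
  push_cast
  rw [mul_left_comm, ← mul_sub, Finset.mul_sum (a := Complex.I), ← Finset.sum_sub_distrib]
  congr 1
  refine Finset.sum_congr rfl fun j _ => ?_
  rw [stdAddChar_neg_eq]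
  ring

lemma unitaryDft_of_even {f : ZMod N → ℝ} (hf : ∀ j, f (-j) = f j) (l : ZMod N) :
    unitaryDft N (fun j => (f j : ℂ)) l = cosTransform f l := by
  have : sinTransform f l = 0 := by
    have h : ∑ j, sinFun N (j * l) * f j = - ∑ j, sinFun N (j * l) * f j := by
      rw [← Finset.sum_neg_distrib]
      refine Fintype.sum_equiv (Equiv.neg _) _ _ fun j => ?_
      rw [Equiv.neg_apply, hf, neg_mul, sinFun_neg]
      ring
    rw [sinTransform, self_eq_neg.1 h, mul_zero]
  rw [unitaryDft_ofReal, this]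
  simp

lemma unitaryDft_of_odd {f : ZMod N → ℝ} (hf : ∀ j, f (-j) = - f j) (l : ZMod N) :
    unitaryDft N (fun j => (f j : ℂ)) l = -Complex.I * sinTransform f l := by
  have : cosTransform f l = 0 := by
    have h : ∑ j, cosFun N (j * l) * f j = - ∑ j, cosFun N (j * l) * f j := by
      rw [← Finset.sum_neg_distrib]
      refine Fintype.sum_equiv (Equiv.neg _) _ _ fun j => ?_
      rw [Equiv.neg_apply, hf, neg_mul, cosFun_neg]
      ring
    rw [cosTransform, self_eq_neg.1 h, mul_zero]
  rw [unitaryDft_ofReal, this]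
  simp

/-- For even `f` the functions `f ± F f` are eigenvectors with eigenvalues `±1`. -/
lemma mem_eigenSub_of_even {f : ZMod N → ℝ} (hf : ∀ j, f (-j) = f j) {s : ℝ} (hs : s * s = 1) :
    ofZfun (f + s • cosTransform f) ∈ eigenSub N (s : ℂ) := by
  have h1 : unitaryDft N (fun j => (f j : ℂ)) = fun l => (cosTransform f l : ℂ) :=
    funext (unitaryDft_of_even hf)
  have h2 : czfun (ofZfun (f + s • cosTransform f)) =
      (fun j => (f j : ℂ)) + (s : ℂ) • unitaryDft N (fun j => (f j : ℂ)) := by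
    funext j
    simp [czfun, h1]
  have hs' : (s : ℂ) * s = 1 := by exact_mod_cast hs
  rw [mem_eigenSub, h2, map_add, map_smul, smul_add, smul_smul, hs', one_smul, add_comm]
  congr 2
  funext j
  rw [unitaryDft_unitaryDft, hf]

/-- For odd `f` the functions `f ± i F f` are eigenvectors with eigenvalues `∓i`. -/
lemma mem_eigenSub_of_odd {f : ZMod N → ℝ} (hf : ∀ j, f (-j) = - f j) {s : ℝ} (hs : s * s = 1) :
    ofZfun (f + s • sinTransform f) ∈ eigenSub N (-Complex.I * s) := by
  have h1 : unitaryDft N (fun j => (f j : ℂ)) = fun l => -Complex.I * (sinTransform f l : ℂ) :=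
    funext (unitaryDft_of_odd hf)
  have h2 : czfun (ofZfun (f + s • sinTransform f)) =
      (fun j => (f j : ℂ)) + (s * Complex.I : ℂ) • unitaryDft N (fun j => (f j : ℂ)) := by
    funext j
    simp only [czfun, zfun_ofZfun, h1, Pi.add_apply, Pi.smul_apply, smul_eq_mul]
    push_cast
    linear_combination ((s : ℂ) * sinTransform f j) * Complex.I_mul_I
  have hs' : (s : ℂ) * s = 1 := by exact_mod_cast hs
  have h3 : unitaryDft N (unitaryDft N fun j => (f j : ℂ)) = fun j => -(f j : ℂ) := by
    funext j
    rw [unitaryDft_unitaryDft, hf]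
    push_cast; rfl
  rw [mem_eigenSub, h2, map_add, map_smul, smul_add, smul_smul, h3]
  funext j
  simp only [Pi.add_apply, Pi.smul_apply, smul_eq_mul]
  linear_combination (s * s * unitaryDft N (fun j => (f j : ℂ)) j : ℂ) * Complex.I_mul_I
    - unitaryDft N (fun j => (f j : ℂ)) j * hs'

lemma mem_widthSub_of_even {m : ℕ} {f : ZMod N → ℝ} (hf : ∀ j, f (-j) = f j)
    (h : ofZfun f ∈ biWidthSub N m) (s : ℝ) : ofZfun (f + s • cosTransform f) ∈ widthSub N m := by
  intro j hj
  have h1 := h.1 j hj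
  have h2 := h.2 j hj
  unfold czfun at h2
  rw [zfun_ofZfun] at h1 h2
  rw [unitaryDft_of_even hf, Complex.ofReal_eq_zero] at h2
  simp [h1, h2]

lemma mem_widthSub_of_odd {m : ℕ} {f : ZMod N → ℝ} (hf : ∀ j, f (-j) = - f j)
    (h : ofZfun f ∈ biWidthSub N m) (s : ℝ) : ofZfun (f + s • sinTransform f) ∈ widthSub N m := by
  intro j hj
  have h1 := h.1 j hj
  have h2 := h.2 j hj
  unfold czfun at h2
  rw [zfun_ofZfun] at h1 h2
  rw [unitaryDft_of_odd hf] at h2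
  simp only [neg_mul, neg_eq_zero, mul_eq_zero, Complex.I_ne_zero, false_or,
    Complex.ofReal_eq_zero] at h2
  simp [h1, h2]

lemma cosFun_zero {N : ℕ} : cosFun N 0 = 1 := by simp [cosFun]

lemma natAbs_valMinAbs_natCast {N : ℕ} {k : ℕ} (h : k ≤ N / 2) :
    (k : ZMod N).valMinAbs.natAbs = k := by
  rw [ZMod.valMinAbs_natCast_of_le_half h, Int.natAbs_natCast]

lemma halfSinSq_natCast {N : ℕ} {k : ℕ} (h : k ≤ N / 2) :
    halfSinSq N (k : ZMod N) = Real.sin (omega N * k / 2) ^ 2 := by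
  rw [halfSinSq_eq, natAbs_valMinAbs_natCast h]

lemma sinFun_natCast_pos {k : ℕ} (h0 : 0 < k) (h : 2 * k < N) : 0 < sinFun N (k : ZMod N) := by
  rw [sinFun, ZMod.valMinAbs_natCast_of_le_half (by omega)]
  have hN : (0 : ℝ) < N := Nat.cast_pos.2 (NeZero.pos N)
  have h1 : (2 * k : ℝ) < N := by exact_mod_cast h
  have h2 : (0 : ℝ) < k := Nat.cast_pos.2 h0
  have h3 := omega_pos (N := N)
  refine Real.sin_pos_of_pos_of_lt_pi (by push_cast; positivity) ?_
  push_cast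
  rw [omega, div_mul_eq_mul_div, div_lt_iff₀ hN]
  nlinarith [Real.pi_pos]

lemma windowFun_zero_nonneg (m p : ℕ) (hp : p % 2 = 0) (j : ZMod N) : 0 ≤ windowFun N m p j := by
  by_cases hj : j.valMinAbs.natAbs ≤ m
  · rw [windowFun, hp, pow_zero, one_mul]
    exact mul_nonneg (pow_nonneg (halfSinSq_nonneg j) _) (windowProd_pos hj).le
  · rw [windowFun_eq_zero (by omega)]

lemma cosTransform_zero (f : ZMod N → ℝ) : cosTransform f 0 = 1 / Real.sqrt N * ∑ j, f j := by
  simp [cosTransform, cosFun_zero]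

lemma sinTransform_one (f : ZMod N → ℝ) :
    sinTransform f 1 = 1 / Real.sqrt N * ∑ j, sinFun N j * f j := by
  simp [sinTransform]

lemma one_div_sqrt_pos : 0 < 1 / Real.sqrt (N : ℝ) := by
  have hN : (0 : ℝ) < N := Nat.cast_pos.2 (NeZero.pos N)
  positivity

lemma sum_windowFun_pos {m p k : ℕ} (hp : p % 2 = 0) (hk : k ≤ m) (hkN : k ≤ N / 2)
    (h : 0 < halfSinSq N (k : ZMod N) ^ (p / 2)) : 0 < ∑ j, windowFun N m p j := by
  refine Finset.sum_pos' (fun j _ => windowFun_zero_nonneg m p hp j)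
    ⟨(k : ZMod N), Finset.mem_univ _, ?_⟩
  have := windowProd_pos (N := N) (m := m) (p := p) (j := (k : ZMod N))
    (by rwa [natAbs_valMinAbs_natCast hkN])
  rw [windowFun, hp, pow_zero, one_mul]
  positivity

lemma ne_zero_of_zfun_ne_zero {a : Vec N} {j : ZMod N} (h : zfun a j ≠ 0) : a ≠ 0 := by
  rintro rfl
  exact h (by simp [zfun])

/-! The eigenvectors are nonzero because their value at `0`, or at `1` in the odd cases, is a sum of
terms of one sign that do not all vanish. -/

lemma exists_eigenvector_zero (hN : 2 ≤ N) :
    ∃ v : Vec N, v ≠ 0 ∧ v ∈ eigenSub N ((-Complex.I) ^ 0) ∧ v ∈ widthSub N ((N + 0 + 2) / 4) := by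
  set m := (N + 0 + 2) / 4 with hm
  have hev : ∀ j : ZMod N, windowFun N m 0 (-j) = windowFun N m 0 j := fun j => by
    rw [windowFun_neg]; simp
  refine ⟨ofZfun (windowFun N m 0 + (1 : ℝ) • cosTransform (windowFun N m 0)), ?_, ?_, ?_⟩
  · refine ne_zero_of_zfun_ne_zero (j := 0) ?_
    have h1 := sum_windowFun_pos (N := N) (m := m) (p := 0) (k := 0) rfl (by omega) (by omega)
      (by simp)
    have h2 := windowFun_zero_nonneg (N := N) m 0 rfl 0
    have h3 := one_div_sqrt_pos (N := N)
    simp only [zfun_ofZfun, one_smul, Pi.add_apply, cosTransform_zero]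
    have := mul_pos h3 h1
    linarith
  · have := mem_eigenSub_of_even (f := windowFun N m 0) hev (s := 1) (by norm_num)
    rw [pow_zero, ← Complex.ofReal_one]
    exact this
  · exact mem_widthSub_of_even hev
      (mem_biWidthSub_windowFun (n := 0) (by omega) le_rfl rfl) 1

lemma exists_eigenvector_two (hN : 4 ≤ N) :
    ∃ v : Vec N, v ≠ 0 ∧ v ∈ eigenSub N ((-Complex.I) ^ 2) ∧ v ∈ widthSub N ((N + 2 + 2) / 4) := by
  set m := (N + 2 + 2) / 4 with hm
  have hev : ∀ j : ZMod N, windowFun N m 2 (-j) = windowFun N m 2 j := fun j => by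
    rw [windowFun_neg]; simp
  refine ⟨ofZfun (windowFun N m 2 + (-1 : ℝ) • cosTransform (windowFun N m 2)), ?_, ?_, ?_⟩
  · refine ne_zero_of_zfun_ne_zero (j := 0) ?_
    have h1 := sum_windowFun_pos (N := N) (m := m) (p := 2) (k := 1) rfl (by omega) (by omega)
      (by
        have := sin_omega_half_pos (N := N) one_pos (by omega)
        rw [halfSinSq_natCast (by omega)]
        positivity)
    have h2 : windowFun N m 2 0 = 0 := by simp [windowFun, halfSinSq, cosFun_zero]
    have h3 := one_div_sqrt_pos (N := N)
    simp only [zfun_ofZfun, Pi.add_apply, Pi.smul_apply, cosTransform_zero, h2, smul_eq_mul]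
    have := mul_pos h3 h1
    linarith
  · have := mem_eigenSub_of_even hev (s := -1) (by norm_num)
    rw [neg_sq, Complex.I_sq]
    simpa using this
  · exact mem_widthSub_of_even hev (mem_biWidthSub_windowFun (by omega) le_rfl rfl) (-1)

lemma windowProd_congr {N : ℕ} {m p q : ℕ} (h : p % 2 = q % 2) :
    windowProd N m p = windowProd N m q := by
  unfold windowProd topIndex
  rw [h]

lemma sin_mul_windowFun_one_nonneg (m : ℕ) (j : ZMod N) : 0 ≤ sinFun N j * windowFun N m 1 j := by
  by_cases hj : j.valMinAbs.natAbs ≤ m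
  · have := windowProd_pos (N := N) (p := 1) hj
    have h2 : sinFun N j * windowFun N m 1 j = sinFun N j ^ 2 * windowProd N m 1 j := by
      simp [windowFun]; ring
    rw [h2]
    positivity
  · rw [windowFun_eq_zero (by omega), mul_zero]

lemma windowFun_one_pos {m k : ℕ} (h0 : 0 < k) (hkm : k ≤ m) (h : 2 * k < N) :
    0 < windowFun N m 1 (k : ZMod N) := by
  have h1 := sinFun_natCast_pos h0 h
  have h2 := windowProd_pos (N := N) (m := m) (p := 1) (j := (k : ZMod N))
    (by rwa [natAbs_valMinAbs_natCast (by omega)])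
  simp only [windowFun, Nat.mod_succ, pow_one, Nat.reduceDiv, pow_zero, one_mul]
  positivity

lemma exists_eigenvector_one (hN : 3 ≤ N) :
    ∃ v : Vec N, v ≠ 0 ∧ v ∈ eigenSub N ((-Complex.I) ^ 1) ∧ v ∈ widthSub N ((N + 1 + 2) / 4) := by
  set m := (N + 1 + 2) / 4 with hm
  have hodd : ∀ j : ZMod N, windowFun N m 1 (-j) = - windowFun N m 1 j := fun j => by
    rw [windowFun_neg]; simp
  refine ⟨ofZfun (windowFun N m 1 + (1 : ℝ) • sinTransform (windowFun N m 1)), ?_, ?_, ?_⟩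
  · refine ne_zero_of_zfun_ne_zero (j := 1) ?_
    have h1 : 0 ≤ ∑ j, sinFun N j * windowFun N m 1 j :=
      Finset.sum_nonneg fun j _ => sin_mul_windowFun_one_nonneg m j
    have h2 := windowFun_one_pos (N := N) (m := m) one_pos (by omega) (by omega)
    rw [Nat.cast_one] at h2
    have h3 := one_div_sqrt_pos (N := N)
    simp only [zfun_ofZfun, one_smul, Pi.add_apply, sinTransform_one]
    positivity
  · simpa using mem_eigenSub_of_odd hodd (s := 1) (by norm_num)
  · exact mem_widthSub_of_odd hodd (mem_biWidthSub_windowFun (by omega) le_rfl rfl) 1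

lemma halfSinSq_mono {i j : ZMod N} (h : i.valMinAbs.natAbs < j.valMinAbs.natAbs) :
    halfSinSq N i < halfSinSq N j := by
  rw [halfSinSq_eq, halfSinSq_eq]
  exact pow_lt_pow_left₀ (sin_omega_half_lt h j.natAbs_valMinAbs_le)
    (sin_omega_half_nonneg i.natAbs_valMinAbs_le) two_ne_zero

/-- Taking `windowFun N m 3` alone, the sign of `v` could not be read off at the point `1`; the
combination used here vanishes at `±1`, and there only its transform contributes to `v`. -/
lemma exists_eigenvector_three (hN : 5 ≤ N) :
    ∃ v : Vec N, v ≠ 0 ∧ v ∈ eigenSub N ((-Complex.I) ^ 3) ∧ v ∈ widthSub N ((N + 3 + 2) / 4) := by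
  set m := (N + 3 + 2) / 4 with hm
  have h1abs : (1 : ZMod N).valMinAbs.natAbs = 1 := by
    have := natAbs_valMinAbs_natCast (N := N) (k := 1) (by omega)
    rwa [Nat.cast_one] at this
  set f : ZMod N → ℝ := fun j => (halfSinSq N j - halfSinSq N 1) * windowFun N m 1 j with hf
  have hf' : ofZfun f = ofZfun (windowFun N m 3) - halfSinSq N 1 • ofZfun (windowFun N m 1) := by
    apply zfun_injective
    funext j
    simp only [zfun_ofZfun, zfun_sub, zfun_smul, Pi.sub_apply, Pi.smul_apply, smul_eq_mul, hf]
    simp only [windowFun, windowProd_congr (N := N) (m := m) (p := 3) (q := 1) rfl]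
    norm_num
    ring
  have hodd : ∀ j : ZMod N, f (-j) = - f j := fun j => by
    simp only [hf]
    rw [windowFun_neg, halfSinSq, cosFun_neg, ← halfSinSq]
    ring
  have hbi : ofZfun f ∈ biWidthSub N m := by
    rw [hf']
    exact sub_mem (mem_biWidthSub_windowFun (by omega) le_rfl rfl)
      (Submodule.smul_mem _ _ (mem_biWidthSub_windowFun (by omega) (by omega) rfl))
  refine ⟨ofZfun (f + (-1 : ℝ) • sinTransform f), ?_, ?_, ?_⟩
  · refine ne_zero_of_zfun_ne_zero (j := 1) ?_
    have h1 : 0 < ∑ j, sinFun N j * f j := by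
      have hrw : ∀ j, sinFun N j * f j =
          (halfSinSq N j - halfSinSq N 1) * (sinFun N j * windowFun N m 1 j) := fun j => by
        simp only [hf]; ring
      simp only [hrw]
      refine Finset.sum_pos' (fun j _ => ?_) ⟨((2 : ℕ) : ZMod N), Finset.mem_univ _, ?_⟩
      · rcases Nat.lt_trichotomy 1 j.valMinAbs.natAbs with h | h | h
        · have := halfSinSq_mono (N := N) (i := 1) (j := j) (by omega)
          exact mul_nonneg (by linarith) (sin_mul_windowFun_one_nonneg m j)
        · rw [halfSinSq_eq j, halfSinSq_eq 1, ← h, h1abs]; simp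
        · have : j = 0 := by
            rw [← ZMod.valMinAbs_eq_zero]; omega
          simp [this, sinFun]
      · have h2 := natAbs_valMinAbs_natCast (N := N) (k := 2) (by omega)
        have h3 := halfSinSq_mono (N := N) (i := 1) (j := ((2 : ℕ) : ZMod N)) (by omega)
        exact mul_pos (by linarith) (mul_pos (sinFun_natCast_pos (by omega) (by omega))
          (windowFun_one_pos (by omega) (by omega) (by omega)))
    have h2 : f 1 = 0 := by simp [hf]
    have h3 := mul_pos (one_div_sqrt_pos (N := N)) h1
    simp only [zfun_ofZfun, Pi.add_apply, Pi.smul_apply, sinTransform_one, h2, smul_eq_mul]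
    linarith
  · have := mem_eigenSub_of_odd hodd (s := -1) (by norm_num)
    have h3 : (-Complex.I) ^ 3 = -Complex.I * ((-1 : ℝ) : ℂ) := by
      push_cast
      rw [pow_succ, neg_sq, Complex.I_sq]
      ring
    rwa [h3]
  · exact mem_widthSub_of_odd hodd hbi (-1)

lemma exists_eigenvector {r : ℕ} (hr : r < 4) (hN : r + 1 < N) :
    ∃ v : Vec N, v ≠ 0 ∧ v ∈ eigenSub N ((-Complex.I) ^ r) ∧ v ∈ widthSub N ((N + r + 2) / 4) := by
  interval_cases r
  · exact exists_eigenvector_zero (by omega)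
  · exact exists_eigenvector_one (by omega)
  · exact exists_eigenvector_two (by omega)
  · exact exists_eigenvector_three (by omega)

end TrigPoly

section Existence

variable {N : ℕ} [NeZero N]

/-! ### Existence of a minimal Hermite-type basis -/

lemma neg_I_pow_mod (n : ℕ) : (-Complex.I) ^ n = (-Complex.I) ^ (n % 4) := by
  have h4 : (-Complex.I) ^ 4 = 1 := by
    rw [show 4 = 2 * 2 from rfl, pow_mul, neg_sq, Complex.I_sq]; norm_num
  conv_lhs => rw [← Nat.div_add_mod n 4, pow_add, pow_mul, h4, one_pow, one_mul]

lemma neg_I_pow_two : (-Complex.I) ^ 2 = -1 := by rw [neg_sq, Complex.I_sq]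

lemma neg_I_pow_three : (-Complex.I) ^ 3 = Complex.I := by
  rw [pow_succ, neg_I_pow_two]; ring

lemma one_le_norm_neg_I_pow_sub {i n : ℕ} (h : i % 4 ≠ n % 4) :
    1 ≤ ‖(-Complex.I) ^ i - (-Complex.I) ^ n‖ := by
  rw [neg_I_pow_mod i, neg_I_pow_mod n]
  have hi : i % 4 < 4 := Nat.mod_lt _ (by norm_num)
  have hn : n % 4 < 4 := Nat.mod_lt _ (by norm_num)
  generalize i % 4 = a at *
  generalize n % 4 = b at *
  have key : ∀ z : ℂ, 1 ≤ |z.re| ∨ 1 ≤ |z.im| → 1 ≤ ‖z‖ := fun z hz =>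
    hz.elim (fun h => h.trans (Complex.abs_re_le_norm z))
      fun h => h.trans (Complex.abs_im_le_norm z)
  apply key
  interval_cases a <;> interval_cases b <;>
    first
    | exact absurd rfl h
    | norm_num [neg_I_pow_two, neg_I_pow_three]

lemma neg_I_pow_injective {i n : ℕ} (h : i % 4 ≠ n % 4) :
    (-Complex.I) ^ i ≠ (-Complex.I) ^ n := fun heq => by
  have := one_le_norm_neg_I_pow_sub h
  rw [heq, sub_self, norm_zero] at this
  linarith

/-- An eigenvector for `(-i) ^ n` has the parity of `n`. -/
lemma zfun_neg_of_mem_eigenSub {n : ℕ} {a : Vec N} (ha : a ∈ eigenSub N ((-Complex.I) ^ n))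
    (j : ZMod N) : zfun a (-j) = (-1) ^ n * zfun a j := by
  have h := unitaryDft_unitaryDft (czfun a) j
  rw [mem_eigenSub.1 ha, map_smul, mem_eigenSub.1 ha, smul_smul, ← mul_pow, neg_mul_neg,
    Complex.I_mul_I, Pi.smul_apply, czfun, czfun, smul_eq_mul] at h
  exact_mod_cast h.symm

/-- The vector obtained from `a` by the operator `hermiteOp`. -/
noncomputable def hermiteOpVec (a : Vec N) : Vec N := ofZfun (hermiteOp N (zfun a))

lemma hermiteOpVec_mem_eigenSub {μ : ℂ} {a : Vec N} (ha : a ∈ eigenSub N μ) :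
    hermiteOpVec a ∈ eigenSub N μ := by
  rw [mem_eigenSub] at *
  have h := unitaryDft_hermiteOp (zfun a) μ fun l => congrFun ha l
  funext l
  have := h l
  unfold czfun hermiteOpVec
  rwa [zfun_ofZfun]

/-- A vector has exact width `w` in the following strong sense: it vanishes at `w < |j|` and does
not vanish at `w`. -/
def HasExactWidth (a : Vec N) (w : ℕ) : Prop := a ∈ widthSub N w ∧ zfun a (w : ZMod N) ≠ 0

lemma exists_hasExactWidth {n m : ℕ} {a : Vec N} (h0 : a ≠ 0)
    (ha : a ∈ eigenSub N ((-Complex.I) ^ n)) (hm : a ∈ widthSub N m) :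
    ∃ w ≤ m, HasExactWidth a w := by
  classical
  have hex : ∃ w, a ∈ widthSub N w := ⟨m, hm⟩
  refine ⟨Nat.find hex, Nat.find_min' hex hm, Nat.find_spec hex, fun hz => ?_⟩
  set w := Nat.find hex with hw
  have hz' : zfun a (-(w : ZMod N)) = 0 := by rw [zfun_neg_of_mem_eigenSub ha, hz, mul_zero]
  have hall : ∀ j : ZMod N, w ≤ j.valMinAbs.natAbs → zfun a j = 0 := by
    intro j hj
    rcases hj.lt_or_eq with hj | hj
    · exact Nat.find_spec hex j hj
    · rw [← ZMod.coe_valMinAbs j]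
      rcases Int.natAbs_eq j.valMinAbs with h | h <;> rw [h, ← hj]
      · simpa using hz
      · simpa using hz'
  rcases Nat.eq_zero_or_pos w with h | h
  · apply h0
    apply zfun_injective
    funext j
    rw [hall j (by omega)]
    simp [zfun]
  · exact Nat.find_min hex (show w - 1 < w by omega) fun j hj => hall j (by omega)

/-- The operator `hermiteOp` raises the exact width by one. For an odd vector the point `N / 2`
has to be excluded, since odd vectors vanish there. -/
lemma HasExactWidth.hermiteOpVec {n w : ℕ} {a : Vec N} (ha : a ∈ eigenSub N ((-Complex.I) ^ n))
    (hw : HasExactWidth a w) (hwN : 2 * (w + 1) ≤ N) (hodd : 2 * (w + 1) = N → n % 2 = 0) :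
    HasExactWidth (hermiteOpVec a) (w + 1) := by
  constructor
  · intro j hj
    have h1 := natAbs_valMinAbs_le_add_one j
    have h2 := natAbs_valMinAbs_le_sub_one j
    rw [MinimalHermite.hermiteOpVec, zfun_ofZfun, hermiteOp, hw.1 j (by omega),
      hw.1 (j - 1) (by omega), hw.1 (j + 1) (by omega)]
    simp
  · have h1 : zfun a ((w + 1 : ℕ) : ZMod N) = 0 :=
      hw.1 _ (by rw [natAbs_valMinAbs_natCast (by omega)]; omega)
    have h2 : ((w + 1 : ℕ) : ZMod N) - 1 = (w : ZMod N) := by push_cast; ring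
    rw [MinimalHermite.hermiteOpVec, zfun_ofZfun, hermiteOp, h1, h2, mul_zero, zero_add]
    by_cases hN : 2 * (w + 1) = N
    · have h3 : ((w + 1 : ℕ) : ZMod N) + 1 = -(w : ZMod N) := by
        have : ((2 * (w + 1) : ℕ) : ZMod N) = 0 := by rw [hN]; exact ZMod.natCast_self N
        push_cast at this ⊢
        linear_combination this
      rw [h3, zfun_neg_of_mem_eigenSub ha, neg_one_pow_eq_pow_mod_two, hodd hN, pow_zero, one_mul,
        add_self_div_two]
      exact hw.2
    · have h3 : zfun a (((w + 1 : ℕ) : ZMod N) + 1) = 0 := by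
        refine hw.1 _ ?_
        have h4 := natAbs_valMinAbs_le_add_one ((w + 1 : ℕ) : ZMod N)
        rw [natAbs_valMinAbs_natCast (by omega)] at h4
        by_contra hcon
        have h5 : (((w + 1 : ℕ) : ZMod N) + 1).valMinAbs.natAbs = w := by omega
        have h6 : ((w + 1 : ℕ) : ZMod N) + 1 = ((w + 2 : ℕ) : ZMod N) := by push_cast; ring
        rw [h6] at h5
        rcases Int.natAbs_eq ((w + 2 : ℕ) : ZMod N).valMinAbs with h | h
        · have h7 := ZMod.coe_valMinAbs ((w + 2 : ℕ) : ZMod N)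
          rw [h, h5, ← sub_eq_zero] at h7
          have h8 : ((2 : ℕ) : ZMod N) = 0 := by push_cast at h7 ⊢; linear_combination -h7
          rw [ZMod.natCast_eq_zero_iff] at h8
          have := Nat.le_of_dvd (by norm_num) h8
          omega
        · have h7 := ZMod.coe_valMinAbs ((w + 2 : ℕ) : ZMod N)
          rw [h, h5, ← sub_eq_zero] at h7
          have h8 : ((2 * (w + 1) : ℕ) : ZMod N) = 0 := by push_cast at h7 ⊢; linear_combination -h7
          rw [ZMod.natCast_eq_zero_iff] at h8
          have := Nat.le_of_dvd (by omega) h8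
          omega
      rw [h3, add_zero]
      exact div_ne_zero hw.2 two_ne_zero

lemma exists_hasExactWidth_iterate {r : ℕ} (hr : r < 4) (hN : r + 1 < N) :
    ∃ (v : Vec N) (w : ℕ), w ≤ (N + r + 2) / 4 ∧ ∀ q, 4 * q + r + 1 < N →
      (hermiteOpVec^[q] v ∈ eigenSub N ((-Complex.I) ^ (4 * q + r))) ∧
      HasExactWidth (hermiteOpVec^[q] v) (w + q) := by
  obtain ⟨v, h0, hv, hm⟩ := exists_eigenvector hr hN
  obtain ⟨w, hw, hex⟩ := exists_hasExactWidth h0 hv hm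
  refine ⟨v, w, hw, fun q => ?_⟩
  have hpow : ∀ q, (-Complex.I) ^ (4 * q + r) = (-Complex.I) ^ r := fun q => by
    rw [neg_I_pow_mod, neg_I_pow_mod r]
    congr 1
    omega
  simp only [hpow]
  induction q with
  | zero => exact fun _ => ⟨hv, hex⟩
  | succ q ih =>
    intro hq
    obtain ⟨h1, h2⟩ := ih (by omega)
    rw [Function.iterate_succ_apply']
    refine ⟨hermiteOpVec_mem_eigenSub h1, ?_⟩
    rw [← add_assoc]
    exact h2.hermiteOpVec h1 (by omega) (by omega)

lemma zfun_sum {ι : Type*} (s : Finset ι) (f : ι → Vec N) :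
    zfun (∑ i ∈ s, f i) = ∑ i ∈ s, zfun (f i) :=
  map_sum (AddMonoidHom.mk' zfun zfun_add) f s

/-- The Gram–Schmidt process preserves the eigenvalue and the exact width of each vector, since
vectors in different residue classes modulo `4` are orthogonal, and the exact widths increase
along each residue class. -/
lemma gramSchmidt_hasExactWidth {f : Fin N → Vec N} {W : ℕ → ℕ}
    (hW : ∀ i n, i < n → i % 4 = n % 4 → W i < W n) (hWN : ∀ n, n + 1 < N → W n ≤ N / 2)
    (hf : ∀ n : Fin N, (n : ℕ) + 1 < N → f n ∈ eigenSub N ((-Complex.I) ^ (n : ℕ)) ∧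
      HasExactWidth (f n) (W n)) (n : Fin N) (hn : (n : ℕ) + 1 < N) :
    InnerProductSpace.gramSchmidt ℝ f n ∈ eigenSub N ((-Complex.I) ^ (n : ℕ)) ∧
      HasExactWidth (InnerProductSpace.gramSchmidt ℝ f n) (W n) := by
  induction n using WellFoundedLT.induction with
  | _ n ih =>
    set g := InnerProductSpace.gramSchmidt ℝ f with hg
    have hdef : g n = f n - ∑ i ∈ Finset.Iio n,
        (inner ℝ (g i) (f n) / (‖g i‖ ^ 2 : ℝ)) • g i := by
      rw [eq_sub_iff_add_eq]
      exact (InnerProductSpace.gramSchmidt_def'' ℝ f n).symm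
    have hterm : ∀ i ∈ Finset.Iio n,
        (inner ℝ (g i) (f n) / (‖g i‖ ^ 2 : ℝ)) • g i ∈ eigenSub N ((-Complex.I) ^ (n : ℕ)) ∧
        ∀ j : ZMod N, W n ≤ j.valMinAbs.natAbs →
          zfun ((inner ℝ (g i) (f n) / (‖g i‖ ^ 2 : ℝ)) • g i) j = 0 := by
      intro i hi
      have hin : i < n := Finset.mem_Iio.1 hi
      have hin' : (i : ℕ) < n := hin
      obtain ⟨h1, h2⟩ := ih i hin (by omega)
      by_cases hmod : (i : ℕ) % 4 = (n : ℕ) % 4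
      · have hpow : (-Complex.I) ^ (i : ℕ) = (-Complex.I) ^ (n : ℕ) := by
          rw [neg_I_pow_mod, hmod, ← neg_I_pow_mod]
        rw [hpow] at h1
        refine ⟨Submodule.smul_mem _ _ h1, fun j hj => ?_⟩
        rw [zfun_smul, Pi.smul_apply, h2.1 j ((hW _ _ hin' hmod).trans_le hj), smul_zero]
      · rw [inner_eq_zero_of_mem_eigenSub (neg_I_pow_injective hmod) h1 (hf n hn).1, zero_div,
          zero_smul]
        exact ⟨zero_mem _, fun j _ => by simp [zfun]⟩
    have hS : ∀ j : ZMod N, W n ≤ j.valMinAbs.natAbs → zfun (g n) j = zfun (f n) j := by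
      intro j hj
      rw [hdef, zfun_sub, zfun_sum, Pi.sub_apply, Finset.sum_apply,
        Finset.sum_eq_zero fun i hi => (hterm i hi).2 j hj, sub_zero]
    refine ⟨?_, fun j hj => ?_, ?_⟩
    · rw [hdef]
      exact sub_mem (hf n hn).1 (sum_mem fun i hi => (hterm i hi).1)
    · rw [hS j hj.le, (hf n hn).2.1 j hj]
    · rw [hS _ (by rw [natAbs_valMinAbs_natCast (hWN _ hn)])]
      exact (hf n hn).2.2

/-- A unit vector orthogonal to `N - 1` orthonormal eigenvectors is an eigenvector. -/
lemma exists_mem_eigenSub_of_forall_ne (b : OrthonormalBasis (Fin N) ℝ (Vec N)) (n : Fin N)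
    (h : ∀ i, i ≠ n → ∃ μ, b i ∈ eigenSub N μ) : ∃ μ, b n ∈ eigenSub N μ := by
  set Φ := unitaryDft N (czfun (b n)) with hΦ
  set R : Vec N := ofZfun fun j => (Φ j).re with hR
  set S : Vec N := ofZfun fun j => (Φ j).im with hS
  have horth : ∀ i, i ≠ n → (inner ℝ (b i) R : ℝ) = 0 ∧ (inner ℝ (b i) S : ℝ) = 0 := by
    intro i hi
    obtain ⟨μ, hμ⟩ := h i hi
    have h1 : ∑ j, Φ j * czfun (b i) j = 0 := by
      have h2 := sub_mul_inner_eq_sum (μ := 0) (a := b n) hμ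
      rw [b.orthonormal.2 hi.symm] at h2
      simpa [hΦ] using h2.symm
    have hre := congrArg Complex.re h1
    have him := congrArg Complex.im h1
    simp only [czfun, Complex.re_sum, Complex.im_sum, Complex.re_mul_ofReal,
      Complex.im_mul_ofReal, Complex.zero_re, Complex.zero_im] at hre him
    rw [inner_eq_sum_zfun, inner_eq_sum_zfun, hR, hS, zfun_ofZfun, zfun_ofZfun]
    exact ⟨by simpa only [mul_comm] using hre, by simpa only [mul_comm] using him⟩
  have hrep : ∀ V : Vec N, (∀ i, i ≠ n → (inner ℝ (b i) V : ℝ) = 0) →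
      V = (inner ℝ (b n) V : ℝ) • b n := by
    intro V hV
    conv_lhs => rw [← b.sum_repr' V]
    refine Finset.sum_eq_single n (fun i _ hi => ?_) (by simp)
    rw [hV i hi, zero_smul]
  refine ⟨(inner ℝ (b n) R : ℝ) + (inner ℝ (b n) S : ℝ) * Complex.I, ?_⟩
  rw [mem_eigenSub, ← hΦ]
  funext j
  have h1 := congrFun (congrArg zfun (hrep R fun i hi => (horth i hi).1)) j
  have h2 := congrFun (congrArg zfun (hrep S fun i hi => (horth i hi).2)) j
  rw [zfun_smul, Pi.smul_apply, smul_eq_mul] at h1 h2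
  have h1' : (Φ j).re = zfun R j := by rw [hR, zfun_ofZfun]
  have h2' : (Φ j).im = zfun S j := by rw [hS, zfun_ofZfun]
  rw [Pi.smul_apply, smul_eq_mul, czfun, ← Complex.re_add_im (Φ j), h1', h2', h1, h2]
  push_cast
  ring

lemma isMinimalHermiteBasis_iff (T : OrthonormalBasis (Fin N) ℝ (Vec N)) :
    IsMinimalHermiteBasis T ↔
      (∀ n : Fin N, ∃ μ : ℂ, ((n : ℕ) + 1 < N → μ = (-Complex.I) ^ (n : ℕ)) ∧
        T n ∈ eigenSub N μ) ∧ ∀ n : Fin N, T n ∈ widthSub N ((N + (n : ℕ) + 2) / 4) := by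
  simp only [mem_eigenSub_iff_dft, mem_widthSub_iff_width]
  exact ⟨fun h => ⟨h.1, h.2⟩, fun h => ⟨h.1, h.2⟩⟩

theorem exists_isMinimalHermiteBasis (hN : 2 ≤ N) :
    ∃ T : OrthonormalBasis (Fin N) ℝ (Vec N), IsMinimalHermiteBasis T := by
  classical
  have hbase : ∀ r : ℕ, ∃ (v : Vec N) (w : ℕ), r < 4 → r + 1 < N →
      w ≤ (N + r + 2) / 4 ∧ ∀ q, 4 * q + r + 1 < N →
      (hermiteOpVec^[q] v ∈ eigenSub N ((-Complex.I) ^ (4 * q + r))) ∧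
      HasExactWidth (hermiteOpVec^[q] v) (w + q) := by
    intro r
    by_cases h : r < 4 ∧ r + 1 < N
    · obtain ⟨v, w, h1⟩ := exists_hasExactWidth_iterate h.1 h.2
      exact ⟨v, w, fun _ _ => h1⟩
    · exact ⟨0, 0, fun h1 h2 => absurd ⟨h1, h2⟩ h⟩
  choose v w hvw using hbase
  set f : Fin N → Vec N := fun n => hermiteOpVec^[(n : ℕ) / 4] (v ((n : ℕ) % 4)) with hf
  set W : ℕ → ℕ := fun n => w (n % 4) + n / 4 with hWdef
  have hW : ∀ i n, i < n → i % 4 = n % 4 → W i < W n := by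
    intro i n hin hmod
    simp only [hWdef, hmod]
    omega
  have hWle : ∀ n, n + 1 < N → W n ≤ (N + n + 2) / 4 := by
    intro n hn
    have := (hvw (n % 4) (Nat.mod_lt _ (by norm_num)) (by omega)).1
    simp only [hWdef]
    omega
  have hfprop : ∀ n : Fin N, (n : ℕ) + 1 < N → f n ∈ eigenSub N ((-Complex.I) ^ (n : ℕ)) ∧
      HasExactWidth (f n) (W n) := by
    intro n hn
    have := (hvw ((n : ℕ) % 4) (Nat.mod_lt _ (by norm_num)) (by omega)).2 ((n : ℕ) / 4) (by omega)
    rwa [Nat.div_add_mod] at this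
  have hgs := gramSchmidt_hasExactWidth hW
    (fun n hn => (hWle n hn).trans (by omega)) hfprop
  have hcard : Module.finrank ℝ (Vec N) = Fintype.card (Fin N) := by
    rw [finrank_euclideanSpace, Fintype.card_congr (indexEquiv N), ZMod.card, Fintype.card_fin]
  set b := InnerProductSpace.gramSchmidtOrthonormalBasis hcard f with hb
  have hbn : ∀ n : Fin N, (n : ℕ) + 1 < N → b n ∈ eigenSub N ((-Complex.I) ^ (n : ℕ)) ∧
      b n ∈ widthSub N ((N + (n : ℕ) + 2) / 4) := by
    intro n hn
    obtain ⟨h1, h2⟩ := hgs n hn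
    have hne := ne_zero_of_zfun_ne_zero h2.2
    have hne' : InnerProductSpace.gramSchmidtNormed ℝ f n ≠ 0 := by
      rw [InnerProductSpace.gramSchmidtNormed]
      exact smul_ne_zero (inv_ne_zero (by simpa using hne)) hne
    rw [hb, InnerProductSpace.gramSchmidtOrthonormalBasis_apply hcard hne',
      InnerProductSpace.gramSchmidtNormed]
    exact ⟨Submodule.smul_mem _ _ h1,
      Submodule.smul_mem _ _ (widthSub_mono (hWle n hn) h2.1)⟩
  refine ⟨b, (isMinimalHermiteBasis_iff b).2 ⟨fun n => ?_, fun n => ?_⟩⟩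
  · by_cases hn : (n : ℕ) + 1 < N
    · exact ⟨_, fun _ => rfl, (hbn n hn).1⟩
    · obtain ⟨μ, hμ⟩ := exists_mem_eigenSub_of_forall_ne b n fun i hi =>
        ⟨_, (hbn i (by
          have : (i : ℕ) ≠ n := fun h => hi (Fin.ext h)
          omega)).1⟩
      exact ⟨μ, fun h => absurd h hn, hμ⟩
  · by_cases hn : (n : ℕ) + 1 < N
    · exact (hbn n hn).2
    · exact widthSub_eq_top (by omega) _

end Existence

section Dimension

variable {N : ℕ} [NeZero N]

/-! ### The dimension of the space of doubly concentrated vectors -/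

/-- An uncertainty principle: a function on `ZMod N` carried by `D` consecutive points whose
transform vanishes at `D` consecutive frequencies is zero. -/
lemma eq_zero_of_consecutive {D : ℕ} (hD : D < N) (f : ZMod N → ℂ) (b : ℤ) (c : ℤ)
    (hf : ∀ j : ZMod N, (∀ i < D, j ≠ ((b + i : ℤ) : ZMod N)) → f j = 0)
    (hF : ∀ i < D, unitaryDft N f ((c + i : ℤ) : ZMod N) = 0) : f = 0 := by
  classical
  have hinj : ∀ d : ℤ, Set.InjOn (fun i : ℕ => ((d + i : ℤ) : ZMod N)) (Finset.range D) := by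
    intro d i hi i' hi' h
    simp only [Finset.coe_range, Set.mem_Iio] at hi hi'
    have h' : ((i : ℕ) : ZMod N) = ((i' : ℕ) : ZMod N) := by
      simp only [Int.cast_add, Int.cast_natCast, add_right_inj] at h
      exact h
    rw [ZMod.natCast_eq_natCast_iff] at h'
    exact h'.eq_of_lt_of_lt (hi.trans hD) (hi'.trans hD)
  set P : Polynomial ℂ :=
    ∑ i ∈ Finset.range D, Polynomial.monomial i (f ((b + i : ℤ) : ZMod N)) with hP
  have hroot : ∀ i < D, P.eval (ZMod.stdAddChar (-((c + i : ℤ) : ZMod N)) : ℂ) = 0 := by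
    intro i hi
    set l : ZMod N := ((c + i : ℤ) : ZMod N) with hl
    have h1 := hF i hi
    rw [unitaryDft_apply] at h1
    have hs : (1 / (Real.sqrt (N : ℝ) : ℂ)) ≠ 0 := by
      have := (one_div_sqrt_pos (N := N)).ne'
      exact_mod_cast this
    have h2 := (mul_eq_zero.1 h1).resolve_left hs
    have h3 : ∑ j : ZMod N, (ZMod.stdAddChar (-(j * l)) : ℂ) * f j =
        ∑ k ∈ Finset.range D, (ZMod.stdAddChar (-(((b + k : ℤ) : ZMod N) * l)) : ℂ) *
          f ((b + k : ℤ) : ZMod N) := by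
      rw [← Finset.sum_image (f := fun j : ZMod N => (ZMod.stdAddChar (-(j * l)) : ℂ) * f j)
        (hinj b)]
      refine (Finset.sum_subset (Finset.subset_univ _) fun j _ hj => ?_).symm
      rw [hf j, mul_zero]
      intro k hk hjk
      exact hj (Finset.mem_image.2 ⟨k, Finset.mem_range.2 hk, hjk.symm⟩)
    have h4 : ∑ j : ZMod N, (ZMod.stdAddChar (-(j * l)) : ℂ) * f j =
        (ZMod.stdAddChar (-((b : ZMod N) * l)) : ℂ) * P.eval (ZMod.stdAddChar (-l) : ℂ) := by
      rw [h3, hP, Polynomial.eval_finsetSum, Finset.mul_sum]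
      refine Finset.sum_congr rfl fun k _ => ?_
      rw [Polynomial.eval_monomial, ← AddChar.map_nsmul_eq_pow, mul_comm (f _), ← mul_assoc,
        ← AddChar.map_add_eq_mul]
      congr 2
      push_cast
      rw [nsmul_eq_mul]
      ring
    rw [h4] at h2
    refine (mul_eq_zero.1 h2).resolve_left ?_
    exact (AddChar.val_isUnit _ _).ne_zero
  have hPdeg : P.degree < D := by
    refine (Polynomial.degree_sum_le _ _).trans_lt ?_
    refine (Finset.sup_lt_iff (WithBot.bot_lt_coe D)).2 fun i hi => ?_
    exact (Polynomial.degree_monomial_le _ _).trans_lt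
      (WithBot.coe_lt_coe.2 (Nat.cast_lt.2 (Finset.mem_range.1 hi)))
  have hP0 : P = 0 := by
    refine Polynomial.eq_zero_of_degree_lt_of_eval_index_eq_zero (s := Finset.range D)
      (v := fun i : ℕ => (ZMod.stdAddChar (-((c + i : ℤ) : ZMod N)) : ℂ)) ?_
      (by simpa using hPdeg) fun i hi => hroot i (Finset.mem_range.1 hi)
    intro i hi i' hi' h
    exact hinj c hi hi' (neg_injective (ZMod.injective_stdAddChar h))
  funext j
  by_cases hj : ∀ i < D, j ≠ ((b + i : ℤ) : ZMod N)
  · exact hf j hj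
  · push Not at hj
    obtain ⟨i, hi, rfl⟩ := hj
    have h5 : P.coeff i = f ((b + i : ℤ) : ZMod N) := by
      rw [hP, Polynomial.finsetSum_coeff]
      simp only [Polynomial.coeff_monomial]
      rw [Finset.sum_ite_eq' (Finset.range D) i, if_pos (Finset.mem_range.2 hi)]
    rw [← h5, hP0]
    simp

/-- A doubly concentrated vector is determined by its values at the points `-m + i`,
`i < 4m + 2 - N`: if they vanish, then `N - 2m - 1` consecutive points are left, the number of
frequencies at which the transform vanishes. -/
lemma finrank_biWidthSub_le {m : ℕ} (h1 : N ≤ 4 * m + 2) (h2 : 2 * m < N) :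
    Module.finrank ℝ (biWidthSub N m) ≤ 4 * m + 2 - N := by
  let φ : biWidthSub N m →ₗ[ℝ] (Fin (4 * m + 2 - N) → ℝ) :=
    { toFun := fun a i => zfun (a : Vec N) ((-m + (i : ℕ) : ℤ) : ZMod N)
      map_add' := fun a b => by funext i; simp
      map_smul' := fun c a => by funext i; simp }
  have hφ : Function.Injective φ := by
    rw [← LinearMap.ker_eq_bot, LinearMap.ker_eq_bot']
    rintro ⟨a, ha⟩ hz
    have hz' : ∀ i : ℕ, i < 4 * m + 2 - N → zfun a ((-m + i : ℤ) : ZMod N) = 0 := fun i hi =>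
      congrFun hz ⟨i, hi⟩
    have key : czfun a = 0 := by
      refine eq_zero_of_consecutive (D := N - 2 * m - 1) (by omega) _ (3 * m + 2 - N) (m + 1)
        (fun j hj => ?_) (fun i hi => ha.2 _ ?_)
      · rw [czfun, Complex.ofReal_eq_zero]
        by_cases hjm : m < j.valMinAbs.natAbs
        · exact ha.1 j hjm
        · by_cases hjl : j.valMinAbs < 3 * m + 2 - N
          · have h3 := hz' (j.valMinAbs + m).toNat (by omega)
            have h4 : (-m + ((j.valMinAbs + m).toNat : ℤ)) = j.valMinAbs := by omega
            rwa [h4, ZMod.coe_valMinAbs] at h3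
          · have h3 := hj (j.valMinAbs - (3 * m + 2 - N)).toNat (by omega)
            have h4 : (3 * m + 2 - N + ((j.valMinAbs - (3 * m + 2 - N)).toNat : ℤ)) =
                j.valMinAbs := by omega
            rw [h4, ZMod.coe_valMinAbs] at h3
            exact absurd rfl h3
      · have hc : ((m + 1 + i : ℤ) : ZMod N) = ((m + 1 + i : ℕ) : ZMod N) := by push_cast; ring
        rw [hc]
        rcases Nat.lt_or_ge (N / 2) (m + 1 + i) with h | h
        · rw [ZMod.valMinAbs_natCast_of_half_lt h (by omega)]
          omega
        · rw [natAbs_valMinAbs_natCast h]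
          omega
    have : a = 0 := by
      apply zfun_injective
      funext j
      have := congrFun key j
      rw [czfun, Pi.zero_apply, Complex.ofReal_eq_zero] at this
      rw [this]
      simp [zfun]
    exact Subtype.ext this
  simpa using LinearMap.finrank_le_finrank_of_injective hφ

/-- The doubly concentrated vectors are spanned by the first elements of a minimal Hermite-type
basis, so they are orthogonal to the others. -/
lemma inner_eq_zero_of_mem_biWidthSub {T : OrthonormalBasis (Fin N) ℝ (Vec N)}
    (hT : IsMinimalHermiteBasis T) {m : ℕ} (h1 : N ≤ 4 * m + 2) (h2 : 2 * m < N) {a : Vec N}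
    (ha : a ∈ biWidthSub N m) {j : Fin N} (hj : 4 * m + 2 - N ≤ j) :
    (inner ℝ (T j) a : ℝ) = 0 := by
  rw [isMinimalHermiteBasis_iff] at hT
  have hle : 4 * m + 2 - N ≤ N := by omega
  set S : Submodule ℝ (Vec N) :=
    Submodule.span ℝ (Set.range fun i : Fin (4 * m + 2 - N) => T (Fin.castLE hle i)) with hS
  have hSle : S ≤ biWidthSub N m := by
    rw [hS, Submodule.span_le]
    rintro _ ⟨i, rfl⟩
    obtain ⟨μ, -, hμ⟩ := hT.1 (Fin.castLE hle i)
    refine mem_biWidthSub_of_mem_eigenSub hμ (widthSub_mono ?_ (hT.2 _))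
    have := i.2
    simp only [Fin.val_castLE]
    omega
  have hSrank : Module.finrank ℝ S = 4 * m + 2 - N := by
    rw [hS, finrank_span_eq_card, Fintype.card_fin]
    exact T.orthonormal.linearIndependent.comp _ (Fin.castLE_injective hle)
  have hSeq : S = biWidthSub N m := by
    refine Submodule.eq_of_le_of_finrank_le hSle ?_
    rw [hSrank]
    exact finrank_biWidthSub_le h1 h2
  rw [← hSeq, hS] at ha
  induction ha using Submodule.span_induction with
  | mem x hx =>
    obtain ⟨i, rfl⟩ := hx
    refine T.orthonormal.2 fun h => ?_
    have := i.2
    rw [h, Fin.val_castLE] at hj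
    omega
  | zero => simp
  | add x y _ _ hx hy => rw [inner_add_right, hx, hy, add_zero]
  | smul c x _ hx => rw [inner_smul_right, hx, mul_zero]

end Dimension

section GaussPoly

open Polynomial Real FourierTransform

/-! ### Gaussians times polynomials and their Fourier transforms -/

lemma exists_abs_pow_mul_exp_le (n : ℕ) {c : ℝ} (hc : 0 < c) :
    ∃ C : ℝ, ∀ x : ℝ, |x| ^ n * exp (-c * x ^ 2) ≤ C := by
  refine ⟨1 + n.factorial / c ^ n, fun x => ?_⟩
  have h1 : |x| ^ n ≤ 1 + (x ^ 2) ^ n := by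
    rw [← sq_abs x, ← pow_mul, mul_comm 2 n, pow_mul]
    nlinarith [sq_nonneg (|x| ^ n - 1), sq_nonneg (|x| ^ n)]
  have h2 : (c * x ^ 2) ^ n / n.factorial ≤ exp (c * x ^ 2) :=
    pow_div_factorial_le_exp _ (by positivity) n
  have h3 : exp (-c * x ^ 2) ≤ 1 := by
    rw [exp_le_one_iff]; nlinarith [sq_nonneg x]
  have h4 : exp (c * x ^ 2) * exp (-c * x ^ 2) = 1 := by
    rw [← exp_add]; simp
  have h5 : (x ^ 2) ^ n ≤ n.factorial / c ^ n * exp (c * x ^ 2) := by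
    rw [mul_pow, div_le_iff₀ (by positivity)] at h2
    rw [div_mul_eq_mul_div, le_div_iff₀ (by positivity)]
    linarith
  have h6 : (x ^ 2) ^ n * exp (-c * x ^ 2) ≤ n.factorial / c ^ n := by
    calc _ ≤ n.factorial / c ^ n * exp (c * x ^ 2) * exp (-c * x ^ 2) := by gcongr
      _ = _ := by rw [mul_assoc, h4, mul_one]
  calc |x| ^ n * exp (-c * x ^ 2) ≤ (1 + (x ^ 2) ^ n) * exp (-c * x ^ 2) := by gcongr
    _ = exp (-c * x ^ 2) + (x ^ 2) ^ n * exp (-c * x ^ 2) := by ring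
    _ ≤ _ := add_le_add h3 h6

lemma exists_pow_mul_norm_eval_mul_exp_le (P : ℂ[X]) (q : ℕ) {c : ℝ} (hc : 0 < c) :
    ∃ C : ℝ, ∀ x : ℝ, |x| ^ q * ‖P.eval (x : ℂ)‖ * exp (-c * x ^ 2) ≤ C := by
  induction P using Polynomial.induction_on' with
  | add P Q hP hQ =>
    obtain ⟨C, hC⟩ := hP
    obtain ⟨D, hD⟩ := hQ
    refine ⟨C + D, fun x => ?_⟩
    rw [eval_add]
    calc _ ≤ |x| ^ q * (‖P.eval (x : ℂ)‖ + ‖Q.eval (x : ℂ)‖) * exp (-c * x ^ 2) := by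
          gcongr; exact norm_add_le _ _
      _ = |x| ^ q * ‖P.eval (x : ℂ)‖ * exp (-c * x ^ 2) +
          |x| ^ q * ‖Q.eval (x : ℂ)‖ * exp (-c * x ^ 2) := by ring
      _ ≤ _ := add_le_add (hC x) (hD x)
  | monomial n a =>
    obtain ⟨C, hC⟩ := exists_abs_pow_mul_exp_le (q + n) hc
    refine ⟨‖a‖ * C, fun x => ?_⟩
    have : |x| ^ q * ‖(monomial n a).eval (x : ℂ)‖ * exp (-c * x ^ 2) =
        ‖a‖ * (|x| ^ (q + n) * exp (-c * x ^ 2)) := by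
      rw [eval_monomial, norm_mul, norm_pow, Complex.norm_real, norm_eq_abs, pow_add]
      ring
    rw [this]
    exact mul_le_mul_of_nonneg_left (hC x) (norm_nonneg a)

/-- The function `P(x) exp (-π x ^ 2)`. -/
noncomputable def gaussPoly (P : ℂ[X]) (x : ℝ) : ℂ :=
  P.eval (x : ℂ) * (exp (-π * x ^ 2) : ℝ)

lemma norm_gaussPoly (P : ℂ[X]) (x : ℝ) :
    ‖gaussPoly P x‖ = ‖P.eval (x : ℂ)‖ * exp (-π * x ^ 2) := by
  rw [gaussPoly, norm_mul, Complex.norm_real, norm_eq_abs, abs_of_pos (exp_pos _)]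

lemma exists_pow_mul_norm_gaussPoly_le (P : ℂ[X]) (q : ℕ) :
    ∃ C : ℝ, ∀ x : ℝ, |x| ^ q * ‖gaussPoly P x‖ ≤ C := by
  obtain ⟨C, hC⟩ := exists_pow_mul_norm_eval_mul_exp_le P q pi_pos
  exact ⟨C, fun x => by rw [norm_gaussPoly, ← mul_assoc]; exact hC x⟩

lemma hasDerivAt_gaussPoly (P : ℂ[X]) (x : ℝ) :
    HasDerivAt (gaussPoly P) (gaussPoly (derivative P - C (2 * π : ℂ) * X * P) x) x := by
  have h1 : HasDerivAt (fun x : ℝ => P.eval (x : ℂ)) ((derivative P).eval (x : ℂ)) x :=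
    (P.hasDerivAt (x : ℂ)).comp_ofReal
  have h2 : HasDerivAt (fun x : ℝ => exp (-π * x ^ 2)) (exp (-π * x ^ 2) * (-π * (2 * x))) x := by
    have := ((hasDerivAt_pow 2 x).const_mul (-π)).exp
    simpa using this
  have h3 := h1.mul h2.ofReal_comp
  refine h3.congr_deriv ?_
  simp only [gaussPoly, eval_sub, eval_mul, eval_C, eval_X]
  push_cast
  ring

lemma continuous_gaussPoly (P : ℂ[X]) : Continuous (gaussPoly P) :=
  continuous_iff_continuousAt.2 fun x => (hasDerivAt_gaussPoly P x).continuousAt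

lemma integrable_gaussPoly (P : ℂ[X]) : MeasureTheory.Integrable (gaussPoly P) := by
  obtain ⟨C, hC⟩ := exists_pow_mul_norm_eval_mul_exp_le P 0 (half_pos pi_pos)
  have h := (integrable_exp_neg_mul_sq (half_pos pi_pos)).const_mul C
  refine h.mono' (continuous_gaussPoly P).aestronglyMeasurable (Filter.Eventually.of_forall ?_)
  intro x
  have h1 := hC x
  rw [pow_zero, one_mul] at h1
  rw [norm_gaussPoly, show -π * x ^ 2 = -(π / 2) * x ^ 2 + -(π / 2) * x ^ 2 by ring, exp_add,
    ← mul_assoc]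
  gcongr

/-- The relation saying that the Fourier transform of `P(x) exp (-π x ^ 2)` is
`Q(x) exp (-π x ^ 2)`. -/
def IsFourierPair (P Q : ℂ[X]) : Prop := 𝓕 (gaussPoly P) = gaussPoly Q

lemma gaussPoly_add (P Q : ℂ[X]) : gaussPoly (P + Q) = gaussPoly P + gaussPoly Q := by
  funext x
  simp only [gaussPoly, eval_add, Pi.add_apply]
  ring

lemma gaussPoly_C_mul (a : ℂ) (P : ℂ[X]) : gaussPoly (C a * P) = fun x => a * gaussPoly P x := by
  funext x
  simp only [gaussPoly, eval_mul, eval_C]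
  ring

lemma IsFourierPair.add {P Q P' Q' : ℂ[X]} (h : IsFourierPair P Q) (h' : IsFourierPair P' Q') :
    IsFourierPair (P + P') (Q + Q') := by
  unfold IsFourierPair at *
  rw [gaussPoly_add, gaussPoly_add, ← h, ← h']
  exact VectorFourier.fourierIntegral_add continuous_fourierChar
    (by exact continuous_inner) (integrable_gaussPoly P) (integrable_gaussPoly P')

lemma IsFourierPair.const_mul {P Q : ℂ[X]} (h : IsFourierPair P Q) (a : ℂ) :
    IsFourierPair (C a * P) (C a * Q) := by
  unfold IsFourierPair at *
  rw [gaussPoly_C_mul, gaussPoly_C_mul, ← h]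
  funext w
  rw [fourier_real_eq, fourier_real_eq, ← MeasureTheory.integral_const_mul]
  congr 1
  funext v
  rw [Circle.smul_def, Circle.smul_def, smul_eq_mul, smul_eq_mul]
  ring

lemma isFourierPair_one : IsFourierPair 1 1 := by
  have h := fourier_gaussian_pi (b := 1) (by simp)
  have h1 : gaussPoly 1 = fun x : ℝ => Complex.exp (-π * 1 * (x : ℂ) ^ 2) := by
    funext x
    simp [gaussPoly]
  unfold IsFourierPair
  rw [h1, h]
  funext t
  simp

/-- The Fourier transform exchanges differentiation and multiplication by the variable. -/
lemma IsFourierPair.derivative {P Q : ℂ[X]} (h : IsFourierPair P Q) :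
    IsFourierPair (derivative P - C (2 * π : ℂ) * X * P) (C (2 * π * Complex.I) * (X * Q)) := by
  have hd : deriv (gaussPoly P) = gaussPoly (Polynomial.derivative P - C (2 * π : ℂ) * X * P) :=
    funext fun x => (hasDerivAt_gaussPoly P x).deriv
  have h1 := Real.fourier_deriv (integrable_gaussPoly P)
    (fun x => (hasDerivAt_gaussPoly P x).differentiableAt)
    (by rw [hd]; exact integrable_gaussPoly _)
  unfold IsFourierPair at *
  rw [hd] at h1
  rw [h1, h]
  funext x
  simp only [gaussPoly, eval_mul, eval_C, eval_X, smul_eq_mul]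
  ring

lemma IsFourierPair.X_mul {P Q : ℂ[X]} (h : IsFourierPair P Q) :
    IsFourierPair (X * P)
      (C (Complex.I / (2 * π)) * (Polynomial.derivative Q - C (2 * π : ℂ) * X * Q)) := by
  have hX : (fun x : ℝ => x • gaussPoly P x) = gaussPoly (X * P) := by
    funext x
    simp only [gaussPoly, eval_mul, eval_X, Complex.real_smul]
    ring
  have hX2 : (fun x : ℝ => (-2 * π * Complex.I * x) • gaussPoly P x) =
      gaussPoly (C (-2 * π * Complex.I) * (X * P)) := by
    funext x
    simp only [gaussPoly, eval_mul, eval_X, eval_C, smul_eq_mul]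
    ring
  have h1 : 𝓕 (gaussPoly (C (-2 * π * Complex.I) * (X * P))) =
      gaussPoly (Polynomial.derivative Q - C (2 * π : ℂ) * X * Q) := by
    funext w
    have h2 := Real.hasDerivAt_fourier (integrable_gaussPoly P)
      (by rw [hX]; exact integrable_gaussPoly _) w
    rw [hX2, h] at h2
    exact h2.unique (hasDerivAt_gaussPoly Q w)
  have h3 := IsFourierPair.const_mul h1 (Complex.I / (2 * π))
  have hpi : (π : ℂ) ≠ 0 := by exact_mod_cast pi_ne_zero
  have h4 : C (Complex.I / (2 * π)) * (C (-2 * π * Complex.I) * (X * P)) = X * P := by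
    rw [← mul_assoc, ← C_mul]
    have : Complex.I / (2 * π) * (-2 * π * Complex.I) = 1 := by
      field_simp
      rw [Complex.I_sq]
      ring
    rw [this, C_1, one_mul]
  rwa [h4] at h3

lemma exists_isFourierPair (P : ℂ[X]) : ∃ Q, IsFourierPair P Q := by
  induction P using Polynomial.induction_on' with
  | add P Q hP hQ =>
    obtain ⟨P', hP⟩ := hP
    obtain ⟨Q', hQ⟩ := hQ
    exact ⟨_, hP.add hQ⟩
  | monomial n a =>
    have : ∀ n : ℕ, ∃ Q, IsFourierPair (X ^ n) Q := by
      intro n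
      induction n with
      | zero => exact ⟨1, by simpa using isFourierPair_one⟩
      | succ n ih =>
        obtain ⟨Q, hQ⟩ := ih
        exact ⟨_, by rw [pow_succ']; exact hQ.X_mul⟩
    obtain ⟨Q, hQ⟩ := this n
    rw [← C_mul_X_pow_eq_monomial]
    exact ⟨_, hQ.const_mul a⟩

/-! ### Poisson summation and lattice sums -/

lemma isBigO_gaussPoly_comp_mul (P : ℂ[X]) {a : ℝ} (ha : 0 < a) :
    (fun x : ℝ => gaussPoly P (a * x)) =O[Filter.cocompact ℝ] fun x : ℝ => |x| ^ (-2 : ℝ) := by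
  obtain ⟨D, hD⟩ := exists_pow_mul_norm_gaussPoly_le P 2
  refine Asymptotics.IsBigO.of_bound (D / a ^ 2) ?_
  have h0 : ∀ᶠ x : ℝ in Filter.cocompact ℝ, x ≠ 0 := by
    have := (isCompact_singleton (x := (0 : ℝ))).compl_mem_cocompact
    exact this
  filter_upwards [h0] with x hx
  have h1 := hD (a * x)
  have hx' : 0 < |x| := abs_pos.2 hx
  rw [rpow_neg hx'.le, norm_inv, norm_eq_abs, abs_of_pos (by positivity), ← div_eq_mul_inv,
    div_div, le_div_iff₀ (by positivity), rpow_two]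
  rw [abs_mul, abs_of_pos ha, mul_pow] at h1
  linarith

lemma fourier_gaussPoly_comp_mul {P Q : ℂ[X]} (h : IsFourierPair P Q) {a : ℝ} (ha : 0 < a) (w : ℝ) :
    𝓕 (fun x : ℝ => gaussPoly P (a * x)) w = (a : ℂ)⁻¹ * gaussPoly Q (w / a) := by
  rw [← h, fourier_real_eq, fourier_real_eq]
  have h1 := MeasureTheory.Measure.integral_comp_mul_left
    (fun v : ℝ => 𝐞 (-(v * (w / a))) • gaussPoly P v) a
  rw [abs_of_pos (inv_pos.2 ha), Complex.real_smul, Complex.ofReal_inv] at h1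
  rw [← h1]
  congr 1
  funext v
  congr 3
  field_simp

lemma summable_gaussPoly_comp_mul (P : ℂ[X]) {a : ℝ} (ha : 0 < a) :
    Summable fun n : ℤ => gaussPoly P (a * n) :=
  summable_of_isBigO (Real.summable_abs_int_rpow one_lt_two)
    ((isBigO_gaussPoly_comp_mul P ha).comp_tendsto Int.tendsto_coe_cofinite)

/-- Poisson summation for a Gaussian times a polynomial, on a lattice of step `a`. -/
lemma tsum_gaussPoly_eq {P Q : ℂ[X]} (h : IsFourierPair P Q) {a : ℝ} (ha : 0 < a) (x : ℝ) :
    ∑' n : ℤ, gaussPoly P (a * (x + n)) =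
      ∑' n : ℤ, (a : ℂ)⁻¹ * gaussPoly Q (n / a) * Complex.exp (2 * π * Complex.I * n * x) := by
  have hF : 𝓕 (fun x : ℝ => gaussPoly P (a * x)) =
      fun w => (a : ℂ)⁻¹ * gaussPoly Q (a⁻¹ * w) := by
    funext w
    rw [fourier_gaussPoly_comp_mul h ha, div_eq_inv_mul]
  have h1 := Real.tsum_eq_tsum_fourier_of_rpow_decay (f := fun x : ℝ => gaussPoly P (a * x))
    (by have := continuous_gaussPoly P; fun_prop) one_lt_two (isBigO_gaussPoly_comp_mul P ha)
    (by rw [hF]; exact (isBigO_gaussPoly_comp_mul Q (inv_pos.2 ha)).const_mul_left _) x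
  rw [h1, hF]
  congr 1
  funext n
  rw [fourier_coe_apply, Complex.ofReal_one, div_one]
  simp only [div_eq_inv_mul]

lemma norm_tsum_sub_sum_le {F : ℤ → ℂ} {B : ℤ → ℝ} (hF : Summable F) (hB : Summable B)
    (hB0 : ∀ k, 0 ≤ B k) (s : Finset ℤ) (h : ∀ k ∉ s, ‖F k‖ ≤ B k) :
    ‖∑' k, F k - ∑ k ∈ s, F k‖ ≤ ∑' k, B k := by
  classical
  have h1 : HasSum (fun k => if k ∈ s then F k else 0) (∑ k ∈ s, F k) := by
    have : HasSum (fun k => if k ∈ s then F k else 0) (∑ k ∈ s, if k ∈ s then F k else 0) :=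
      hasSum_sum_of_ne_finset_zero fun k hk => if_neg hk
    rwa [Finset.sum_congr rfl fun k hk => if_pos hk] at this
  have h2 := hF.hasSum.sub h1
  have h3 : ∑' k, (F k - if k ∈ s then F k else 0) = ∑' k, F k - ∑ k ∈ s, F k := h2.tsum_eq
  rw [← h3]
  refine tsum_of_norm_bounded hB.hasSum fun k => ?_
  by_cases hk : k ∈ s
  · simpa [hk] using hB0 k
  · simpa [hk] using h k hk

lemma summable_int_one_div_sq : Summable fun k : ℤ => 1 / (k : ℝ) ^ 2 :=
  Real.summable_one_div_int_pow.2 one_lt_two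

/-- Far from the origin, on the scale of `N`, the samples of a Gaussian times a polynomial on a
lattice of step `√(c / N)` are negligible. -/
lemma exists_norm_gaussPoly_tail_le (P : ℂ[X]) {c : ℝ} (hc : 0 < c) :
    ∃ D : ℝ, 0 ≤ D ∧ ∀ N : ℕ, 0 < N → ∀ k : ℤ, (N : ℝ) ≤ 2 * |(k : ℝ)| →
      ‖gaussPoly P (√(c / N) * k)‖ ≤ D / (N : ℝ) ^ 3 * (1 / (k : ℝ) ^ 2) := by
  obtain ⟨D, hD⟩ := exists_pow_mul_norm_gaussPoly_le P 10
  have hD0 : 0 ≤ D := le_trans (by positivity) (hD 0)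
  refine ⟨D * 2 ^ 8 / c ^ 5, by positivity, fun N hN k hk => ?_⟩
  have hN' : (0 : ℝ) < N := Nat.cast_pos.2 hN
  have hk0 : 0 < |(k : ℝ)| := by linarith
  have h1 := hD (√(c / N) * k)
  have h2 : |√(c / N) * k| ^ 10 = (c / N) ^ 5 * |(k : ℝ)| ^ 10 := by
    rw [abs_mul, abs_of_nonneg (sqrt_nonneg _), mul_pow, show 10 = 2 * 5 from rfl, pow_mul,
      sq_sqrt (by positivity), pow_mul]
  rw [h2] at h1
  set g := ‖gaussPoly P (√(c / N) * k)‖ with hg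
  have hg0 : 0 ≤ g := norm_nonneg _
  rw [← sq_abs (k : ℝ)]
  have h3 : (N : ℝ) ^ 8 ≤ 2 ^ 8 * |(k : ℝ)| ^ 8 := by
    rw [← mul_pow]; gcongr
  have h4 : g * ((N : ℝ) ^ 3 * |(k : ℝ)| ^ 2 * c ^ 5) ≤ D * 2 ^ 8 := by
    rw [div_pow] at h1
    have h5 : c ^ 5 * |(k : ℝ)| ^ 10 * g ≤ D * N ^ 5 := by
      rw [div_mul_eq_mul_div, div_mul_eq_mul_div, div_le_iff₀ (by positivity)] at h1
      exact h1
    have h6 : c ^ 5 * |(k : ℝ)| ^ 2 * g * (N : ℝ) ^ 8 ≤ D * N ^ 5 * 2 ^ 8 := by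
      calc c ^ 5 * |(k : ℝ)| ^ 2 * g * (N : ℝ) ^ 8
          ≤ c ^ 5 * |(k : ℝ)| ^ 2 * g * (2 ^ 8 * |(k : ℝ)| ^ 8) := by gcongr
        _ = c ^ 5 * |(k : ℝ)| ^ 10 * g * 2 ^ 8 := by ring
        _ ≤ _ := by gcongr
    have h7 : (g * ((N : ℝ) ^ 3 * |(k : ℝ)| ^ 2 * c ^ 5)) * N ^ 5 ≤ (D * 2 ^ 8) * N ^ 5 := by
      linarith
    exact le_of_mul_le_mul_right h7 (by positivity)
  rw [div_div, div_mul_div_comm, mul_one, le_div_iff₀ (by positivity)]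
  calc g * (c ^ 5 * (N : ℝ) ^ 3 * |(k : ℝ)| ^ 2)
      = g * ((N : ℝ) ^ 3 * |(k : ℝ)| ^ 2 * c ^ 5) := by ring
    _ ≤ _ := h4

lemma le_two_mul_abs_of_notMem_indexSet {N : ℕ} {k : ℤ} (hk : k ∉ indexSet N) :
    (N : ℝ) ≤ 2 * |(k : ℝ)| := by
  rw [mem_indexSet_iff, Set.mem_Ioc] at hk
  have h : (N : ℤ) ≤ 2 * |k| := by
    rcases abs_cases k with h | h <;> omega
  have := (Int.cast_le (R := ℝ)).2 h
  push_cast at this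
  exact this

/-- Riemann sums of a Gaussian times a polynomial over `I_N`, with step `√(c / N)`, converge to
the integral with error `O(1 / N)`. -/
lemma exists_norm_sum_gaussPoly_sub_integral_le (P : ℂ[X]) {c : ℝ} (hc : 0 < c) :
    ∃ D : ℝ, ∀ N : ℕ, 0 < N →
      ‖(√(c / N) : ℂ) * ∑ k ∈ indexSet N, gaussPoly P (√(c / N) * k) - ∫ x, gaussPoly P x‖
        ≤ D / N := by
  obtain ⟨Q, hQ⟩ := exists_isFourierPair P
  obtain ⟨D, hD0, hD⟩ := exists_norm_gaussPoly_tail_le P hc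
  obtain ⟨E, hE⟩ := exists_pow_mul_norm_gaussPoly_le Q 2
  have hE0 : 0 ≤ E := le_trans (by positivity) (hE 0)
  set Z := ∑' k : ℤ, 1 / (k : ℝ) ^ 2 with hZ
  have hZ0 : 0 ≤ Z := tsum_nonneg fun k => by positivity
  refine ⟨√c * (D * Z) + c * E * Z, fun N hN => ?_⟩
  have hN' : (0 : ℝ) < N := Nat.cast_pos.2 hN
  have hN1 : (1 : ℝ) ≤ N := by exact_mod_cast hN
  set h := √(c / N) with hh
  have hpos : 0 < h := sqrt_pos.2 (by positivity)
  have hsq : h ^ 2 = c / N := sq_sqrt (by positivity)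
  have hle : h ≤ √c := sqrt_le_sqrt (div_le_self hc.le hN1)
  -- By Poisson summation the full Riemann sum is a sum over the transform, whose term at `0` is
  -- the integral; the other terms and the tail of the Riemann sum are negligible.
  have hP : ∑' n : ℤ, gaussPoly P (h * n) = ∑' n : ℤ, (h : ℂ)⁻¹ * gaussPoly Q (n / h) := by
    have := tsum_gaussPoly_eq hQ hpos 0
    simpa using this
  have h1 : ‖∑' n : ℤ, gaussPoly P (h * n) - ∑ k ∈ indexSet N, gaussPoly P (h * k)‖
      ≤ D / (N : ℝ) ^ 3 * Z := by
    rw [hZ, ← tsum_mul_left]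
    exact norm_tsum_sub_sum_le (summable_gaussPoly_comp_mul P hpos)
      (summable_int_one_div_sq.mul_left _) (fun k => by positivity) _
      fun k hk => hD N hN k (le_two_mul_abs_of_notMem_indexSet hk)
  have h2 : ‖∑' n : ℤ, gaussPoly Q (n / h) - ∑ n ∈ ({0} : Finset ℤ), gaussPoly Q (n / h)‖
      ≤ c * E / N * Z := by
    rw [hZ, ← tsum_mul_left]
    refine norm_tsum_sub_sum_le ?_ (summable_int_one_div_sq.mul_left _)
      (fun k => by positivity) _ fun k hk => ?_
    · simpa only [div_eq_inv_mul] using summable_gaussPoly_comp_mul Q (inv_pos.2 hpos)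
    · have hk0 : (k : ℝ) ≠ 0 := by
        rw [Int.cast_ne_zero]; simpa using hk
      have h3 := hE (k / h)
      rw [sq_abs, div_pow, hsq] at h3
      have hk2 : 0 < (k : ℝ) ^ 2 := by positivity
      rw [mul_one_div, div_div, le_div_iff₀ (by positivity)]
      rw [div_div_eq_mul_div, div_mul_eq_mul_div, div_le_iff₀ hc] at h3
      linarith
  have hint : ∫ x, gaussPoly P x = gaussPoly Q 0 := by
    rw [← hQ, fourier_real_eq]
    simp
  have h3 : (h : ℂ) * ∑' n : ℤ, gaussPoly P (h * n) = ∑' n : ℤ, gaussPoly Q (n / h) := by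
    rw [hP, tsum_mul_left, ← mul_assoc, mul_inv_cancel₀ (by exact_mod_cast hpos.ne'), one_mul]
  have h4 : (h : ℂ) * ∑ k ∈ indexSet N, gaussPoly P (h * k) - ∫ x, gaussPoly P x =
      (∑' n : ℤ, gaussPoly Q (n / h) - ∑ n ∈ ({0} : Finset ℤ), gaussPoly Q (n / h)) -
      h * (∑' n : ℤ, gaussPoly P (h * n) - ∑ k ∈ indexSet N, gaussPoly P (h * k)) := by
    rw [mul_sub, h3, hint]
    simp
  rw [h4]
  refine (norm_sub_le _ _).trans ?_
  rw [norm_mul, Complex.norm_real, norm_eq_abs, abs_of_pos hpos]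
  have h5 : D / (N : ℝ) ^ 3 * Z ≤ D * Z / N := by
    rw [div_mul_eq_mul_div]
    have : (N : ℝ) ≤ N ^ 3 := le_self_pow₀ hN1 (by norm_num)
    gcongr
  calc _ ≤ c * E / N * Z + √c * (D * Z / N) := by
        have : h * ‖∑' n : ℤ, gaussPoly P (h * n) - ∑ k ∈ indexSet N, gaussPoly P (h * k)‖ ≤
          √c * (D * Z / N) := mul_le_mul hle (h1.trans h5) (norm_nonneg _) (sqrt_nonneg _)
        linarith
    _ = _ := by ring

end GaussPoly

section HermitePoly

open Polynomial Real FourierTransform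

/-! ### Hermite polynomials -/

/-- The Hermite polynomials, with the sign convention `(d/dx)^n e^{-x²} = H_n(x) e^{-x²}`. -/
noncomputable def hermitePoly : ℕ → ℝ[X]
  | 0 => 1
  | n + 1 => derivative (hermitePoly n) - C 2 * X * hermitePoly n

lemma hermitePoly_succ (n : ℕ) :
    hermitePoly (n + 1) = derivative (hermitePoly n) - C 2 * X * hermitePoly n := rfl

lemma iteratedDeriv_gaussian (n : ℕ) :
    iteratedDeriv n (fun y : ℝ => exp (-y ^ 2)) =
      fun x => (hermitePoly n).eval x * exp (-x ^ 2) := by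
  induction n with
  | zero => simp [hermitePoly]
  | succ n ih =>
    rw [iteratedDeriv_succ, ih]
    funext x
    have h1 : HasDerivAt (fun x : ℝ => exp (-x ^ 2)) (exp (-x ^ 2) * (-(2 * x))) x := by
      have := ((hasDerivAt_pow 2 x).neg).exp
      simpa using this
    have h2 : HasDerivAt (fun x => (hermitePoly n).eval x * exp (-x ^ 2)) _ x :=
      ((hermitePoly n).hasDerivAt x).mul h1
    rw [h2.deriv, hermitePoly_succ]
    simp only [eval_sub, eval_mul, eval_C, eval_X]
    ring

/-- The signed normalizing constant of the Hermite function. -/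
noncomputable def hermiteConst (n : ℕ) : ℝ :=
  (-1) ^ n * (√π * 2 ^ n * (n.factorial : ℝ)) ^ (-(1 / 2) : ℝ)

lemma hermiteFun_eq (n : ℕ) (x : ℝ) :
    hermiteFun n x = hermiteConst n * ((hermitePoly n).eval x * exp (-x ^ 2 / 2)) := by
  rw [hermiteFun, iteratedDeriv_gaussian, hermiteConst]
  have : exp (x ^ 2 / 2) * exp (-x ^ 2) = exp (-x ^ 2 / 2) := by
    rw [← exp_add]; ring_nf
  rw [← this]
  ring

lemma hermiteConst_sq (n : ℕ) : √π * (hermiteConst n ^ 2 * (2 ^ n * n.factorial)) = 1 := by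
  have h0 : 0 < √π * 2 ^ n * (n.factorial : ℝ) := by positivity
  have h1 : hermiteConst n ^ 2 = (√π * 2 ^ n * (n.factorial : ℝ))⁻¹ := by
    rw [hermiteConst, mul_pow, ← pow_mul, mul_comm n 2, pow_mul, neg_one_sq, one_pow, one_mul,
      ← rpow_natCast, ← rpow_mul h0.le]
    norm_num
    rw [rpow_neg_one]
    ring
  rw [h1]
  field_simp

/-- The Hermite polynomial `H_n` has degree at most `n` and the parity of `n`. -/
lemma hermitePoly_coeff_eq_zero {n k : ℕ} (h : n < k ∨ k % 2 ≠ n % 2) :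
    (hermitePoly n).coeff k = 0 := by
  induction n generalizing k with
  | zero =>
    rw [hermitePoly, coeff_one, if_neg (by omega)]
  | succ n ih =>
    rw [hermitePoly_succ, coeff_sub, coeff_derivative, ih (by omega), zero_mul, zero_sub,
      neg_eq_zero, mul_assoc, coeff_C_mul]
    cases k with
    | zero => rw [coeff_X_mul_zero, mul_zero]
    | succ k => rw [coeff_X_mul, ih (by omega), mul_zero]

lemma derivative_hermitePoly_succ (n : ℕ) :
    derivative (hermitePoly (n + 1)) = C (-2 * (n + 1) : ℝ) * hermitePoly n := by
  induction n with
  | zero => simp [hermitePoly]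
  | succ n ih =>
    have h := hermitePoly_succ n
    rw [hermitePoly_succ (n + 1), ih]
    simp only [derivative_sub, derivative_mul, derivative_C, derivative_X, ih]
    simp only [map_mul, map_add, map_neg, map_one, Nat.cast_add, Nat.cast_one, zero_mul, zero_add,
      map_natCast]
    linear_combination (C (2 : ℝ) * (n + 1)) * h

/-- The complex polynomial `p(a X)`. -/
noncomputable def scaledPoly (a : ℝ) (p : ℝ[X]) : ℂ[X] :=
  (p.map (algebraMap ℝ ℂ)).comp (C (a : ℂ) * X)

lemma eval_scaledPoly (a : ℝ) (p : ℝ[X]) (x : ℝ) :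
    (scaledPoly a p).eval (x : ℂ) = (p.eval (a * x) : ℝ) := by
  rw [scaledPoly, eval_comp, eval_mul, eval_C, eval_X, ← Complex.ofReal_mul, eval_map]
  exact (hom_eval₂ p (RingHom.id ℝ) (algebraMap ℝ ℂ) (a * x)).symm

lemma scaledPoly_sub (a : ℝ) (p q : ℝ[X]) :
    scaledPoly a (p - q) = scaledPoly a p - scaledPoly a q := by
  simp [scaledPoly]

lemma scaledPoly_add (a : ℝ) (p q : ℝ[X]) :
    scaledPoly a (p + q) = scaledPoly a p + scaledPoly a q := by
  simp [scaledPoly]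

lemma scaledPoly_C_mul (a b : ℝ) (p : ℝ[X]) :
    scaledPoly a (C b * p) = C (b : ℂ) * scaledPoly a p := by
  simp [scaledPoly]

lemma scaledPoly_X_mul (a : ℝ) (p : ℝ[X]) :
    scaledPoly a (X * p) = C (a : ℂ) * (X * scaledPoly a p) := by
  simp [scaledPoly, mul_assoc]

lemma derivative_scaledPoly (a : ℝ) (p : ℝ[X]) :
    derivative (scaledPoly a p) = C (a : ℂ) * scaledPoly a (derivative p) := by
  simp [scaledPoly, derivative_comp, derivative_map]

lemma gaussPoly_scaledPoly (a : ℝ) (p : ℝ[X]) (x : ℝ) :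
    gaussPoly (scaledPoly a p) x = (p.eval (a * x) * exp (-π * x ^ 2) : ℝ) := by
  rw [gaussPoly, eval_scaledPoly]
  push_cast
  rfl

/-! ### The samples of the Hermite functions are nearly orthonormal -/

/-- The linear functional `p ↦ π^{-1/2} ∫ p(x) e^{-x²} dx`, written with the variable `√π x`. -/
noncomputable def gaussIntegral (p : ℝ[X]) : ℂ := ∫ x, gaussPoly (scaledPoly (√π) p) x

lemma gaussIntegral_add (p q : ℝ[X]) :
    gaussIntegral (p + q) = gaussIntegral p + gaussIntegral q := by
  rw [gaussIntegral, scaledPoly_add, gaussPoly_add]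
  exact MeasureTheory.integral_add (integrable_gaussPoly _) (integrable_gaussPoly _)

lemma gaussIntegral_C_mul (b : ℝ) (p : ℝ[X]) :
    gaussIntegral (C b * p) = b * gaussIntegral p := by
  rw [gaussIntegral, scaledPoly_C_mul, gaussPoly_C_mul]
  exact MeasureTheory.integral_const_mul _ _

lemma gaussIntegral_one : gaussIntegral 1 = 1 := by
  have h := congrFun isFourierPair_one 0
  rw [fourier_real_eq] at h
  simpa [gaussIntegral, scaledPoly, gaussPoly] using h

/-- Integration by parts: `p' - 2 X p` is, up to the Gaussian weight, a derivative. -/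
lemma gaussIntegral_derivative_sub (p : ℝ[X]) :
    gaussIntegral (derivative p - C 2 * X * p) = 0 := by
  have h1 := MeasureTheory.integral_eq_zero_of_hasDerivAt_of_integrable
    (hasDerivAt_gaussPoly (scaledPoly (√π) p)) (integrable_gaussPoly _) (integrable_gaussPoly _)
  have hs : ((√π : ℝ) : ℂ) * (√π : ℝ) = (π : ℂ) := by
    rw [← Complex.ofReal_mul, mul_self_sqrt pi_pos.le]
  have h2 : derivative (scaledPoly (√π) p) - C (2 * π : ℂ) * X * scaledPoly (√π) p =
      C ((√π : ℝ) : ℂ) * scaledPoly (√π) (derivative p - C 2 * X * p) := by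
    rw [derivative_scaledPoly, scaledPoly_sub, mul_assoc (C 2), scaledPoly_C_mul,
      scaledPoly_X_mul, mul_sub, ← hs]
    simp only [C_mul]
    push_cast
    ring
  rw [h2, gaussPoly_C_mul, MeasureTheory.integral_const_mul] at h1
  refine (mul_eq_zero.1 h1).resolve_left ?_
  have : √π ≠ 0 := (sqrt_pos.2 pi_pos).ne'
  exact_mod_cast this

lemma gaussIntegral_hermitePoly_mul (i j : ℕ) :
    gaussIntegral (hermitePoly i * hermitePoly j) =
      if i = j then (2 : ℂ) ^ i * i.factorial else 0 := by
  induction i generalizing j with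
  | zero =>
    cases j with
    | zero => simp [hermitePoly, gaussIntegral_one]
    | succ j =>
      rw [if_neg (by omega), hermitePoly, one_mul, hermitePoly_succ]
      exact gaussIntegral_derivative_sub _
  | succ i ih =>
    cases j with
    | zero =>
      rw [if_neg (by omega), hermitePoly, mul_one, hermitePoly_succ]
      exact gaussIntegral_derivative_sub _
    | succ j =>
      have h1 := gaussIntegral_derivative_sub (hermitePoly (i + 1) * hermitePoly j)
      have h2 : derivative (hermitePoly (i + 1) * hermitePoly j) -
          C 2 * X * (hermitePoly (i + 1) * hermitePoly j) =
          C (-2 * (i + 1) : ℝ) * (hermitePoly i * hermitePoly j) +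
          hermitePoly (i + 1) * hermitePoly (j + 1) := by
        rw [hermitePoly_succ j, derivative_mul, derivative_hermitePoly_succ]
        ring
      rw [h2, gaussIntegral_add, gaussIntegral_C_mul, ih] at h1
      rw [eq_neg_of_add_eq_zero_right h1]
      by_cases hij : i = j
      · simp only [hij, if_true]
        rw [Nat.factorial_succ, pow_succ]
        push_cast
        ring
      · rw [if_neg hij, if_neg (by omega)]
        simp

lemma sqrt_omega {N : ℕ} : √(omega N) = √π * √(2 / N) := by
  rw [← sqrt_mul pi_pos.le, omega]
  congr 1
  ring

lemma hermiteVec_apply {N : ℕ} (n : ℕ) (k : indexSet N) :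
    hermiteVec N n k = omega N ^ (1 / 4 : ℝ) * (hermiteConst n *
      ((hermitePoly n).eval (√(omega N) * ((k : ℤ) : ℝ)) *
        exp (-(√(omega N) * ((k : ℤ) : ℝ)) ^ 2 / 2))) := by
  rw [hermiteVec]
  simp only
  rw [hermiteFun_eq]

lemma omega_nonneg (N : ℕ) : 0 ≤ omega N := by rw [omega]; positivity

lemma omega_rpow_sq (N : ℕ) : omega N ^ (1 / 4 : ℝ) * omega N ^ (1 / 4 : ℝ) = √(omega N) := by
  rw [← sq, ← rpow_natCast, ← rpow_mul (omega_nonneg N), sqrt_eq_rpow]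
  norm_num

lemma inner_hermiteVec (N i j : ℕ) : ((inner ℝ (hermiteVec N i) (hermiteVec N j) : ℝ) : ℂ) =
    √π * (hermiteConst i * hermiteConst j) * (√(2 / N) * ∑ k ∈ indexSet N,
      gaussPoly (scaledPoly (√π) (hermitePoly i * hermitePoly j)) (√(2 / N) * k)) := by
  have h : ∀ k : indexSet N, hermiteVec N j k * hermiteVec N i k =
      √π * (hermiteConst i * hermiteConst j) * (√(2 / N) *
        ((hermitePoly i * hermitePoly j).eval (√π * (√(2 / N) * (k : ℤ))) *
          exp (-π * (√(2 / N) * (k : ℤ)) ^ 2))) := by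
    intro k
    have h1 : exp (-(√(omega N) * ((k : ℤ) : ℝ)) ^ 2 / 2) *
        exp (-(√(omega N) * ((k : ℤ) : ℝ)) ^ 2 / 2) = exp (-π * (√(2 / N) * (k : ℤ)) ^ 2) := by
      rw [← exp_add, sqrt_omega]
      congr 1
      rw [mul_assoc (√π), mul_pow (√π), sq_sqrt pi_pos.le]
      ring
    rw [hermiteVec_apply, hermiteVec_apply, ← h1, ← mul_assoc (√π) (√(2 / N)), ← sqrt_omega,
      eval_mul]
    calc _ = (omega N ^ (1 / 4 : ℝ) * omega N ^ (1 / 4 : ℝ)) * (hermiteConst i * hermiteConst j) *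
          (eval (√(omega N) * ((k : ℤ) : ℝ)) (hermitePoly i) *
            eval (√(omega N) * ((k : ℤ) : ℝ)) (hermitePoly j) *
          (exp (-(√(omega N) * ((k : ℤ) : ℝ)) ^ 2 / 2) *
            exp (-(√(omega N) * ((k : ℤ) : ℝ)) ^ 2 / 2))) := by ring
      _ = _ := by rw [omega_rpow_sq, sqrt_omega]; ring
  rw [PiLp.inner_apply]
  simp only [RCLike.inner_apply, conj_trivial]
  rw [Finset.sum_congr rfl fun k _ => h k, ← Finset.mul_sum, ← Finset.mul_sum,
    Finset.sum_coe_sort (indexSet N) (fun k : ℤ =>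
      (hermitePoly i * hermitePoly j).eval (√π * (√(2 / N) * k)) *
          exp (-π * (√(2 / N) * k) ^ 2))]
  simp only [gaussPoly_scaledPoly]
  push_cast
  rfl

/-- The samples of the Hermite functions are orthonormal up to `O(1 / N)`. -/
lemma exists_abs_inner_hermiteVec_sub_le (i j : ℕ) :
    ∃ D : ℝ, ∀ N : ℕ, 0 < N →
      |(inner ℝ (hermiteVec N i) (hermiteVec N j) : ℝ) - if i = j then 1 else 0| ≤ D / N := by
  obtain ⟨D, hD⟩ := exists_norm_sum_gaussPoly_sub_integral_le
    (scaledPoly (√π) (hermitePoly i * hermitePoly j)) two_pos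
  refine ⟨|√π * (hermiteConst i * hermiteConst j)| * D, fun N hN => ?_⟩
  have h1 : ((if i = j then 1 else 0 : ℝ) : ℂ) =
      (√π * (hermiteConst i * hermiteConst j) : ℝ) *
        ∫ x, gaussPoly (scaledPoly (√π) (hermitePoly i * hermitePoly j)) x := by
    have h2 := gaussIntegral_hermitePoly_mul i j
    rw [gaussIntegral] at h2
    rw [h2]
    by_cases hij : i = j
    · subst hij
      have h3 := hermiteConst_sq i
      simp only [if_true]
      have h4 : (√π * (hermiteConst i * hermiteConst i)) * (2 ^ i * i.factorial) = 1 := by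
        rw [← h3]; ring
      exact_mod_cast h4.symm
    · simp [hij]
  have h2 := hD N hN
  have h3 : (((inner ℝ (hermiteVec N i) (hermiteVec N j) : ℝ) - if i = j then 1 else 0 : ℝ) : ℂ) =
      (√π * (hermiteConst i * hermiteConst j) : ℝ) * (√(2 / N) * ∑ k ∈ indexSet N,
      gaussPoly (scaledPoly (√π) (hermitePoly i * hermitePoly j)) (√(2 / N) * k) -
        ∫ x, gaussPoly (scaledPoly (√π) (hermitePoly i * hermitePoly j)) x) := by
    rw [mul_sub, ← h1, Complex.ofReal_sub, inner_hermiteVec]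
    push_cast
    ring
  rw [← norm_eq_abs, ← Complex.norm_real, h3, norm_mul, Complex.norm_real, norm_eq_abs,
    mul_div_assoc]
  exact mul_le_mul_of_nonneg_left h2 (abs_nonneg _)

/-! ### The samples of the Hermite functions are nearly eigenvectors -/

/-- The function `H_n(√(2π) x) e^{-π x²}` is multiplied by `(-i)^n` under the Fourier transform. -/
lemma isFourierPair_hermitePoly (n : ℕ) :
    IsFourierPair (scaledPoly (√(2 * π)) (hermitePoly n))
      (C ((-Complex.I) ^ n) * scaledPoly (√(2 * π)) (hermitePoly n)) := by
  induction n with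
  | zero => simpa [hermitePoly, scaledPoly] using isFourierPair_one
  | succ n ih =>
    set K := scaledPoly (√(2 * π)) (hermitePoly n) with hK
    have hs0 : (√(2 * π) : ℂ) ≠ 0 := by
      have : √(2 * π) ≠ 0 := (sqrt_pos.2 (by positivity)).ne'
      exact_mod_cast this
    have hs : (√(2 * π) : ℂ) * √(2 * π) = 2 * π := by
      rw [← Complex.ofReal_mul, mul_self_sqrt (by positivity)]
      push_cast; ring
    have hrec : scaledPoly (√(2 * π)) (hermitePoly (n + 1)) =
        C ((√(2 * π) : ℂ)⁻¹) * (derivative K - C (2 * π : ℂ) * X * K) +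
          C (-(√(2 * π) : ℂ)) * (X * K) := by
      have h1 : derivative K =
          C (√(2 * π) : ℂ) * scaledPoly (√(2 * π)) (derivative (hermitePoly n)) :=
        derivative_scaledPoly _ _
      have h2 : C ((√(2 * π) : ℂ)⁻¹) * C (√(2 * π) : ℂ) = 1 := by
        rw [← C_mul, inv_mul_cancel₀ hs0, C_1]
      rw [hermitePoly_succ, scaledPoly_sub, mul_assoc (C 2), scaledPoly_C_mul, scaledPoly_X_mul,
        h1, ← hs]
      simp only [C_mul, C_neg, ← hK]
      rw [Complex.ofReal_ofNat, show (C (2 : ℂ) : ℂ[X]) = 2 from map_ofNat C 2]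
      linear_combination (-scaledPoly (√(2 * π)) (derivative (hermitePoly n)) +
        C (√(2 * π) : ℂ) * X * K) * h2
    have h3 := (ih.derivative.const_mul ((√(2 * π) : ℂ)⁻¹)).add
      (ih.X_mul.const_mul (-(√(2 * π) : ℂ)))
    rw [← hrec] at h3
    convert h3 using 1
    rw [hrec]
    have e1 : (2 * π * Complex.I : ℂ) = √(2 * π) * √(2 * π) * Complex.I := by rw [hs]
    have e2 : Complex.I / (2 * π) = (√(2 * π) : ℂ)⁻¹ * (√(2 * π) : ℂ)⁻¹ * Complex.I := by
      rw [← hs]; field_simp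
    have h2 : C ((√(2 * π) : ℂ)⁻¹) * C (√(2 * π) : ℂ) = 1 := by
      rw [← C_mul, inv_mul_cancel₀ hs0, C_1]
    rw [e1, e2, pow_succ, derivative_C_mul]
    simp only [C_mul, C_neg]
    linear_combination (-C Complex.I * C ((-Complex.I) ^ n) * C (√(2 * π) : ℂ) * X * K +
      C ((√(2 * π) : ℂ)⁻¹) * C Complex.I * C ((-Complex.I) ^ n) *
        (derivative K - C 2 * C (π : ℂ) * X * K)) * h2

end HermitePoly

section NearEigen

open Polynomial Real FourierTransform

lemma sqrt_omega_eq {N : ℕ} : √(omega N) = √(2 * π) * √(1 / N) := by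
  rw [← sqrt_mul (by positivity), omega]
  congr 1
  ring

lemma hermiteVec_eq_gaussPoly {N : ℕ} (n : ℕ) (k : indexSet N) :
    ((hermiteVec N n k : ℝ) : ℂ) = (omega N ^ (1 / 4 : ℝ) * hermiteConst n : ℝ) *
      gaussPoly (scaledPoly (√(2 * π)) (hermitePoly n)) (√(1 / N) * (k : ℤ)) := by
  rw [hermiteVec_apply, gaussPoly_scaledPoly, ← mul_assoc (√(2 * π)), ← sqrt_omega_eq,
    ← Complex.ofReal_mul]
  congr 1
  have : exp (-(√(omega N) * ((k : ℤ) : ℝ)) ^ 2 / 2) = exp (-π * (√(1 / N) * (k : ℤ)) ^ 2) := by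
    rw [sqrt_omega_eq]
    congr 1
    rw [mul_assoc, mul_pow, sq_sqrt (by positivity)]
    ring
  rw [this]
  ring

/-- Poisson summation for the Hermite functions with step `√(1 / N)`. -/
lemma tsum_hermite_eq {N : ℕ} (hN : 0 < N) (n : ℕ) (l : ℤ) :
    (-Complex.I) ^ n * ∑' m : ℤ,
      gaussPoly (scaledPoly (√(2 * π)) (hermitePoly n)) (√(1 / N) * ((l + m * N : ℤ) : ℝ)) =
    √(1 / N) * ∑' m : ℤ, Complex.exp (-Complex.I * omega N * m * l) *
      gaussPoly (scaledPoly (√(2 * π)) (hermitePoly n)) (√(1 / N) * m) := by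
  have hN' : (0 : ℝ) < N := Nat.cast_pos.2 hN
  set K := scaledPoly (√(2 * π)) (hermitePoly n) with hK
  have hreal : ∀ x, (starRingEnd ℂ) (gaussPoly K x) = gaussPoly K x := fun x => by
    rw [hK, gaussPoly_scaledPoly, Complex.conj_ofReal]
  have h1 := tsum_gaussPoly_eq (isFourierPair_hermitePoly n) (sqrt_pos.2 hN') (l / N)
  rw [← hK, gaussPoly_C_mul] at h1
  have h2 := congrArg (starRingEnd ℂ) h1
  rw [Complex.conj_tsum, Complex.conj_tsum] at h2
  simp only [hreal, map_mul, map_pow, map_neg, Complex.conj_I, neg_neg,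
    ← Complex.exp_conj, map_inv₀, Complex.conj_ofReal] at h2
  have h3 : ∀ m : ℤ, √N * ((l : ℝ) / N + m) = √(1 / N) * ((l + m * N : ℤ) : ℝ) := fun m => by
    have : √(1 / (N : ℝ)) * N = √N := by
      rw [sqrt_div zero_le_one, sqrt_one, one_div, inv_mul_eq_div, div_sqrt]
    rw [← this]
    push_cast
    field_simp
  simp only [h3] at h2
  rw [h2, ← tsum_mul_left, ← tsum_mul_left]
  congr 1
  funext m
  have h4 : (-Complex.I) ^ n * Complex.I ^ n = 1 := by
    rw [← mul_pow, neg_mul, Complex.I_mul_I, neg_neg, one_pow]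
  have h5 : (m : ℝ) / √N = √(1 / N) * m := by
    rw [sqrt_div zero_le_one, sqrt_one, one_div, inv_mul_eq_div]
  have h6 : ((√(N : ℝ) : ℝ) : ℂ)⁻¹ = (√(1 / (N : ℝ)) : ℝ) := by
    rw [sqrt_div zero_le_one, sqrt_one, one_div, Complex.ofReal_inv]
  have h7 : (starRingEnd ℂ) 2 * (π : ℂ) * -Complex.I * (starRingEnd ℂ) (m : ℂ) *
      ((l / N : ℝ) : ℂ) = -Complex.I * omega N * m * l := by
    rw [omega, map_ofNat, map_intCast]
    push_cast
    ring
  rw [h5, h6, h7]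
  linear_combination ((√(1 / (N : ℝ)) : ℝ) * gaussPoly K (√(1 / N) * m) *
    Complex.exp (-Complex.I * omega N * m * l)) * h4

lemma omega_rpow_le {N : ℕ} (hN : 0 < N) : omega N ^ (1 / 4 : ℝ) ≤ (2 * π) ^ (1 / 4 : ℝ) := by
  have hN1 : (1 : ℝ) ≤ N := by exact_mod_cast hN
  refine rpow_le_rpow (omega_nonneg N) ?_ (by norm_num)
  rw [omega]
  exact div_le_self (by positivity) hN1

/-- The samples of the Hermite functions are eigenvectors of the discrete Fourier transform up to
a small error, by Poisson summation. -/
lemma exists_norm_unitaryDft_hermiteVec_sub_le (n : ℕ) :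
    ∃ D : ℝ, 0 ≤ D ∧ ∀ (N : ℕ) [NeZero N] (l : ZMod N),
      ‖unitaryDft N (czfun (hermiteVec N n)) l - (-Complex.I) ^ n * czfun (hermiteVec N n) l‖
        ≤ D / (N : ℝ) ^ 3 := by
  set K := scaledPoly (√(2 * π)) (hermitePoly n) with hK
  obtain ⟨D, hD0, hD⟩ := exists_norm_gaussPoly_tail_le K one_pos
  set Z := ∑' k : ℤ, 1 / (k : ℝ) ^ 2 with hZ
  have hZ0 : 0 ≤ Z := tsum_nonneg fun k => by positivity
  refine ⟨(2 * π) ^ (1 / 4 : ℝ) * |hermiteConst n| * (5 * D * Z), by positivity, fun N _ => ?_⟩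
  have hN : 0 < N := NeZero.pos N
  have hN' : (0 : ℝ) < N := Nat.cast_pos.2 hN
  have hN1 : (1 : ℝ) ≤ N := by exact_mod_cast hN
  rw [← (indexEquiv N).forall_congr_right]
  intro l
  set h := √(1 / (N : ℝ)) with hh
  have hpos : 0 < h := sqrt_pos.2 (by positivity)
  have hle : h ≤ 1 := by
    refine sqrt_le_one.2 ?_
    exact div_le_one_of_le₀ hN1 hN'.le
  set A : ℝ := omega N ^ (1 / 4 : ℝ) * hermiteConst n with hA
  -- `E k` are the terms of the transform and `G m` the periodic translates of the sample at `l`;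
  -- Poisson summation relates the two full sums, and both truncation errors are small.
  set E : ℤ → ℂ := fun k => Complex.exp (-Complex.I * omega N * k * (l : ℤ)) *
    gaussPoly K (h * k) with hE
  have hEnorm : ∀ k, ‖E k‖ = ‖gaussPoly K (h * k)‖ := fun k => by
    have : -Complex.I * omega N * k * (l : ℤ) =
        ((-(omega N * k * (l : ℤ)) : ℝ) : ℂ) * Complex.I := by
      push_cast; ring
    simp only [hE, norm_mul]
    rw [this, Complex.norm_exp_ofReal_mul_I, one_mul]
  have hsum := summable_gaussPoly_comp_mul K hpos
  have hEsum : Summable E := by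
    rw [← summable_norm_iff] at hsum ⊢
    simpa only [hEnorm] using hsum
  have h1 : ‖∑' k, E k - ∑ k ∈ indexSet N, E k‖ ≤ D / (N : ℝ) ^ 3 * Z := by
    rw [hZ, ← tsum_mul_left]
    refine norm_tsum_sub_sum_le hEsum (summable_int_one_div_sq.mul_left _)
      (fun k => by positivity) _ fun k hk => ?_
    rw [hEnorm]
    exact hD N hN k (le_two_mul_abs_of_notMem_indexSet hk)
  set G : ℤ → ℂ := fun m => gaussPoly K (h * (((l : ℤ) + m * N : ℤ) : ℝ)) with hG
  have hGsum : Summable G := by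
    refine hsum.comp_injective (i := fun m : ℤ => (l : ℤ) + m * N) fun m m' hm => ?_
    have hNz : (N : ℤ) ≠ 0 := by exact_mod_cast hN.ne'
    exact mul_right_cancel₀ hNz (add_left_cancel hm)
  have hlmem := (mem_indexSet_iff (N := N) l).1 l.2
  have hlabs : 2 * |((l : ℤ) : ℝ)| ≤ N := by
    have : 2 * |(l : ℤ)| ≤ N := by
      rw [Set.mem_Ioc] at hlmem
      rcases abs_cases (l : ℤ) with h | h <;> omega
    have := (Int.cast_le (R := ℝ)).2 this
    push_cast at this
    exact this
  have h2 : ‖∑' m, G m - ∑ m ∈ ({0} : Finset ℤ), G m‖ ≤ D / (N : ℝ) ^ 3 * 4 * Z := by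
    rw [hZ, ← tsum_mul_left]
    refine norm_tsum_sub_sum_le hGsum (summable_int_one_div_sq.mul_left _)
      (fun k => by positivity) _ fun m hm => ?_
    have hm0 : m ≠ 0 := by simpa using hm
    have hm1 : (1 : ℝ) ≤ |(m : ℝ)| := by
      rw [← Int.cast_abs]
      exact_mod_cast Int.one_le_abs hm0
    have hfar : |(m : ℝ)| * N ≤ 2 * |(((l : ℤ) + m * N : ℤ) : ℝ)| := by
      have h3 : |(m : ℝ) * N| ≤ |(((l : ℤ) + m * N : ℤ) : ℝ)| + |((l : ℤ) : ℝ)| := by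
        have : (m : ℝ) * N = (((l : ℤ) + m * N : ℤ) : ℝ) - ((l : ℤ) : ℝ) := by push_cast; ring
        conv_lhs => rw [this]
        exact abs_sub _ _
      rw [abs_mul, abs_of_pos hN'] at h3
      nlinarith
    refine (hD N hN _ (by nlinarith)).trans ?_
    rw [mul_assoc]
    refine mul_le_mul_of_nonneg_left ?_ (by positivity)
    rw [mul_one_div, div_le_div_iff₀ (by
      rw [← sq_abs]
      have : 0 < |(((l : ℤ) + m * N : ℤ) : ℝ)| := by nlinarith
      positivity) (by rw [← sq_abs]; positivity), one_mul, ← sq_abs (m : ℝ),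
      ← sq_abs (((l : ℤ) + m * N : ℤ) : ℝ)]
    have h4 : |(m : ℝ)| ≤ 2 * |(((l : ℤ) + m * N : ℤ) : ℝ)| := by nlinarith
    calc |(m : ℝ)| ^ 2 ≤ (2 * |(((l : ℤ) + m * N : ℤ) : ℝ)|) ^ 2 := by gcongr
      _ = _ := by ring
  have h3 := tsum_hermite_eq hN n l
  rw [← hK] at h3
  have h4 : unitaryDft N (czfun (hermiteVec N n)) (indexEquiv N l) =
      h * (A * ∑ k ∈ indexSet N, E k) := by
    rw [← dft_eq_unitaryDft, dft]
    congr 1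
    · rw [hh, sqrt_div zero_le_one, sqrt_one]
      push_cast; rfl
    · rw [Finset.mul_sum, ← Finset.sum_coe_sort (indexSet N)]
      refine Finset.sum_congr rfl fun k _ => ?_
      rw [hermiteVec_eq_gaussPoly]
      simp only [hE, hA, hh, hK]
      ring
  have h5 : czfun (hermiteVec N n) (indexEquiv N l) = A * G 0 := by
    rw [czfun, zfun_apply_index, hermiteVec_eq_gaussPoly]
    simp [hG, hA, hh, hK]
  have h6 : unitaryDft N (czfun (hermiteVec N n)) (indexEquiv N l) -
      (-Complex.I) ^ n * czfun (hermiteVec N n) (indexEquiv N l) =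
      A * ((-Complex.I) ^ n * (∑' m, G m - ∑ m ∈ ({0} : Finset ℤ), G m) -
        h * (∑' k, E k - ∑ k ∈ indexSet N, E k)) := by
    rw [h4, h5, Finset.sum_singleton]
    linear_combination (-(A : ℂ)) * h3
  rw [h6, norm_mul, Complex.norm_real, norm_eq_abs, hA, abs_mul,
    abs_of_nonneg (rpow_nonneg (omega_nonneg N) _), mul_div_assoc]
  have h7 : ‖(-Complex.I) ^ n * (∑' m, G m - ∑ m ∈ ({0} : Finset ℤ), G m) -
        h * (∑' k, E k - ∑ k ∈ indexSet N, E k)‖ ≤ 5 * D * Z / (N : ℝ) ^ 3 := by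
    refine (norm_sub_le _ _).trans ?_
    rw [norm_mul, norm_mul, norm_pow, norm_neg, Complex.norm_I, one_pow, one_mul,
      Complex.norm_real, norm_eq_abs, abs_of_pos hpos]
    have : h * ‖∑' k, E k - ∑ k ∈ indexSet N, E k‖ ≤ 1 * (D / (N : ℝ) ^ 3 * Z) := by gcongr
    calc _ ≤ D / (N : ℝ) ^ 3 * 4 * Z + 1 * (D / (N : ℝ) ^ 3 * Z) := add_le_add h2 this
      _ = _ := by ring
  exact mul_le_mul (mul_le_mul_of_nonneg_right (omega_rpow_le hN) (abs_nonneg _)) h7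
    (norm_nonneg _) (by positivity)

end NearEigen

section Window

open Real

/-! ### Asymptotics of the window -/

/-- A product of factors `1 - t` close to `1` compared with the exponential of the sum. -/
lemma prod_one_sub_bounds {ι : Type*} (s : Finset ι) (t : ι → ℝ) (h0 : ∀ i ∈ s, 0 ≤ t i)
    (h1 : ∀ i ∈ s, t i ≤ 1) :
    0 ≤ ∏ i ∈ s, (1 - t i) ∧ ∏ i ∈ s, (1 - t i) ≤ exp (-∑ i ∈ s, t i) ∧
    exp (-∑ i ∈ s, t i) - ∏ i ∈ s, (1 - t i) ≤ 3 * (∑ i ∈ s, t i ^ 2) * exp (-∑ i ∈ s, t i) := by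
  classical
  induction s using Finset.induction_on with
  | empty => simp
  | insert i s hi ih =>
    obtain ⟨hp, hle, hd⟩ := ih (fun j hj => h0 j (Finset.mem_insert_of_mem hj))
      (fun j hj => h1 j (Finset.mem_insert_of_mem hj))
    have hi0 := h0 i (Finset.mem_insert_self i s)
    have hi1 := h1 i (Finset.mem_insert_self i s)
    rw [Finset.prod_insert hi, Finset.sum_insert hi, Finset.sum_insert hi, neg_add, exp_add]
    set P := ∏ j ∈ s, (1 - t j)
    set E := exp (-∑ j ∈ s, t j)
    set Q := ∑ j ∈ s, t j ^ 2
    set e := exp (-t i) with he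
    have he1 : 1 - t i ≤ e := one_sub_le_exp_neg (t i)
    have he0 : 0 < e := exp_pos _
    have he2 : e - (1 - t i) ≤ t i ^ 2 := by
      have := abs_exp_sub_one_sub_id_le (x := -t i) (by rw [abs_neg, abs_of_nonneg hi0]; exact hi1)
      rw [neg_sq] at this
      have := (abs_le.1 this).2
      linarith
    have he3 : 1 ≤ 3 * e := by
      have h2 : exp 1 < 3 := by linarith [exp_one_lt_d9]
      have h3 : exp (-1) ≤ e := exp_le_exp.2 (by linarith)
      have h4 : exp 1 * exp (-1) = 1 := by rw [← exp_add]; simp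
      nlinarith [exp_pos (-1)]
    refine ⟨mul_nonneg (by linarith) hp, mul_le_mul he1 hle hp he0.le, ?_⟩
    have hE0 : 0 ≤ E := (exp_pos _).le
    calc e * E - (1 - t i) * P = (e - (1 - t i)) * P + e * (E - P) := by ring
      _ ≤ t i ^ 2 * E + e * (3 * Q * E) := by
          refine add_le_add ?_ (mul_le_mul_of_nonneg_left hd he0.le)
          exact mul_le_mul he2 hle hp (sq_nonneg _)
      _ ≤ t i ^ 2 * E * (3 * e) + e * (3 * Q * E) := by
          have : 0 ≤ t i ^ 2 * E := by positivity
          nlinarith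
      _ = _ := by ring

lemma half_le_sin {x : ℝ} (h1 : π / 6 ≤ x) (h2 : x ≤ π / 2) : 1 / 2 ≤ sin x := by
  rw [← sin_pi_div_six]
  exact sin_le_sin_of_le_of_le_pi_div_two (by linarith [pi_pos]) h2 h1

variable {N : ℕ} [NeZero N]

lemma half_le_sin_omega {i : ℕ} (h1 : N ≤ 6 * i) (h2 : i ≤ N / 2) :
    1 / 2 ≤ sin (omega N * i / 2) := by
  refine half_le_sin ?_ (omega_half_mul_le h2)
  have hN : (0 : ℝ) < N := Nat.cast_pos.2 (NeZero.pos N)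
  have h : (N : ℝ) ≤ 6 * i := by exact_mod_cast h1
  rw [omega, div_mul_eq_mul_div, div_div, div_le_div_iff₀ (by positivity) (by positivity)]
  nlinarith [pi_pos]

lemma one_div_sin_sq_le {i : ℕ} (h1 : N ≤ 6 * i) (h2 : i ≤ N / 2) :
    1 / sin (omega N * i / 2) ^ 2 ≤ 4 := by
  have hs := half_le_sin_omega (N := N) h1 h2
  rw [div_le_iff₀ (by positivity)]
  nlinarith

/-- The sum of `1 / sin²` is compared with a telescoping sum of cotangents. -/
lemma abs_sin_mul_sum_sub_cot_le {m U : ℕ} (hm : N ≤ 6 * m) (hmU : m ≤ U) (hU : U ≤ N / 2) :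
    |sin (omega N / 2) * ∑ i ∈ Finset.Ioc m U, 1 / sin (omega N * i / 2) ^ 2 -
      (cos (omega N * m / 2) / sin (omega N * m / 2) -
        cos (omega N * U / 2) / sin (omega N * U / 2))| ≤ (U - m) * (2 * omega N ^ 2) := by
  induction U, hmU using Nat.le_induction with
  | base => simp
  | succ U hmU ih =>
    have ih := ih (by omega)
    have hs1 := half_le_sin_omega (N := N) (i := U) (by omega) (by omega)
    have hs2 := half_le_sin_omega (N := N) (i := U + 1) (by omega) hU
    have hω := omega_pos (N := N)
    rw [Finset.sum_Ioc_succ_top (by omega), mul_add]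
    have hkey : |sin (omega N / 2) * (1 / sin (omega N * (U + 1 : ℕ) / 2) ^ 2) -
        (cos (omega N * U / 2) / sin (omega N * U / 2) -
          cos (omega N * (U + 1 : ℕ) / 2) / sin (omega N * (U + 1 : ℕ) / 2))| ≤
        2 * omega N ^ 2 := by
      set a := omega N * U / 2 with ha
      set b := omega N * (U + 1 : ℕ) / 2 with hb
      have hba : b - a = omega N / 2 := by rw [ha, hb]; push_cast; ring
      have ha0 : 0 < sin a := by linarith
      have hb0 : 0 < sin b := by linarith
      have h1 : cos a / sin a - cos b / sin b = sin (omega N / 2) / (sin a * sin b) := by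
        rw [← hba, sin_sub]
        field_simp
      have h2 : sin (omega N / 2) * (1 / sin b ^ 2) - sin (omega N / 2) / (sin a * sin b) =
          sin (omega N / 2) * (sin a - sin b) / (sin a * sin b ^ 2) := by
        field_simp
      rw [h1, h2, abs_div, abs_mul, abs_of_pos (by positivity : 0 < sin a * sin b ^ 2),
        div_le_iff₀ (by positivity)]
      have h3 : |sin (omega N / 2)| ≤ omega N / 2 :=
        abs_sin_le_abs.trans (le_of_eq (abs_of_pos (by positivity)))
      have h4 : |sin a - sin b| ≤ omega N / 2 := by
        refine (abs_sin_sub_sin_le a b).trans (le_of_eq ?_)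
        rw [abs_sub_comm, hba, abs_of_pos (by positivity)]
      have h5 : 1 / 8 ≤ sin a * sin b ^ 2 := by
        calc (1 / 8 : ℝ) = 1 / 2 * (1 / 2) ^ 2 := by norm_num
          _ ≤ _ := by gcongr
      calc |sin (omega N / 2)| * |sin a - sin b| ≤ omega N / 2 * (omega N / 2) := by gcongr
        _ = 2 * omega N ^ 2 * (1 / 8) := by ring
        _ ≤ _ := by gcongr
    have := abs_add_le (sin (omega N / 2) * ∑ i ∈ Finset.Ioc m U, 1 / sin (omega N * i / 2) ^ 2 -
      (cos (omega N * m / 2) / sin (omega N * m / 2) -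
        cos (omega N * U / 2) / sin (omega N * U / 2)))
      (sin (omega N / 2) * (1 / sin (omega N * (U + 1 : ℕ) / 2) ^ 2) -
        (cos (omega N * U / 2) / sin (omega N * U / 2) -
          cos (omega N * (U + 1 : ℕ) / 2) / sin (omega N * (U + 1 : ℕ) / 2)))
    refine le_trans (le_of_eq ?_) (this.trans ((add_le_add ih hkey).trans (le_of_eq ?_)))
    · congr 1; ring
    · push_cast; ring

lemma omega_mul_natCast : omega N * N = 2 * π := by
  have hN : (N : ℝ) ≠ 0 := NeZero.ne _
  rw [omega, div_mul_cancel₀ _ hN]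

lemma abs_cot_omega_sub_one_le {n m : ℕ} (hm : m = (N + n + 2) / 4) (hN : 3 * n + 12 ≤ N) :
    |cos (omega N * m / 2) / sin (omega N * m / 2) - 1| ≤ (n + 2) * omega N := by
  have hω := omega_pos (N := N)
  have hωN := omega_mul_natCast (N := N)
  have hs := half_le_sin_omega (N := N) (i := m) (by omega) (by omega)
  set A := omega N * m / 2 with hA
  have hApi : |A - π / 4| ≤ (n + 2) * omega N / 8 := by
    have h4 : A - π / 4 = omega N / 8 * (4 * m - N) := by
      rw [hA]
      linear_combination (1 / 8 : ℝ) * hωN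
    rw [h4, abs_mul, abs_of_pos (by positivity)]
    have h5 : |(4 * m - N : ℝ)| ≤ n + 2 := by
      have h6 : (4 * m : ℝ) ≤ N + n + 2 := by exact_mod_cast (by omega : 4 * m ≤ N + n + 2)
      have h7 : (N : ℝ) + n ≤ 4 * m + 1 := by exact_mod_cast (by omega : N + n ≤ 4 * m + 1)
      have : (0 : ℝ) ≤ n := Nat.cast_nonneg n
      rw [abs_le]
      constructor <;> linarith
    calc omega N / 8 * |(4 * m - N : ℝ)| ≤ omega N / 8 * (n + 2) := by gcongr
      _ = _ := by ring
  have h8 := (abs_cos_sub_cos_le A (π / 4)).trans hApi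
  have h9 := (abs_sin_sub_sin_le A (π / 4)).trans hApi
  rw [cos_pi_div_four] at h8
  rw [sin_pi_div_four] at h9
  have h10 : cos A / sin A - 1 = (cos A - sin A) / sin A := by field_simp
  rw [h10, abs_div, abs_of_pos (by linarith : 0 < sin A), div_le_iff₀ (by linarith)]
  have h11 : |cos A - sin A| ≤ (n + 2) * omega N / 4 := by
    rw [abs_le] at h8 h9 ⊢
    constructor <;> linarith [h8.1, h8.2, h9.1, h9.2]
  have h12 : 0 ≤ ((n : ℝ) + 2) * omega N := by positivity
  nlinarith

lemma abs_cot_omega_le {U : ℕ} (h6 : N ≤ 6 * U) (hUle : U ≤ N / 2) (hU2 : N ≤ 2 * U + 2) :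
    |cos (omega N * U / 2) / sin (omega N * U / 2)| ≤ omega N := by
  have hω := omega_pos (N := N)
  have hωN := omega_mul_natCast (N := N)
  have hs := half_le_sin_omega (N := N) (i := U) (by omega) (by omega)
  set B := omega N * U / 2 with hB
  have h4 := abs_cos_sub_cos_le B (π / 2)
  rw [cos_pi_div_two, sub_zero] at h4
  have h5 : |B - π / 2| ≤ omega N / 2 := by
    have h6 : B - π / 2 = -(omega N / 4 * (N - 2 * U)) := by
      rw [hB]
      linear_combination (1 / 4 : ℝ) * hωN
    have h7 : (2 * U : ℝ) ≤ N := by exact_mod_cast (by omega : 2 * U ≤ N)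
    have h8 : (N : ℝ) ≤ 2 * U + 2 := by exact_mod_cast hU2
    rw [h6, abs_neg, abs_of_nonneg (by apply mul_nonneg <;> linarith)]
    nlinarith
  rw [abs_div, abs_of_pos (by linarith : 0 < sin B), div_le_iff₀ (by linarith)]
  nlinarith

/-- The coefficient governing the Gaussian shape of the window tends to `1 / 2` at rate `1 / N`. -/
lemma abs_omega_mul_sum_sub_half_le {n p m : ℕ} (hm : m = (N + n + 2) / 4)
    (hN : 3 * n + 12 ≤ N) :
    |omega N / 4 * ∑ i ∈ Finset.Ioc m (topIndex N p), 1 / sin (omega N * i / 2) ^ 2 - 1 / 2| ≤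
      (n + 20) * omega N := by
  set U := topIndex N p with hU
  have hUle := topIndex_le N p
  have hU2 : N ≤ 2 * U + 2 := by rw [hU, topIndex]; omega
  have hω := omega_pos (N := N)
  have hωN := omega_mul_natCast (N := N)
  have hN' : (0 : ℝ) < N := Nat.cast_pos.2 (NeZero.pos N)
  have h1 := abs_sin_mul_sum_sub_cot_le (N := N) (m := m) (U := U) (by omega) (by omega) hUle
  set σ := ∑ i ∈ Finset.Ioc m U, 1 / sin (omega N * i / 2) ^ 2 with hσ
  have hσ0 : 0 ≤ σ := Finset.sum_nonneg fun i _ => by positivity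
  have hσle : σ ≤ 4 * N := by
    have : ∀ i ∈ Finset.Ioc m U, 1 / sin (omega N * i / 2) ^ 2 ≤ 4 := fun i hi => by
      rw [Finset.mem_Ioc] at hi
      exact one_div_sin_sq_le (by omega) (by omega)
    have h2 := Finset.sum_le_card_nsmul _ _ _ this
    rw [Nat.card_Ioc, nsmul_eq_mul] at h2
    have h3 : ((U - m : ℕ) : ℝ) ≤ N := by exact_mod_cast (by omega : U - m ≤ N)
    linarith
  set S := sin (omega N / 2) with hS
  have hSle : |omega N / 2 - S| ≤ (omega N / 2) ^ 3 / 6 := by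
    have := abs_sub_sin_le (omega N / 2)
    rwa [abs_of_pos (by positivity : 0 < omega N / 2)] at this
  have hω1 : omega N ≤ 1 := by
    have h12 : (12 : ℝ) ≤ N := by exact_mod_cast (by omega : 12 ≤ N)
    nlinarith [pi_lt_four, pi_pos]
  -- The telescoping sum is `S σ` up to `O(ω)`; replacing `S` by `ω / 2` costs `e1`, and the two
  -- cotangents are close to `cot (π / 4) = 1` and `cot (π / 2) = 0`.
  have e1 : |(omega N / 2 - S) * σ| ≤ omega N := by
    rw [abs_mul, abs_of_nonneg hσ0]
    calc |omega N / 2 - S| * σ ≤ (omega N / 2) ^ 3 / 6 * (4 * N) :=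
          mul_le_mul hSle hσle hσ0 (by positivity)
      _ = omega N ^ 2 * (omega N * N) / 12 := by ring
      _ = omega N * (omega N * (2 * π)) / 12 := by rw [hωN]; ring
      _ ≤ omega N := by
          have h2 : omega N * (2 * π) ≤ 1 * 8 :=
            mul_le_mul hω1 (by linarith [pi_lt_four]) (by positivity) zero_le_one
          have h3 : omega N * (omega N * (2 * π)) ≤ omega N * (1 * 8) :=
            mul_le_mul_of_nonneg_left h2 hω.le
          linarith
  have e2 : ((U : ℝ) - m) * (2 * omega N ^ 2) ≤ 2 * (2 * π) * omega N := by
    have h3 : (U : ℝ) - m ≤ N := by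
      have : (U : ℝ) ≤ N := by exact_mod_cast (by omega : U ≤ N)
      have : (0 : ℝ) ≤ m := Nat.cast_nonneg m
      linarith
    calc ((U : ℝ) - m) * (2 * omega N ^ 2) ≤ N * (2 * omega N ^ 2) :=
          mul_le_mul_of_nonneg_right h3 (by positivity)
      _ = 2 * (omega N * N) * omega N := by ring
      _ = _ := by rw [hωN]
  have e3 := abs_cot_omega_sub_one_le (N := N) hm hN
  have e4 := abs_cot_omega_le (N := N) (U := U) (by omega) hUle hU2
  set x := cos (omega N * m / 2) / sin (omega N * m / 2)
  set y := cos (omega N * U / 2) / sin (omega N * U / 2)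
  clear_value σ S x y
  have hπ : 2 * (2 * π) * omega N ≤ 16 * omega N := by
    have := pi_lt_four
    gcongr
    linarith
  have h2 := abs_le.1 (h1.trans (e2.trans hπ))
  have e1 := abs_le.1 e1
  have e3 := abs_le.1 e3
  have e4 := abs_le.1 e4
  have hn : 0 ≤ (n : ℝ) * omega N := by positivity
  rw [abs_le]
  constructor <;> linarith [h2.1, h2.2, e1.1, e1.2, e3.1, e3.2, e4.1, e4.2]

end Window

section Approximation

open Real

/-! ### Approximation of the Hermite functions by doubly concentrated vectors -/

lemma abs_exp_neg_sub_exp_neg_le {α β γ : ℝ} (hα : γ ≤ α) (hβ : γ ≤ β) :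
    |exp (-α) - exp (-β)| ≤ |α - β| * exp (-γ) := by
  wlog h : α ≤ β generalizing α β
  · rw [abs_sub_comm, abs_sub_comm α]
    exact this hβ hα (not_le.1 h).le
  have h1 : exp (-β) = exp (-α) * exp (-(β - α)) := by rw [← exp_add]; ring_nf
  have h2 := one_sub_le_exp_neg (β - α)
  have h3 : exp (-α) ≤ exp (-γ) := exp_le_exp.2 (by linarith)
  have h4 : 0 < exp (-α) := exp_pos _
  have h5 : exp (-β) ≤ exp (-α) := exp_le_exp.2 (by linarith)
  rw [abs_of_nonneg (by linarith), abs_sub_comm, abs_of_nonneg (by linarith)]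
  calc exp (-α) - exp (-β) = exp (-α) * (1 - exp (-(β - α))) := by rw [h1]; ring
    _ ≤ exp (-α) * (β - α) := mul_le_mul_of_nonneg_left (by linarith) h4.le
    _ ≤ exp (-γ) * (β - α) := mul_le_mul_of_nonneg_right h3 (by linarith)
    _ = _ := mul_comm _ _

/-- Comparison of the window with the Gaussian `exp (-X / 2)`, in terms of `y`, which is
`X = x ^ 2` with the sine in the place of the angle. -/
lemma abs_window_sub_exp_le {ω a c y X G Q : ℝ} (hω : 0 ≤ ω) (hc : 0 ≤ c) (ha : 1 / 4 ≤ a)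
    (hac : |a - 1 / 2| ≤ c * ω) (hy : 0 ≤ y) (hyX : y ≤ X) (hXy : X ≤ 3 * y)
    (hd : X - y ≤ ω * X ^ 2) (hG : G ≤ exp (-(a * y)))
    (hGd : exp (-(a * y)) - G ≤ 3 * Q * exp (-(a * y))) (hQ : Q ≤ 7 * ω * y ^ 2) :
    G ≤ exp (-(X / 12)) ∧
      |G - exp (-(X / 2))| ≤ ω * ((c + 22) * (1 + X ^ 2)) * exp (-(X / 12)) := by
  have hay : X / 12 ≤ a * y := by nlinarith
  have hE : exp (-(a * y)) ≤ exp (-(X / 12)) := exp_le_exp.2 (by linarith)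
  set E := exp (-(X / 12)) with hEdef
  have hE0 : 0 < E := exp_pos _
  have hX0 : 0 ≤ X := hy.trans hyX
  refine ⟨hG.trans hE, ?_⟩
  have h1 : |G - exp (-(a * y))| ≤ ω * (21 * X ^ 2) * E := by
    rw [abs_sub_comm, abs_of_nonneg (by linarith)]
    calc _ ≤ 3 * Q * exp (-(a * y)) := hGd
      _ ≤ 3 * (7 * ω * y ^ 2) * exp (-(a * y)) := by gcongr
      _ ≤ 3 * (7 * ω * X ^ 2) * E := by gcongr
      _ = _ := by ring
  have h2 : |exp (-(a * y)) - exp (-(y / 2))| ≤ ω * (c * X) * E := by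
    refine (abs_exp_neg_sub_exp_neg_le (γ := X / 12) hay (by linarith)).trans ?_
    have : a * y - y / 2 = (a - 1 / 2) * y := by ring
    rw [this, abs_mul, abs_of_nonneg hy]
    calc |a - 1 / 2| * y * E ≤ c * ω * X * E := by gcongr
      _ = _ := by ring
  have h3 : |exp (-(y / 2)) - exp (-(X / 2))| ≤ ω * X ^ 2 * E := by
    refine (abs_exp_neg_sub_exp_neg_le (γ := X / 12) (by linarith) (by linarith)).trans ?_
    gcongr
    rw [abs_sub_comm, abs_of_nonneg (by linarith)]
    linarith
  have h4 : |G - exp (-(X / 2))| ≤ |G - exp (-(a * y))| + |exp (-(a * y)) - exp (-(y / 2))| +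
      |exp (-(y / 2)) - exp (-(X / 2))| := by
    refine (abs_sub_le _ (exp (-(y / 2))) _).trans ?_
    gcongr
    exact abs_sub_le _ _ _
  have h5 : X ≤ 1 + X ^ 2 := by nlinarith [sq_nonneg (X - 1)]
  calc _ ≤ ω * (21 * X ^ 2) * E + ω * (c * X) * E + ω * X ^ 2 * E := by linarith
    _ = ω * (c * X + 22 * X ^ 2) * E := by ring
    _ ≤ ω * ((c + 22) * (1 + X ^ 2)) * E := by
      have : c * X ≤ c * (1 + X ^ 2) := by gcongr
      gcongr
      nlinarith

lemma pow_sub_pow_le {ω y X : ℝ} (hy : 0 ≤ y) (hyX : y ≤ X) (hd : X - y ≤ ω * X ^ 2)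
    (q : ℕ) : X ^ q - y ^ q ≤ q * ω * X ^ (q + 1) := by
  have hX := hy.trans hyX
  induction q with
  | zero => simp
  | succ q ih =>
    calc X ^ (q + 1) - y ^ (q + 1) = X * (X ^ q - y ^ q) + y ^ q * (X - y) := by ring
      _ ≤ X * (q * ω * X ^ (q + 1)) + X ^ q * (ω * X ^ 2) := by
        gcongr
      _ = _ := by push_cast; ring

/-- The product of the window with approximate monomials approximates the monomial times the
Gaussian. -/
lemma abs_window_mul_sub_le {ω C ς x y G H E : ℝ} (hω : 0 ≤ ω) (hς : |ς - x| ≤ ω * |x| ^ 3)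
    (hy : 0 ≤ y) (hyX : y ≤ x ^ 2) (hd : x ^ 2 - y ≤ ω * (x ^ 2) ^ 2)
    (hG0 : 0 ≤ G) (hGE : G ≤ E) (hH0 : 0 ≤ H) (hHE : H ≤ E)
    (hGH : |G - H| ≤ ω * (C * (1 + (x ^ 2) ^ 2)) * E) (p : ℕ) :
    |ς ^ (p % 2) * (y ^ (p / 2) * G) - x ^ p * H| ≤
      ω * (C * (|x| ^ p + |x| ^ (p + 4)) + (p + 1) * |x| ^ (p + 2)) * E := by
  set q := p / 2 with hq
  have hE0 : 0 ≤ E := hG0.trans hGE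
  have hbase : |y ^ q * G - (x ^ 2) ^ q * H| ≤
      ω * (C * (|x| ^ (2 * q) + |x| ^ (2 * q + 4)) + q * |x| ^ (2 * q + 2)) * E := by
    have h1 := pow_sub_pow_le hy hyX hd q
    have h2 : y ^ q ≤ (x ^ 2) ^ q := pow_le_pow_left₀ hy hyX q
    have h3 : y ^ q * G - (x ^ 2) ^ q * H = y ^ q * (G - H) - ((x ^ 2) ^ q - y ^ q) * H := by ring
    rw [h3]
    refine (abs_sub _ _).trans ?_
    rw [abs_mul, abs_mul, abs_of_nonneg (pow_nonneg hy q), abs_of_nonneg (sub_nonneg.2 h2),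
      abs_of_nonneg hH0]
    have hGH0 : 0 ≤ ω * (C * (1 + (x ^ 2) ^ 2)) * E := (abs_nonneg _).trans hGH
    calc _ ≤ (x ^ 2) ^ q * (ω * (C * (1 + (x ^ 2) ^ 2)) * E) +
          q * ω * (x ^ 2) ^ (q + 1) * E := by gcongr
      _ = _ := by rw [← sq_abs x]; ring
  rcases Nat.mod_two_eq_zero_or_one p with h | h
  · have hp : p = 2 * q := by omega
    rw [h, pow_zero, one_mul, show x ^ p = (x ^ 2) ^ q by rw [hp, pow_mul]]
    refine hbase.trans ?_
    rw [← hp]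
    have : (q : ℝ) ≤ p + 1 := by exact_mod_cast (by omega : q ≤ p + 1)
    gcongr
  · have hp : p = 2 * q + 1 := by omega
    rw [h, pow_one, show x ^ p = x * (x ^ 2) ^ q by rw [hp, pow_succ', pow_mul]]
    have h2 : y ^ q ≤ (x ^ 2) ^ q := pow_le_pow_left₀ hy hyX q
    have h3 : ς * (y ^ q * G) - x * (x ^ 2) ^ q * H =
        (ς - x) * (y ^ q * G) + x * (y ^ q * G - (x ^ 2) ^ q * H) := by ring
    rw [h3]
    refine (abs_add_le _ _).trans ?_
    rw [abs_mul (ς - x), abs_mul x, abs_of_nonneg (mul_nonneg (pow_nonneg hy q) hG0)]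
    have hq' : (q : ℝ) + 1 ≤ p + 1 := by exact_mod_cast (by omega : q + 1 ≤ p + 1)
    calc _ ≤ ω * |x| ^ 3 * ((x ^ 2) ^ q * E) + |x| *
          (ω * (C * (|x| ^ (2 * q) + |x| ^ (2 * q + 4)) + q * |x| ^ (2 * q + 2)) * E) := by gcongr
      _ = ω * (C * (|x| ^ p + |x| ^ (p + 4)) + (q + 1) * |x| ^ (p + 2)) * E := by
        rw [hp, ← sq_abs x]; ring
      _ ≤ _ := by gcongr

variable {N : ℕ} [NeZero N]

/-- The approximate square `4 sin² (ω j / 2) / ω` of `√ω j`. -/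
lemma four_mul_halfSinSq_div_bounds (j : ZMod N) :
    0 ≤ 4 * halfSinSq N j / omega N ∧
    4 * halfSinSq N j / omega N ≤ (√(omega N) * j.valMinAbs) ^ 2 ∧
    (√(omega N) * j.valMinAbs) ^ 2 ≤ 3 * (4 * halfSinSq N j / omega N) ∧
    (√(omega N) * j.valMinAbs) ^ 2 - 4 * halfSinSq N j / omega N ≤
      omega N * ((√(omega N) * j.valMinAbs) ^ 2) ^ 2 := by
  have hω := omega_pos (N := N)
  set u := omega N * j.valMinAbs.natAbs / 2 with hu
  have hu0 : 0 ≤ u := by positivity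
  have hu2 : u ≤ π / 2 := omega_half_mul_le j.natAbs_valMinAbs_le
  have hX : (√(omega N) * j.valMinAbs) ^ 2 = 4 * u ^ 2 / omega N := by
    rw [mul_pow, sq_sqrt hω.le, hu, Nat.cast_natAbs, Int.cast_abs, div_pow, mul_pow, sq_abs]
    field_simp
    norm_num
  have hs0 : 0 ≤ sin u := sin_nonneg_of_nonneg_of_le_pi hu0 (by linarith [pi_pos])
  have hs1 : sin u ≤ u := sin_le hu0
  have hs2 : 2 / π * u ≤ sin u := mul_le_sin hu0 hu2
  have hs3 : u - sin u ≤ u ^ 3 / 6 := by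
    have := (abs_le.1 (abs_sub_sin_le u)).2
    rwa [abs_of_nonneg hu0] at this
  rw [halfSinSq_eq, ← hu, hX]
  refine ⟨by positivity, by gcongr, ?_, ?_⟩
  · rw [← mul_div_assoc]
    refine div_le_div_of_nonneg_right ?_ hω.le
    have h1 : (2 / π * u) ^ 2 ≤ sin u ^ 2 := by gcongr
    have h2 : u ^ 2 ≤ 3 * (2 / π * u) ^ 2 := by
      have h3 : π ^ 2 ≤ 12 := by nlinarith [pi_lt_d2, pi_pos]
      have h4 : 3 * (2 / π * u) ^ 2 = 12 / π ^ 2 * u ^ 2 := by ring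
      rw [h4]
      have : 1 ≤ 12 / π ^ 2 := by rw [le_div_iff₀ (by positivity)]; linarith
      nlinarith [sq_nonneg u]
    linarith
  · have h1 : u ^ 2 - sin u ^ 2 ≤ u ^ 4 := by
      calc u ^ 2 - sin u ^ 2 = (u - sin u) * (u + sin u) := by ring
        _ ≤ u ^ 3 / 6 * (u + u) := by gcongr
        _ = u ^ 4 / 3 := by ring
        _ ≤ u ^ 4 := by linarith [pow_nonneg hu0 4]
    calc 4 * u ^ 2 / omega N - 4 * sin u ^ 2 / omega N
      _ = 4 * (u ^ 2 - sin u ^ 2) / omega N := by ring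
      _ ≤ 4 * u ^ 4 / omega N := by gcongr
      _ ≤ 16 * u ^ 4 / omega N := by gcongr; norm_num
      _ = _ := by field_simp; ring

lemma abs_sinFun_div_sub_le (j : ZMod N) :
    |sinFun N j / √(omega N) - √(omega N) * j.valMinAbs| ≤
      omega N * |√(omega N) * j.valMinAbs| ^ 3 := by
  have hω := omega_pos (N := N)
  have hs := sqrt_pos.2 hω
  have hsq : √(omega N) * √(omega N) = omega N := mul_self_sqrt hω.le
  have h1 := abs_sub_sin_le (omega N * j.valMinAbs)
  set k : ℝ := (j.valMinAbs : ℝ)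
  have h2 : sinFun N j / √(omega N) - √(omega N) * k =
      -(omega N * k - sin (omega N * k)) / √(omega N) := by
    rw [sinFun, eq_div_iff hs.ne', sub_mul, div_mul_cancel₀ _ hs.ne']
    linear_combination (-k) * hsq
  rw [h2, abs_div, abs_neg, abs_of_pos hs, div_le_iff₀ hs]
  refine h1.trans ?_
  rw [abs_mul, abs_mul, abs_of_pos hω, abs_of_pos hs]
  have h3 : omega N * (√(omega N) * |k|) ^ 3 * √(omega N) = (omega N * |k|) ^ 3 := by
    calc _ = omega N * (√(omega N) * √(omega N)) * (√(omega N) * √(omega N)) * |k| ^ 3 := by ring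
      _ = _ := by rw [hsq]; ring
  rw [h3]
  have : 0 ≤ (omega N * |k|) ^ 3 := by positivity
  linarith

/-- The window compared with the Gaussian at the points `|j| ≤ m`. -/
lemma windowProd_bounds {n p m : ℕ} (hm : m = (N + n + 2) / 4) (hN : 26 * (n + 20) ≤ N)
    {j : ZMod N} (hj : j.valMinAbs.natAbs ≤ m) :
    windowProd N m p j ≤ exp (-((√(omega N) * j.valMinAbs) ^ 2 / 12)) ∧
    |windowProd N m p j - exp (-((√(omega N) * j.valMinAbs) ^ 2 / 2))| ≤
      omega N * (((n + 20 : ℝ) + 22) * (1 + ((√(omega N) * j.valMinAbs) ^ 2) ^ 2)) *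
        exp (-((√(omega N) * j.valMinAbs) ^ 2 / 12)) := by
  have hω := omega_pos (N := N)
  have hωN := omega_mul_natCast (N := N)
  obtain ⟨hy0, hyX, hXy, hd⟩ := four_mul_halfSinSq_div_bounds j
  have hhs0 := halfSinSq_nonneg j
  set y := 4 * halfSinSq N j / omega N with hy
  have hhs : halfSinSq N j = omega N * y / 4 := by rw [hy]; field_simp
  set U := topIndex N p with hU
  have hUle := topIndex_le N p
  have hσ := abs_omega_mul_sum_sub_half_le (N := N) (n := n) (p := p) hm (by omega)
  rw [← hU] at hσ
  set σ := ∑ i ∈ Finset.Ioc m U, 1 / sin (omega N * i / 2) ^ 2 with hσdef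
  have hsmall : (n + 20) * omega N ≤ 1 / 4 := by
    have h26 : 26 * ((n : ℝ) + 20) ≤ N := by exact_mod_cast hN
    have h1 : 26 * ((n : ℝ) + 20) * omega N ≤ 2 * π := by
      rw [← hωN, mul_comm (omega N)]
      gcongr
    linarith [pi_lt_d2]
  have hprod := prod_one_sub_bounds (Finset.Ioc m U)
    (fun i => halfSinSq N j / sin (omega N * i / 2) ^ 2) (fun i _ => by positivity)
    (fun i hi => by
      have := windowProd_nonneg_factor hj hi
      exact (div_lt_one (hhs0.trans_lt this)).2 this |>.le)
  have hsum : ∑ i ∈ Finset.Ioc m U, halfSinSq N j / sin (omega N * i / 2) ^ 2 =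
      omega N / 4 * σ * y := by
    rw [hσdef, Finset.mul_sum, Finset.sum_mul]
    refine Finset.sum_congr rfl fun i _ => ?_
    rw [hhs]; ring
  have hsq : ∑ i ∈ Finset.Ioc m U, (halfSinSq N j / sin (omega N * i / 2) ^ 2) ^ 2 ≤
      7 * omega N * y ^ 2 := by
    have h1 : ∀ i ∈ Finset.Ioc m U, (halfSinSq N j / sin (omega N * i / 2) ^ 2) ^ 2 ≤
        omega N ^ 2 * y ^ 2 := by
      intro i hi
      rw [Finset.mem_Ioc] at hi
      have h2 := one_div_sin_sq_le (N := N) (i := i) (by omega) (by omega)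
      have h3 : halfSinSq N j / sin (omega N * i / 2) ^ 2 ≤ omega N * y := by
        rw [hhs, div_eq_mul_one_div]
        calc omega N * y / 4 * (1 / sin (omega N * i / 2) ^ 2) ≤ omega N * y / 4 * 4 := by gcongr
          _ = _ := by ring
      rw [← mul_pow]
      have h4 : 0 ≤ halfSinSq N j / sin (omega N * i / 2) ^ 2 := by positivity
      exact pow_le_pow_left₀ h4 h3 2
    refine (Finset.sum_le_card_nsmul _ _ _ h1).trans ?_
    rw [Nat.card_Ioc, nsmul_eq_mul]
    have h3 : ((U - m : ℕ) : ℝ) ≤ N := by exact_mod_cast (by omega : U - m ≤ N)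
    calc ((U - m : ℕ) : ℝ) * (omega N ^ 2 * y ^ 2) ≤ N * (omega N ^ 2 * y ^ 2) := by gcongr
      _ = (omega N * N) * (omega N * y ^ 2) := by ring
      _ ≤ 7 * (omega N * y ^ 2) := by
        rw [hωN]
        gcongr
        linarith [pi_lt_d2]
      _ = _ := by ring
  rw [hsum] at hprod
  have hσ' := (abs_le.1 (hσ.trans hsmall)).1
  exact abs_window_sub_exp_le hω.le (by positivity) (by linarith) hσ hy0 hyX hXy hd
    hprod.2.1 hprod.2.2 hsq

/-- The scaled function `windowFun` approximates `x ^ p exp (-x² / 2)`, `x = √ω j`. -/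
lemma exists_abs_windowFun_sub_le (n p : ℕ) :
    ∃ D : ℝ, ∀ (N : ℕ) [NeZero N], 26 * (n + 20) ≤ N → ∀ j : ZMod N,
      |(1 / √(omega N)) ^ (p % 2) * (4 / omega N) ^ (p / 2) *
          windowFun N ((N + n + 2) / 4) p j -
        (√(omega N) * j.valMinAbs) ^ p * exp (-((√(omega N) * j.valMinAbs) ^ 2 / 2))| ≤
      omega N * D * exp (-((√(omega N) * j.valMinAbs) ^ 2 / 24)) := by
  have hdecay : ∀ r : ℕ, ∃ D : ℝ, ∀ x : ℝ,
      |x| ^ r * exp (-(x ^ 2 / 12)) ≤ D * exp (-(x ^ 2 / 24)) := by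
    intro r
    obtain ⟨D, hD⟩ := exists_abs_pow_mul_exp_le r (c := 1 / 24) (by norm_num)
    refine ⟨D, fun x => ?_⟩
    have h1 : exp (-(x ^ 2 / 12)) = exp (-(1 / 24) * x ^ 2) * exp (-(x ^ 2 / 24)) := by
      rw [← exp_add]; ring_nf
    rw [h1, ← mul_assoc]
    exact mul_le_mul_of_nonneg_right (hD x) (exp_pos _).le
  obtain ⟨D1, hD1⟩ := hdecay p
  obtain ⟨D2, hD2⟩ := hdecay (p + 4)
  obtain ⟨D3, hD3⟩ := hdecay (p + 2)
  set C : ℝ := (n + 20 : ℝ) + 22 with hC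
  have hC0 : 0 ≤ C := by positivity
  refine ⟨C * (D1 + D2) + (p + 1) * D3, fun N _ hN j => ?_⟩
  have hω := omega_pos (N := N)
  have hωN := omega_mul_natCast (N := N)
  set m := (N + n + 2) / 4 with hm
  set x := √(omega N) * j.valMinAbs with hx
  set E := exp (-(x ^ 2 / 12)) with hE
  have hE0 : 0 < E := exp_pos _
  have hHE : exp (-(x ^ 2 / 2)) ≤ E := exp_le_exp.2 (by nlinarith [sq_nonneg x])
  suffices hmain : |(1 / √(omega N)) ^ (p % 2) * (4 / omega N) ^ (p / 2) * windowFun N m p j -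
      x ^ p * exp (-(x ^ 2 / 2))| ≤
      omega N * (C * (|x| ^ p + |x| ^ (p + 4)) + (p + 1) * |x| ^ (p + 2)) * E by
    refine hmain.trans ?_
    have e1 := hD1 x
    have e2 := hD2 x
    have e3 := hD3 x
    rw [mul_assoc, mul_assoc]
    refine mul_le_mul_of_nonneg_left ?_ hω.le
    calc _ = C * (|x| ^ p * E + |x| ^ (p + 4) * E) + (p + 1) * (|x| ^ (p + 2) * E) := by ring
      _ ≤ C * (D1 * exp (-(x ^ 2 / 24)) + D2 * exp (-(x ^ 2 / 24))) +
          (p + 1) * (D3 * exp (-(x ^ 2 / 24))) := by gcongr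
      _ = _ := by ring
  -- Beyond `m` the window vanishes and `ω x² ≥ 1`, so the Gaussian is itself within the error.
  by_cases hj : j.valMinAbs.natAbs ≤ m
  · obtain ⟨hy0, hyX, -, hd⟩ := four_mul_halfSinSq_div_bounds j
    obtain ⟨hGE, hGH⟩ := windowProd_bounds (p := p) hm hN hj
    have h1 := abs_window_mul_sub_le hω.le (abs_sinFun_div_sub_le j) hy0 hyX hd
      (windowProd_pos hj).le hGE (exp_pos _).le hHE hGH p
    refine le_trans (le_of_eq ?_) h1
    congr 2
    rw [windowFun, div_pow, div_pow, div_pow, one_pow, mul_div_assoc, mul_pow, div_pow]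
    ring
  · rw [windowFun_eq_zero (by omega), mul_zero, zero_sub, abs_neg, abs_mul, abs_pow,
      abs_of_pos (exp_pos _)]
    have hX : 1 ≤ omega N * x ^ 2 := by
      have h1 : x ^ 2 = omega N * (j.valMinAbs.natAbs : ℝ) ^ 2 := by
        rw [hx, mul_pow, sq_sqrt hω.le, Nat.cast_natAbs, Int.cast_abs, sq_abs]
      have h2 : (N : ℝ) ≤ 6 * j.valMinAbs.natAbs := by
        exact_mod_cast (by omega : N ≤ 6 * j.valMinAbs.natAbs)
      have h3 : 1 ≤ omega N * j.valMinAbs.natAbs := by nlinarith [pi_gt_three]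
      rw [h1]
      nlinarith
    have hx0 : 0 ≤ |x| ^ p * E := by positivity
    calc |x| ^ p * exp (-(x ^ 2 / 2)) ≤ |x| ^ p * E := by gcongr
      _ ≤ (omega N * x ^ 2) * (|x| ^ p * E) := le_mul_of_one_le_left hx0 hX
      _ = omega N * (|x| ^ (p + 2)) * E := by rw [← sq_abs x]; ring
      _ ≤ _ := by
        gcongr
        have h4 : 0 ≤ C * (|x| ^ p + |x| ^ (p + 4)) := by positivity
        have h5 : 0 ≤ (p : ℝ) * |x| ^ (p + 2) := by positivity
        linarith

end Approximation

section NormApproximation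

open Real Polynomial

/-- Riemann sums of a Gaussian with step `√ω` are bounded uniformly in `N`. -/
lemma exists_sqrt_omega_mul_sum_exp_le :
    ∃ D : ℝ, 0 ≤ D ∧ ∀ N : ℕ, 0 < N →
      √(omega N) * ∑ k ∈ indexSet N, exp (-((√(omega N) * k) ^ 2 / 12)) ≤ D := by
  obtain ⟨D, hD⟩ := exists_norm_sum_gaussPoly_sub_integral_le 1 (c := 1 / 6) (by norm_num)
  set I := ∫ x, gaussPoly 1 x
  refine ⟨√(12 * π) * (|D| + ‖I‖), by positivity, fun N hN => ?_⟩
  have hN1 : (1 : ℝ) ≤ N := by exact_mod_cast hN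
  set h := √(1 / 6 / (N : ℝ)) with hh
  have hωh : √(omega N) = √(12 * π) * h := by
    rw [hh, ← sqrt_mul (by positivity), omega]
    congr 1
    ring
  have hterm : ∀ k : ℤ, gaussPoly 1 (h * k) = (exp (-((√(omega N) * k) ^ 2 / 12)) : ℝ) := by
    intro k
    rw [gaussPoly, eval_one, one_mul]
    congr 2
    rw [hωh, mul_pow, mul_pow, mul_pow, sq_sqrt (by positivity), sq_sqrt (by positivity)]
    ring
  have h1 := hD N hN
  simp only [← hh, hterm] at h1
  rw [← Complex.ofReal_sum, ← Complex.ofReal_mul] at h1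
  set S := ∑ k ∈ indexSet N, exp (-((√(omega N) * k) ^ 2 / 12)) with hS
  have hS0 : 0 ≤ S := Finset.sum_nonneg fun k _ => (exp_pos _).le
  have h2 : D / N ≤ |D| := by
    refine (le_abs_self _).trans ?_
    rw [abs_div, Nat.abs_cast]
    exact div_le_self (abs_nonneg _) hN1
  have h3 : h * S ≤ |D| + ‖I‖ := by
    have h4 : ‖((h * S : ℝ) : ℂ)‖ = h * S := by
      rw [Complex.norm_real, norm_of_nonneg (by positivity)]
    rw [← h4]
    have := norm_sub_norm_le ((h * S : ℝ) : ℂ) I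
    linarith
  rw [hωh, mul_assoc]
  gcongr

/-- Doubly concentrated vectors approximate the samples of the Hermite functions. -/
lemma exists_mem_biWidthSub_norm_sub_le (n : ℕ) :
    ∃ D : ℝ, 0 ≤ D ∧ ∀ (N : ℕ) [NeZero N], 26 * (n + 20) ≤ N →
      ∃ w ∈ biWidthSub N ((N + n + 2) / 4), ‖w - hermiteVec N n‖ ≤ D / N := by
  choose A hA using fun p => exists_abs_windowFun_sub_le n p
  obtain ⟨S, hS0, hS⟩ := exists_sqrt_omega_mul_sum_exp_le
  set c : ℕ → ℝ := fun p => hermiteConst n * (hermitePoly n).coeff p with hc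
  set B := ∑ p ∈ Finset.range (n + 1), |c p| * |A p| with hB
  have hB0 : 0 ≤ B := Finset.sum_nonneg fun p _ => by positivity
  refine ⟨2 * π * (B * √S), by positivity, fun N _ hN => ?_⟩
  have hω := omega_pos (N := N)
  have hωN := omega_mul_natCast (N := N)
  have hN' : (0 : ℝ) < N := Nat.cast_pos.2 (NeZero.pos N)
  set m := (N + n + 2) / 4 with hm
  set a : ℕ → ℝ := fun p => (1 / √(omega N)) ^ (p % 2) * (4 / omega N) ^ (p / 2) with ha
  set w : Vec N := ∑ p ∈ Finset.range (n + 1),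
    (omega N ^ (1 / 4 : ℝ) * c p * a p) • ofZfun (windowFun N m p) with hw
  have hw' : ∀ k : indexSet N, w k = omega N ^ (1 / 4 : ℝ) * ∑ p ∈ Finset.range (n + 1),
      c p * (a p * windowFun N m p (indexEquiv N k)) := by
    intro k
    rw [← zfun_apply_index, hw, zfun_sum, Finset.sum_apply, Finset.mul_sum]
    refine Finset.sum_congr rfl fun p _ => ?_
    rw [zfun_smul, Pi.smul_apply, zfun_ofZfun, smul_eq_mul]
    ring
  have hΨ : ∀ k : indexSet N, hermiteVec N n k = omega N ^ (1 / 4 : ℝ) *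
      ∑ p ∈ Finset.range (n + 1), c p * ((√(omega N) * (k : ℤ)) ^ p *
        exp (-((√(omega N) * (k : ℤ)) ^ 2 / 2))) := by
    intro k
    have hdeg : (hermitePoly n).natDegree < n + 1 :=
      Nat.lt_succ_of_le (natDegree_le_iff_coeff_eq_zero.2 fun k hk =>
        hermitePoly_coeff_eq_zero (Or.inl hk))
    rw [hermiteVec_apply, eval_eq_sum_range' hdeg, Finset.sum_mul, Finset.mul_sum, neg_div]
    congr 1
    refine Finset.sum_congr rfl fun p _ => ?_
    simp only [hc]
    ring
  refine ⟨w, Submodule.sum_mem _ fun p hp => ?_, ?_⟩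
  · by_cases hpn : p % 2 = n % 2
    · exact Submodule.smul_mem _ _ (mem_biWidthSub_windowFun (by omega)
        (Nat.lt_succ_iff.1 (Finset.mem_range.1 hp)) hpn)
    · have : c p = 0 := by simp only [hc, hermitePoly_coeff_eq_zero (Or.inr hpn), mul_zero]
      rw [this, mul_zero, zero_mul, zero_smul]
      exact zero_mem _
  have hpt : ∀ k : indexSet N, |(w - hermiteVec N n) k| ≤
      omega N ^ (1 / 4 : ℝ) * (omega N * B * exp (-((√(omega N) * (k : ℤ)) ^ 2 / 24))) := by
    intro k
    rw [PiLp.sub_apply, hw', hΨ, ← mul_sub, abs_mul, abs_of_nonneg (rpow_nonneg hω.le _),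
      ← Finset.sum_sub_distrib]
    refine mul_le_mul_of_nonneg_left ?_ (rpow_nonneg hω.le _)
    refine (Finset.abs_sum_le_sum_abs _ _).trans ?_
    rw [hB, Finset.mul_sum, Finset.sum_mul]
    refine Finset.sum_le_sum fun p _ => ?_
    rw [← mul_sub, abs_mul]
    have h1 := hA p N hN (indexEquiv N k)
    rw [valMinAbs_indexEquiv] at h1
    calc _ ≤ |c p| * (omega N * A p * exp (-((√(omega N) * (k : ℤ)) ^ 2 / 24))) :=
          mul_le_mul_of_nonneg_left h1 (abs_nonneg _)
      _ ≤ |c p| * (omega N * |A p| * exp (-((√(omega N) * (k : ℤ)) ^ 2 / 24))) := by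
          gcongr
          exact le_abs_self _
      _ = _ := by ring
  have hsq : ‖w - hermiteVec N n‖ ^ 2 ≤ (omega N * (B * √S)) ^ 2 := by
    rw [EuclideanSpace.norm_sq_eq]
    calc _ ≤ ∑ k : indexSet N, (omega N * B) ^ 2 *
          (√(omega N) * exp (-((√(omega N) * (k : ℤ)) ^ 2 / 12))) := by
          refine Finset.sum_le_sum fun k _ => ?_
          refine (pow_le_pow_left₀ (norm_nonneg _) (hpt k) 2).trans (le_of_eq ?_)
          have h1 : exp (-((√(omega N) * (k : ℤ)) ^ 2 / 24)) ^ 2 =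
              exp (-((√(omega N) * (k : ℤ)) ^ 2 / 12)) := by
            rw [← exp_nat_mul]
            congr 1
            push_cast
            ring
          rw [← h1]
          generalize exp (-((√(omega N) * (k : ℤ)) ^ 2 / 24)) = e
          rw [← omega_rpow_sq]
          ring
      _ = (omega N * B) ^ 2 * (√(omega N) *
          ∑ k ∈ indexSet N, exp (-((√(omega N) * k) ^ 2 / 12))) := by
          rw [← Finset.mul_sum, ← Finset.mul_sum,
            ← Finset.sum_coe_sort (indexSet N) fun k => exp (-((√(omega N) * k) ^ 2 / 12))]
      _ ≤ (omega N * B) ^ 2 * S := by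
          gcongr
          exact hS N (NeZero.pos N)
      _ = _ := by rw [← mul_assoc, mul_pow _ (√S), sq_sqrt hS0]
  refine ((sq_le_sq₀ (norm_nonneg _) (by positivity)).1 hsq).trans (le_of_eq ?_)
  rw [← hωN]
  field_simp

end NormApproximation

section Convergence

/-! ### Convergence of minimal Hermite-type bases -/

/-- Parseval's identity, with at most `K` coefficients that are bounded by `E` instead of being
dominated by those of `u`. -/
lemma norm_sq_le_add_card_mul {N : ℕ} (T : OrthonormalBasis (Fin N) ℝ (Vec N)) {r u : Vec N}
    {K : ℕ} {E : ℝ}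
    (h : ∀ j : Fin N, |(inner ℝ (T j) r : ℝ)| ≤ |(inner ℝ (T j) u : ℝ)| ∨
      ((j : ℕ) < K ∧ |(inner ℝ (T j) r : ℝ)| ≤ E)) :
    ‖r‖ ^ 2 ≤ ‖u‖ ^ 2 + K * E ^ 2 := by
  rw [← T.sum_sq_norm_inner_right r, ← T.sum_sq_norm_inner_right u]
  have hK : ∑ j : Fin N, (if (j : ℕ) < K then E ^ 2 else 0) ≤ K * E ^ 2 := by
    rw [Fin.sum_univ_eq_sum_range (fun j => if j < K then E ^ 2 else 0), ← Finset.sum_filter,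
      Finset.sum_const, nsmul_eq_mul]
    gcongr
    calc _ ≤ (Finset.range K).card := Finset.card_le_card fun j hj => by
          simpa using (Finset.mem_filter.1 hj).2
      _ = K := Finset.card_range K
  calc _ ≤ ∑ j : Fin N, (‖(inner ℝ (T j) u : ℝ)‖ ^ 2 + if (j : ℕ) < K then E ^ 2 else 0) := by
        refine Finset.sum_le_sum fun j _ => ?_
        rw [Real.norm_eq_abs, Real.norm_eq_abs]
        rcases h j with hj | ⟨hj, hE⟩
        · have := pow_le_pow_left₀ (abs_nonneg _) hj 2
          split_ifs <;> nlinarith [sq_nonneg E]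
        · rw [if_pos hj]
          have := pow_le_pow_left₀ (abs_nonneg _) hE 2
          nlinarith [sq_nonneg |(inner ℝ (T j) u : ℝ)|]
    _ ≤ _ := by
        rw [Finset.sum_add_distrib]
        gcongr

/-- The sign of a real number, with the value `1` at `0`. -/
noncomputable def unitSign (x : ℝ) : ℝ := if 0 ≤ x then 1 else -1

lemma unitSign_eq (x : ℝ) : unitSign x = 1 ∨ unitSign x = -1 := by
  unfold unitSign
  split_ifs
  · exact Or.inl rfl
  · exact Or.inr rfl

lemma abs_unitSign_sub (x : ℝ) : |unitSign x - x| = abs (1 - |x|) := by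
  unfold unitSign
  split_ifs with h
  · rw [abs_of_nonneg h]
  · rw [abs_of_neg (not_le.1 h), ← abs_neg]
    congr 1
    ring

/-- A nearly normalized vector near the line spanned by a unit vector `t` is near `± t`. -/
lemma norm_unitSign_smul_sub_le {V : Type*} [NormedAddCommGroup V] [InnerProductSpace ℝ V]
    {t v : V} (ht : ‖t‖ = 1) :
    ‖unitSign (inner ℝ t v) • t - v‖ ≤
      2 * ‖v - (inner ℝ t v : ℝ) • t‖ + |(inner ℝ v v : ℝ) - 1| := by
  set c : ℝ := inner ℝ t v
  have h1 : unitSign c • t - v = (unitSign c - c) • t - (v - c • t) := by module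
  have h2 : abs (‖v‖ - |c|) ≤ ‖v - c • t‖ := by
    have := abs_norm_sub_norm_le v (c • t)
    rwa [norm_smul, ht, mul_one, Real.norm_eq_abs] at this
  have h3 : |1 - ‖v‖| ≤ |(inner ℝ v v : ℝ) - 1| := by
    rw [real_inner_self_eq_norm_sq, show ‖v‖ ^ 2 - 1 = (‖v‖ + 1) * (‖v‖ - 1) by ring, abs_mul,
      abs_sub_comm, abs_of_nonneg (by positivity : 0 ≤ ‖v‖ + 1)]
    exact le_mul_of_one_le_left (abs_nonneg _) (by linarith [norm_nonneg v])
  rw [h1]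
  refine (norm_sub_le _ _).trans ?_
  rw [norm_smul, ht, mul_one, Real.norm_eq_abs, abs_unitSign_sub]
  have := abs_sub_le 1 ‖v‖ |c|
  linarith

/-- The samples of the `n`-th Hermite function are almost orthogonal to the eigenvectors for the
eigenvalues other than `(-i) ^ n`. -/
lemma exists_abs_inner_hermiteVec_le (n : ℕ) :
    ∃ D : ℝ, 0 ≤ D ∧ ∀ (N : ℕ) [NeZero N] (j : ℕ) (t : Vec N), j % 4 ≠ n % 4 →
      t ∈ eigenSub N ((-Complex.I) ^ j) → ‖t‖ = 1 →
      |(inner ℝ (hermiteVec N n) t : ℝ)| ≤ D / N := by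
  obtain ⟨D, hD0, hD⟩ := exists_norm_unitaryDft_hermiteVec_sub_le n
  refine ⟨D, hD0, fun N _ j t hj ht htn => ?_⟩
  have hN' : (0 : ℝ) < N := Nat.cast_pos.2 (NeZero.pos N)
  have hN1 : (1 : ℝ) ≤ N := by exact_mod_cast NeZero.pos N
  have h1 := congrArg norm (sub_mul_inner_eq_sum (μ := (-Complex.I) ^ n) (a := hermiteVec N n) ht)
  rw [norm_mul, Complex.norm_real, Real.norm_eq_abs] at h1
  have h2 : ∀ k : ZMod N, ‖czfun t k‖ ≤ 1 := fun k => by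
    rw [czfun, Complex.norm_real, ← htn, zfun]
    exact PiLp.norm_apply_le t _
  calc |(inner ℝ (hermiteVec N n) t : ℝ)|
      ≤ ‖(-Complex.I) ^ j - (-Complex.I) ^ n‖ * |(inner ℝ (hermiteVec N n) t : ℝ)| :=
        le_mul_of_one_le_left (abs_nonneg _) (one_le_norm_neg_I_pow_sub hj)
    _ ≤ ∑ k : ZMod N, D / (N : ℝ) ^ 3 := by
        rw [h1]
        refine (norm_sum_le _ _).trans (Finset.sum_le_sum fun k _ => ?_)
        rw [norm_mul]
        exact (mul_le_of_le_one_right (norm_nonneg _) (h2 k)).trans (hD N k)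
    _ = D / N / N := by
        rw [Finset.sum_const, Finset.card_univ, ZMod.card, nsmul_eq_mul]
        field_simp
    _ ≤ D / N := div_le_self (by positivity) hN1

/-- The vectors of a minimal Hermite-type basis, up to the sign, are at the distance `O(1 / N)` from
the samples of the Hermite functions. -/
lemma exists_norm_unitSign_smul_sub_hermiteVec_le (n : ℕ) :
    ∃ D : ℝ, 0 ≤ D ∧ ∀ (N : ℕ) [NeZero N] (T : OrthonormalBasis (Fin N) ℝ (Vec N)),
      IsMinimalHermiteBasis T → ∀ h : n < N, 26 * (n + 20) ≤ N →
      ‖unitSign (inner ℝ (T ⟨n, h⟩) (hermiteVec N n)) • T ⟨n, h⟩ - hermiteVec N n‖ ≤ D / N := by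
  induction n using Nat.strong_induction_on with
  | _ n ih =>
  choose! P hP0 hP using ih
  choose G hG using fun j => exists_abs_inner_hermiteVec_sub_le n j
  obtain ⟨A, hA0, hA⟩ := exists_abs_inner_hermiteVec_le n
  obtain ⟨W, hW0, hW⟩ := exists_mem_biWidthSub_norm_sub_le n
  have hG0 : ∀ j, 0 ≤ G j := fun j => by
    have := (abs_nonneg _).trans (hG j 1 one_pos)
    simpa using this
  set B := ∑ i ∈ Finset.range n, ((1 + G n) * P i + G i) with hB
  have hB0 : ∀ i ∈ Finset.range n, 0 ≤ (1 + G n) * P i + G i := fun i hi => by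
    have h1 := hP0 i (Finset.mem_range.1 hi)
    have h2 := hG0 i
    have h3 := hG0 n
    positivity
  have hB0' : 0 ≤ B := Finset.sum_nonneg hB0
  refine ⟨2 * (W + (n + 4) * (A + B)) + G n, by have := hG0 n; positivity, fun N _ T hT h hN => ?_⟩
  have hN' : (0 : ℝ) < N := Nat.cast_pos.2 (NeZero.pos N)
  have hN1 : (1 : ℝ) ≤ N := by exact_mod_cast NeZero.pos N
  set v := hermiteVec N n with hv
  have hvv : |(inner ℝ v v : ℝ) - 1| ≤ G n / N := by simpa using hG n N (NeZero.pos N)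
  have hvn : ‖v‖ ≤ 1 + G n := by
    have h1 : G n / N ≤ G n := div_le_self (hG0 n) hN1
    have h2 := (abs_le.1 hvv).2
    rw [real_inner_self_eq_norm_sq] at h2
    nlinarith [hG0 n, norm_nonneg v]
  obtain ⟨w, hw, hwv⟩ := hW N hN
  set m := (N + n + 2) / 4 with hm
  have hT' := (isMinimalHermiteBasis_iff T).1 hT
  have hsmall : ∀ j : Fin N, (j : ℕ) < n + 4 → (j : ℕ) ≠ n →
      |(inner ℝ (T j) v : ℝ)| ≤ (A + B) / N := by
    intro j hj hjn
    rw [add_div]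
    -- An index `j < n + 4` congruent to `n` modulo `4` and different from `n` is smaller than `n`,
    -- so that the induction hypothesis applies; otherwise the eigenvalues differ.
    by_cases hjn4 : (j : ℕ) % 4 = n % 4
    · have hlt : (j : ℕ) < n := by omega
      set s := unitSign (inner ℝ (T j) (hermiteVec N j)) with hs
      have h1 : ‖s • T j - hermiteVec N j‖ ≤ P j / N := hP j hlt N T hT j.2 (by omega)
      have h2 : |(inner ℝ v (hermiteVec N j) : ℝ)| ≤ G j / N := by
        have := hG j N (NeZero.pos N)
        rwa [if_neg hlt.ne', sub_zero] at this
      have h3 : |(inner ℝ (T j) v : ℝ)| = |(inner ℝ v (s • T j) : ℝ)| := by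
        rw [inner_smul_right, abs_mul, real_inner_comm]
        rcases unitSign_eq (inner ℝ (T j) (hermiteVec N j)) with h | h <;> simp [hs, h]
      have h4 : (inner ℝ v (s • T j) : ℝ) =
          inner ℝ v (s • T j - hermiteVec N j) + inner ℝ v (hermiteVec N j) := by
        rw [← inner_add_right, sub_add_cancel]
      have h5 : |(inner ℝ v (s • T j - hermiteVec N j) : ℝ)| ≤ (1 + G n) * (P j / N) :=
        (abs_real_inner_le_norm _ _).trans (mul_le_mul hvn h1 (norm_nonneg _)
          (by linarith [hG0 n]))
      have h6 : (1 + G n) * P j + G j ≤ B :=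
        Finset.single_le_sum hB0 (Finset.mem_range.2 hlt)
      have h7 : ((1 + G n) * P j + G j) / N ≤ B / N := by gcongr
      have h8 : (1 + G n) * (P j / N) + G j / N = ((1 + G n) * P j + G j) / N := by ring
      have h9 : 0 ≤ A / N := by positivity
      rw [h3, h4]
      refine (abs_add_le _ _).trans ?_
      linarith
    · obtain ⟨μ, hμ, hμT⟩ := hT'.1 j
      rw [hμ (by omega)] at hμT
      have h1 := hA N j (T j) hjn4 hμT (T.norm_eq_one j)
      have h2 : 0 ≤ B / N := by positivity
      rw [real_inner_comm]
      linarith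
  set t := T ⟨n, h⟩ with ht
  set r := v - (inner ℝ t v : ℝ) • t with hr
  -- The residual `r` has small coefficients at `j < n + 4`; at the others its coefficients are
  -- those of `v - w`, because `w` is orthogonal to these `T j`.
  have hrj : ∀ j : Fin N, (inner ℝ (T j) r : ℝ) =
      if (j : ℕ) = n then 0 else inner ℝ (T j) v := by
    intro j
    rw [hr, inner_sub_right, inner_smul_right]
    split_ifs with hjn
    · have : T j = t := congrArg T (Fin.ext hjn)
      rw [this, real_inner_self_eq_norm_sq, T.norm_eq_one]
      ring
    · rw [ht, T.orthonormal.2 fun hj => hjn (congrArg Fin.val hj), mul_zero, sub_zero]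
  have hr1 : ‖r‖ ^ 2 ≤ ‖v - w‖ ^ 2 + (n + 4 : ℕ) * ((A + B) / N) ^ 2 := by
    refine norm_sq_le_add_card_mul T fun j => ?_
    rw [hrj]
    split_ifs with hjn
    · left
      rw [abs_zero]
      exact abs_nonneg _
    · rcases lt_or_ge (j : ℕ) (n + 4) with hj | hj
      · exact Or.inr ⟨hj, hsmall j hj hjn⟩
      · left
        rw [inner_sub_right, inner_eq_zero_of_mem_biWidthSub hT (by omega) (by omega) hw (by omega),
          sub_zero]
  have hr2 : ‖r‖ ≤ (W + (n + 4) * (A + B)) / N := by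
    have hwv' : ‖v - w‖ ≤ W / N := by rwa [norm_sub_rev]
    have h1 : 0 ≤ W / N := by positivity
    have h2 : 0 ≤ (A + B) / N := by positivity
    refine (sq_le_sq₀ (norm_nonneg _) (by positivity)).1 (hr1.trans ?_)
    have h3 : ‖v - w‖ ^ 2 ≤ (W / N) ^ 2 := pow_le_pow_left₀ (norm_nonneg _) hwv' 2
    have h4 : (W + (n + 4) * (A + B)) / N = W / N + (n + 4) * ((A + B) / N) := by ring
    rw [h4]
    push_cast
    have hn : (0 : ℝ) ≤ n := Nat.cast_nonneg n
    generalize (A + B) / N = e at *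
    generalize W / N = f at *
    have h5 : ((n : ℝ) + 4) * e ^ 2 ≤ ((n + 4) * e) ^ 2 := by
      rw [mul_pow]
      gcongr
      nlinarith
    have h6 : 0 ≤ f * ((n + 4) * e) := by positivity
    nlinarith
  refine (norm_unitSign_smul_sub_le (T.norm_eq_one _)).trans ?_
  have h1 : (2 * (W + (n + 4) * (A + B)) + G n) / N =
      2 * ((W + (n + 4) * (A + B)) / N) + G n / N := by ring
  rw [h1]
  linarith

end Convergence

end MinimalHermite

theorem theorem4 :
    (∀ N : ℕ, 2 ≤ N →
      ∃ T : OrthonormalBasis (Fin N) ℝ (MinimalHermite.Vec N),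
        MinimalHermite.IsMinimalHermiteBasis T) ∧
    ∀ T : (N : ℕ) → OrthonormalBasis (Fin N) ℝ (MinimalHermite.Vec N),
      (∀ N : ℕ, 2 ≤ N → MinimalHermite.IsMinimalHermiteBasis (T N)) →
      ∃ s : (N : ℕ) → Fin N → ℝ,
        (∀ (N : ℕ) (n : Fin N), s N n = 1 ∨ s N n = -1) ∧
        ∀ (n : ℕ) (ε : ℝ), 0 < ε →
          ∃ C : ℝ, ∀ᶠ N : ℕ in Filter.atTop, ∀ h : n < N,
            ‖s N ⟨n, h⟩ • T N ⟨n, h⟩ - MinimalHermite.hermiteVec N n‖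
              ≤ C * (N : ℝ) ^ (-1 + ε) := by
  refine ⟨fun N hN => ?_, fun T hT => ?_⟩
  · have : NeZero N := ⟨by omega⟩
    exact MinimalHermite.exists_isMinimalHermiteBasis hN
  refine ⟨fun N n => MinimalHermite.unitSign (inner ℝ (T N n) (MinimalHermite.hermiteVec N n)),
    fun N n => MinimalHermite.unitSign_eq _, fun n ε hε => ?_⟩
  obtain ⟨D, hD0, hD⟩ := MinimalHermite.exists_norm_unitSign_smul_sub_hermiteVec_le n
  refine ⟨D, Filter.eventually_atTop.2 ⟨26 * (n + 20), fun N hN h => ?_⟩⟩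
  have : NeZero N := ⟨by omega⟩
  have hN1 : (1 : ℝ) ≤ N := by exact_mod_cast NeZero.pos N
  refine (hD N (T N) (hT N (by omega)) h hN).trans ?_
  rw [div_eq_mul_inv, ← Real.rpow_neg_one]
  exact mul_le_mul_of_nonneg_left (Real.rpow_le_rpow_of_exponent_le hN1 (by linarith)) hD0
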